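/- **Setting.** Let $d\ge 1$ be an integer. For a probability density $f$ on $\mathbb R^d$ put $\mathcal X=\{x:f(x)>0\}$, $H(f)=-\int_{\mathcal X} f\log f$ and $\mu_\alpha(f)=\int\|x\|^\alpha f(x)\,dx$; let $V_d=\pi^{d/2}/\Gamma(1+d/2)$, and let $\Psi=\Gamma'/\Gamma$ be the digamma function. Let $\mathcal A$ be the set of non-increasing functions $a:(0,\infty)\to[1,\infty)$ with $a(\delta)=o(\delta^{-\epsilon})$ as $\delta\searrow0$ for every $\epsilon>0$, and let $\Theta=(0,\infty)^4\times\mathcal A$. For $\theta=(\alpha,\beta,\nu,\gamma,a)\in\Theta$ put $m=\lceil\beta\rceil-1$. If $f$ is $m$ times differentiable, write $f^{(t)}(x)$ for the array of its partial derivatives of order $t$ at $x$ and $\|\cdot\|$ for the Euclidean norm of an array, and for $x\in\mathcal X$ let $r_a(x)=\{8d^{1/2}a(f(x))\}^{-1/\min(\beta,1)}$ and $$M_{f,a,\beta}(x)=\max\Bigl\{\max_{1\le t\le m}\frac{\|f^{(t)}(x)\|}{f(x)},\ \sup_{0<\|y-x\|\le r_a(x)}\frac{\|f^{(m)}(y)-f^{(m)}(x)\|}{f(x)\,\|y-x\|^{\beta-m}}\Bigr\}.$$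 Let $\mathcal F_{d,\theta}$ be the class of $m$ times differentiable densities $f$ on $\mathbb R^d$ with $\mu_\alpha(f)\le\nu$, $\sup_x f(x)\le\gamma$, and $\sup_{x:f(x)\ge\delta}M_{f,a,\beta}(x)\le a(\delta)$ for all $\delta>0$. Let $X_1,\dots,X_n$ be independent with density $f$, let $\rho_{(k),i}$ be the distance from $X_i$ to its $k$th nearest neighbour among the other $X_j$, and let $$\hat H_n=\frac1n\sum_{i=1}^n\log\Bigl(\frac{\rho_{(k),i}^d\,V_d\,(n-1)}{e^{\Psi(k)}}\Bigr)$$ be the unweighted Kozachenko--Leonenko estimator. **Statement.** There are real numbers $\Lambda_l(f)$, $l\ge1$, depending only on $d$, $f$ and $l$, such that the following holds for every $\theta=(\alpha,\beta,\nu,\gamma,a)\in\Theta$. Put $\lambda_l=\lambda_l(f)=\Lambda_l(f)$ if $2l<d\alpha/(\alpha+d)$ and $\lambda_l=0$ if $2l\ge d\alpha/(\alpha+d)$. 1. $\sup_{f\in\mathcal F_{d,\theta}}\max_{1\le l\le\lceil\beta/2\rceil-1}|\lambda_l(f)|<\infty$. 2. For every $f\in\mathcal F_{d,\theta}$ the integral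 defining $H(f)$ converges absolutely. Let $k^*=k^*_n$ be any deterministic sequence of positive integers with $k^*=O(n^{1-\epsilon_0})$ as $n\to\infty$ for some $\epsilon_0>0$. Then for every $\epsilon>0$, as $n\to\infty$, uniformly for $k\in\{1,\dots,k^*\}$, $$\sup_{f\in\mathcal F_{d,\theta}}\Bigl|\mathbb E_f(\hat H_n)-H(f)-\sum_{l=1}^{\lceil\beta/2\rceil-1}\frac{\Gamma(k+2l/d)\,\Gamma(n)}{\Gamma(k)\,\Gamma(n+2l/d)}\,\lambda_l(f)\Bigr|=O\Bigl(\max\Bigl\{\Bigl(\frac kn\Bigr)^{\frac{\alpha}{\alpha+d}-\epsilon},\ \Bigl(\frac kn\Bigr)^{\beta/d}\Bigr\}\Bigr),$$ where, for all large $n$, the expectation exists (as an absolutely convergent integral) for all these $k$ and $f$. 3. If $d\ge3$, $\alpha>2d/(d-2)$ and $\beta>2$, then for every $f\in\mathcal F_{d,\theta}$ the following integral converges absolutely and $$\lambda_1(f)=-\frac1{2(d+2)V_d^{2/d}}\int_{\mathcal X}\frac{\Delta f(x)}{f(x)^{2/d}}\,dx.$$ -/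

import Mathlib

namespace KLEntropy

noncomputable section

/-- The class of decreasing (that is, non-increasing) functions `a : (0,∞) → [1,∞)` with
`a(δ) = o(δ^{-ε})` as `δ ↓ 0`, for every `ε > 0`. Only the values on `(0,∞)` matter. -/
def IsGrowthFunction (a : ℝ → ℝ) : Prop :=
  AntitoneOn a (Set.Ioi 0) ∧ (∀ δ, 0 < δ → 1 ≤ a δ) ∧
    ∀ ε : ℝ, 0 < ε →
      Asymptotics.IsLittleO (nhdsWithin (0 : ℝ) (Set.Ioi 0)) a (fun δ => δ ^ (-ε))

/-- The parameter space `Θ = (0,∞)^4 × 𝒜`. -/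
structure Theta where
  α : ℝ
  β : ℝ
  ν : ℝ
  γ : ℝ
  a : ℝ → ℝ
  α_pos : 0 < α
  β_pos : 0 < β
  ν_pos : 0 < ν
  γ_pos : 0 < γ
  a_mem : IsGrowthFunction a

variable {d : ℕ}

/-- `f` is a probability density with respect to Lebesgue measure on `ℝ^d`. -/
def IsDensity (f : EuclideanSpace ℝ (Fin d) → ℝ) : Prop :=
  Measurable f ∧ (∀ x, 0 ≤ f x) ∧ ∫⁻ x, ENNReal.ofReal (f x) = 1

/-- The set `𝒳 = {x : f x > 0}`. -/
def posSet (f : EuclideanSpace ℝ (Fin d) → ℝ) : Set (EuclideanSpace ℝ (Fin d)) :=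
  {x | 0 < f x}

/-- The moment `μ_α(f) = ∫ ‖x‖^α f(x) dx`, as an element of `[0,∞]`. -/
def moment (α : ℝ) (f : EuclideanSpace ℝ (Fin d) → ℝ) : ENNReal :=
  ∫⁻ x, ENNReal.ofReal (‖x‖ ^ α * f x)

/-- The integer `m = ⌈β⌉ - 1` (for `β > 0`). -/
def smoothnessOrder (β : ℝ) : ℕ := ⌈β⌉₊ - 1

/-- `f` is `m` times differentiable on `ℝ^d`: the derivatives of order `0, …, m - 1` exist and are
differentiable everywhere. -/
def TimesDifferentiable (m : ℕ) (f : EuclideanSpace ℝ (Fin d) → ℝ) : Prop :=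
  ∀ j < m, Differentiable ℝ (iteratedFDeriv ℝ j f)

/-- The vectorised Euclidean norm of the `d × ⋯ × d` array of the coordinates of an `m`-linear form.
For the `m`-th derivative of `f` at `x` the entry with index `(j_1, …, j_m)` is the partial
derivative `∂^m f(x) / ∂x_{j_1} ⋯ ∂x_{j_m}`. -/
def arrayNorm {m : ℕ}
    (T : ContinuousMultilinearMap ℝ (fun _ : Fin m => EuclideanSpace ℝ (Fin d)) ℝ) : ℝ :=
  Real.sqrt (∑ j : Fin m → Fin d, (T fun i => EuclideanSpace.single (j i) (1 : ℝ)) ^ 2)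

/-- The radius `r_a(x) = {8 d^{1/2} a(f(x))}^{-1/(β ∧ 1)}`. -/
def radius (f : EuclideanSpace ℝ (Fin d) → ℝ) (a : ℝ → ℝ) (β : ℝ)
    (x : EuclideanSpace ℝ (Fin d)) : ℝ :=
  (8 * Real.sqrt d * a (f x)) ^ (-(1 / min β 1))

/-- The quantity `M_{f,a,β}(x) ∈ [0,∞]` (used only at points with `f x > 0`). -/
def smoothness (f : EuclideanSpace ℝ (Fin d) → ℝ) (a : ℝ → ℝ) (β : ℝ)
    (x : EuclideanSpace ℝ (Fin d)) : ENNReal :=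
  max
    (⨆ t ∈ Finset.Icc 1 (smoothnessOrder β),
      ENNReal.ofReal (arrayNorm (iteratedFDeriv ℝ t f x) / f x))
    (⨆ y ∈ Metric.closedBall x (radius f a β x) \ {x},
      ENNReal.ofReal
        (arrayNorm (iteratedFDeriv ℝ (smoothnessOrder β) f y
            - iteratedFDeriv ℝ (smoothnessOrder β) f x) /
          (f x * ‖y - x‖ ^ (β - (smoothnessOrder β : ℝ)))))

/-- The class `ℱ_{d,θ}` of densities on `ℝ^d`. -/
def densityClass (d : ℕ) (θ : Theta) : Set (EuclideanSpace ℝ (Fin d) → ℝ) :=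
  {f | IsDensity f ∧ TimesDifferentiable (smoothnessOrder θ.β) f ∧
    moment θ.α f ≤ ENNReal.ofReal θ.ν ∧
    (∀ x, f x ≤ θ.γ) ∧
    ∀ δ : ℝ, 0 < δ →
      (⨆ x ∈ {x | δ ≤ f x}, smoothness f θ.a θ.β x) ≤ ENNReal.ofReal (θ.a δ)}

/-- The differential entropy `H(f) = -∫_𝒳 f log f`. -/
def entropy (f : EuclideanSpace ℝ (Fin d) → ℝ) : ℝ :=
  -∫ x in posSet f, f x * Real.log (f x)

/-- The volume `V_d = π^{d/2} / Γ(1 + d/2)` of the unit ball of `ℝ^d`. -/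
def unitBallVolume (d : ℕ) : ℝ :=
  Real.pi ^ ((d : ℝ) / 2) / Real.Gamma (1 + (d : ℝ) / 2)

/-- The digamma function `Ψ = Γ'/Γ`. -/
def digamma (x : ℝ) : ℝ := logDeriv Real.Gamma x

/-- The distance `ρ_{(k),i}` from `X i` to its `k`-th nearest neighbour among the other sample
points: the least `r ≥ 0` such that at least `k` of the points `X j`, `j ≠ i`, are within distance
`r` of `X i` (for `1 ≤ k ≤ n - 1`). -/
def nnDist {n : ℕ} (k : ℕ) (X : Fin n → EuclideanSpace ℝ (Fin d)) (i : Fin n) : ℝ :=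
  sInf {r : ℝ | 0 ≤ r ∧ k ≤ (Finset.univ.filter fun j => j ≠ i ∧ ‖X j - X i‖ ≤ r).card}

/-- The (unweighted) Kozachenko--Leonenko entropy estimator. -/
def klEstimator (n k : ℕ) (X : Fin n → EuclideanSpace ℝ (Fin d)) : ℝ :=
  (1 / (n : ℝ)) * ∑ i : Fin n,
    Real.log (nnDist k X i ^ d * unitBallVolume d * ((n : ℝ) - 1) / Real.exp (digamma k))

/-- The joint law of `n` independent random vectors with density `f`. -/
def sampleLaw (f : EuclideanSpace ℝ (Fin d) → ℝ) (n : ℕ) :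
    MeasureTheory.Measure (Fin n → EuclideanSpace ℝ (Fin d)) :=
  MeasureTheory.Measure.pi fun _ : Fin n =>
    MeasureTheory.volume.withDensity fun x => ENNReal.ofReal (f x)

/-- The factor `Γ(k + 2l/d) Γ(n) / (Γ(k) Γ(n + 2l/d))`. -/
def gammaFactor (d n k l : ℕ) : ℝ :=
  Real.Gamma (k + 2 * l / d) * Real.Gamma n / (Real.Gamma k * Real.Gamma (n + 2 * l / d))

end

end KLEntropy

/-!
For a point `x` with `f x > 0` let `R` be the distance from `x` to its `k`-th nearest neighbour
among the `n - 1` other points, and let `S = h_x(R)` be the mass of the ball about `x` of radius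
`R`. The argument rests on two facts.

The law of `S` is the same for every `x`: by the probability integral transform `S` is distributed
as the `k`-th smallest of `n - 1` uniform variables, that is, it has the beta distribution with
parameters `k` and `n - k` (`map_ballMass_kthDist`). Hence `E (S ^ τ)` is the ratio
`Γ(k + τ) Γ(n) / (Γ(k) Γ(n + τ))` and `E (log S) = Ψ(k) - Ψ(n)`. With
`T = log (V_d f(x) R ^ d / S)` (`logRatio`), a summand of the estimator is
`T + log S - log f(x) + log (n - 1) - Ψ(k)` (`klSummand_eq`), so that its mean exceeds the entropy
by `E T + log (n - 1) - Ψ(n)`, and the last difference is at most `1 / (n - 1)`.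

For small `r`, Taylor's formula gives
`h_x(r) = V_d f(x) r ^ d (1 + c_1 r ^ 2 + c_2 r ^ 4 + ⋯ + O(r ^ β))`, the odd orders vanishing by
symmetry (`abs_ballMass_sub_le`). Taking logarithms and changing the variable from `r ^ 2` to
`h_x(r) ^ (2 / d)` (`exists_log_expansion`), one finds
`T = ∑ e_l(x) S ^ (2 l / d) + O(S ^ (β / d))` with coefficients `e_l(x)` (`expansionCoef`) that
are successive limits as `r → 0`, and therefore depend on `f` and `x` only. The coefficients
`Λ_l(f)` are the integrals of `f e_l`.

The constants in the expansion at `x` grow like powers of the inverse of `goodMass d θ (f x)`,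
roughly the mass of the largest ball on which Taylor's formula is used, and `goodMass d θ δ` is at
least a constant times `δ` to a power as close to `1` as desired, since `a(δ) = o(δ ^ (-ε))`
(`exists_goodMass_rpow_le`). Interpolating between the small radii and a crude bound for the large
ones gives, for all radii, `|T - ∑ e_l(x) S ^ (2 l / d)| ≤ C f(x) ^ (-τ') S ^ τ (1 + R ^ η)`,
where the sum runs over the `l` with `2 l / d ≤ τ`, and `τ ≤ β / d`, `τ < τ'` with `τ'` close to
`τ` and `η` small (`exists_truncated_expansion_bound`). The moment condition makes `f ^ (-τ')`
integrable, uniformly over the class, whenever `τ' < α / (α + d)` (`exists_lintegral_rpow_le`),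
and it bounds the moments of `R` of small order. Instead of Hölder's inequality, the factors `S`
and `R` are separated by the weighted arithmetic-geometric mean inequality, with weights adapted
to `E S = k / n`; the result is an error of order `(k / n) ^ τ`
(`exists_lintegral_truncError_le`). No truncation of the density is needed, and the growth
condition on `k` serves only to have `2 k ≤ n`.

The first coefficient comes from the second moments of the uniform law on a ball
(`expansionCoef_one`).
-/

namespace KLEntropy

open MeasureTheory Finset
open scoped Pointwise

/-! ### Expansions with a uniform remainder -/

section

/-- `HasExp b L j G`: uniformly in the index `i`, the functions `G i` have on `(0, 1]` an expansion
`∑_{l=j}^L g_{i,l} t^l + O(t^b)` with bounded coefficients. -/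
def HasExp {ι : Type*} (b : ℝ) (L j : ℕ) (G : ι → ℝ → ℝ) : Prop :=
  ∃ (g : ι → ℕ → ℝ) (K : ℝ), 0 ≤ K ∧ (∀ i l, |g i l| ≤ K) ∧
    ∀ i, ∀ t ∈ Set.Ioc (0 : ℝ) 1, |G i t - ∑ l ∈ Icc j L, g i l * t ^ l| ≤ K * t ^ b

namespace HasExp

variable {ι : Type*} {b : ℝ} {L j k : ℕ} {F G : ι → ℝ → ℝ}

theorem congr (hF : HasExp b L j F) (h : ∀ i, ∀ t ∈ Set.Ioc (0 : ℝ) 1, G i t = F i t) :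
    HasExp b L j G := by
  obtain ⟨g, K, hK, hg, hG⟩ := hF
  exact ⟨g, K, hK, hg, fun i t ht => by rw [h i t ht]; exact hG i t ht⟩

theorem add (hF : HasExp b L j F) (hG : HasExp b L j G) :
    HasExp b L j (fun i t => F i t + G i t) := by
  obtain ⟨f, K, hK, hf, hF⟩ := hF
  obtain ⟨g, K', hK', hg, hG⟩ := hG
  refine ⟨fun i l => f i l + g i l, K + K', by positivity,
    fun i l => (abs_add_le _ _).trans (add_le_add (hf i l) (hg i l)), fun i t ht => ?_⟩
  have : F i t + G i t - ∑ l ∈ Icc j L, (f i l + g i l) * t ^ l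
      = (F i t - ∑ l ∈ Icc j L, f i l * t ^ l) + (G i t - ∑ l ∈ Icc j L, g i l * t ^ l) := by
    simp only [add_mul, sum_add_distrib]; ring
  rw [this, add_mul]
  exact (abs_add_le _ _).trans (add_le_add (hF i t ht) (hG i t ht))

theorem smul (c : ι → ℝ) {C : ℝ} (hc : ∀ i, |c i| ≤ C) (hF : HasExp b L j F) :
    HasExp b L j (fun i t => c i * F i t) := by
  obtain ⟨f, K, hK, hf, hF⟩ := hF
  refine ⟨fun i l => c i * f i l, |C| * K, by positivity, fun i l => ?_, fun i t ht => ?_⟩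
  · rw [abs_mul]
    exact mul_le_mul ((hc i).trans (le_abs_self C)) (hf i l) (abs_nonneg _) (abs_nonneg _)
  · have : c i * F i t - ∑ l ∈ Icc j L, c i * f i l * t ^ l
        = c i * (F i t - ∑ l ∈ Icc j L, f i l * t ^ l) := by
      rw [mul_sub, mul_sum]; simp only [mul_assoc]
    rw [this, abs_mul, mul_assoc]
    exact mul_le_mul ((hc i).trans (le_abs_self C)) (hF i t ht) (abs_nonneg _) (abs_nonneg _)

theorem of_le {C : ℝ} (h : ∀ i, ∀ t ∈ Set.Ioc (0 : ℝ) 1, |G i t| ≤ C * t ^ b) :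
    HasExp b L j G := by
  refine ⟨fun _ _ => 0, |C|, abs_nonneg _, by simp, fun i t ht => ?_⟩
  simp only [zero_mul, sum_const_zero, sub_zero]
  exact (h i t ht).trans (mul_le_mul_of_nonneg_right (le_abs_self C)
    (Real.rpow_nonneg ht.1.le _))

theorem monomial (hL : b ≤ L + 1) (n : ℕ) (hn : j ≤ n) :
    HasExp b L j (fun (_ : ι) t => t ^ n) := by
  by_cases h : n ≤ L
  · refine ⟨fun _ l => if l = n then 1 else 0, 1, zero_le_one, fun i l => ?_, fun i t ht => ?_⟩
    · dsimp only
      split_ifs <;> simp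
    · simp only [ite_mul, one_mul, zero_mul]
      rw [sum_ite_eq', if_pos (mem_Icc.2 ⟨hn, h⟩), sub_self, abs_zero]
      exact Real.rpow_nonneg ht.1.le _
  · refine of_le (C := 1) fun i t ht => ?_
    rw [abs_of_nonneg (pow_nonneg ht.1.le n), one_mul, ← Real.rpow_natCast]
    refine Real.rpow_le_rpow_of_exponent_ge ht.1 ht.2 (hL.trans ?_)
    push Not at h
    exact_mod_cast h

theorem finset_sum {κ : Type*} (s : Finset κ) (H : κ → ι → ℝ → ℝ)
    (h : ∀ a ∈ s, HasExp b L j (H a)) : HasExp b L j (fun i t => ∑ a ∈ s, H a i t) := by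
  classical
  induction s using Finset.induction_on with
  | empty => exact of_le (C := 0) (by simp)
  | insert a s ha ih =>
    refine ((h a (mem_insert_self a s)).add
      (ih fun x hx => h x (mem_insert_of_mem hx))).congr fun i t _ => ?_
    rw [sum_insert ha]

theorem weaken (hL : b ≤ L + 1) (hjk : j ≤ k) (hF : HasExp b L k F) : HasExp b L j F := by
  obtain ⟨f, K, hK, hf, hF⟩ := hF
  have h1 : HasExp b L j (fun i t => ∑ l ∈ Icc k L, f i l * t ^ l) :=
    finset_sum _ _ fun l hl =>
      (monomial hL l (hjk.trans (mem_Icc.1 hl).1)).smul (fun i => f i l) (fun i => hf i l)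
  have h2 : HasExp b L j (fun i t => F i t - ∑ l ∈ Icc k L, f i l * t ^ l) := of_le hF
  exact (h1.add h2).congr fun i t _ => by ring

theorem bounded (hb : 0 ≤ b) (hF : HasExp b L j F) :
    ∃ K, 0 ≤ K ∧ ∀ i, ∀ t ∈ Set.Ioc (0 : ℝ) 1, |F i t| ≤ K := by
  obtain ⟨f, K, hK, hf, hF⟩ := hF
  refine ⟨K + ∑ l ∈ Icc j L, K, by positivity, fun i t ht => ?_⟩
  have h1 : |∑ l ∈ Icc j L, f i l * t ^ l| ≤ ∑ l ∈ Icc j L, K := by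
    refine (abs_sum_le_sum_abs _ _).trans (sum_le_sum fun l _ => ?_)
    rw [abs_mul, abs_of_nonneg (pow_nonneg ht.1.le l)]
    exact (mul_le_of_le_one_right (abs_nonneg _) (pow_le_one₀ ht.1.le ht.2)).trans (hf i l)
  have h2 : K * t ^ b ≤ K := mul_le_of_le_one_right hK (Real.rpow_le_one ht.1.le ht.2 hb)
  have h3 := hF i t ht
  calc |F i t| = |(F i t - ∑ l ∈ Icc j L, f i l * t ^ l) + ∑ l ∈ Icc j L, f i l * t ^ l| := by
        rw [sub_add_cancel]
    _ ≤ _ := (abs_add_le _ _).trans (add_le_add (h3.trans h2) h1)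

theorem mul (hb : 0 ≤ b) (hL : b ≤ L + 1) (hF : HasExp b L j F) (hG : HasExp b L k G) :
    HasExp b L (j + k) (fun i t => F i t * G i t) := by
  obtain ⟨KG, hKG0, hKG⟩ := hG.bounded hb
  obtain ⟨f, K, hK, hf, hF⟩ := hF
  obtain ⟨g, K', hK', hg, hG⟩ := hG
  have h1 : HasExp b L (j + k)
      (fun i t => ∑ l ∈ Icc j L, ∑ q ∈ Icc k L, f i l * (g i q * t ^ (l + q))) :=
    finset_sum _ _ fun l hl => finset_sum _ _ fun q hq =>
      ((monomial hL (l + q) (add_le_add (mem_Icc.1 hl).1 (mem_Icc.1 hq).1)).smul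
        (fun i => g i q) (fun i => hg i q)).smul (fun i => f i l) (fun i => hf i l)
  have h2 : HasExp b L (j + k) (fun i t => ∑ l ∈ Icc j L,
      f i l * (t ^ l * (G i t - ∑ q ∈ Icc k L, g i q * t ^ q))) := by
    refine finset_sum _ _ fun l hl => HasExp.smul (fun i => f i l) (fun i => hf i l) ?_
    refine of_le (C := K') fun i t ht => ?_
    rw [abs_mul, abs_of_nonneg (pow_nonneg ht.1.le l)]
    exact (mul_le_of_le_one_left (abs_nonneg _) (pow_le_one₀ ht.1.le ht.2)).trans (hG i t ht)
  have h3 : HasExp b L (j + k)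
      (fun i t => (F i t - ∑ l ∈ Icc j L, f i l * t ^ l) * G i t) := by
    refine of_le (C := K * KG) fun i t ht => ?_
    rw [abs_mul, mul_right_comm]
    exact mul_le_mul (hF i t ht) (hKG i t ht) (abs_nonneg _)
      (mul_nonneg hK (Real.rpow_nonneg ht.1.le _))
  refine ((h1.add h2).add h3).congr fun i t _ => ?_
  have e1 : ∑ l ∈ Icc j L, ∑ q ∈ Icc k L, f i l * (g i q * t ^ (l + q))
      = (∑ l ∈ Icc j L, f i l * t ^ l) * ∑ q ∈ Icc k L, g i q * t ^ q := by
    rw [sum_mul_sum]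
    exact sum_congr rfl fun l _ => sum_congr rfl fun q _ => by rw [pow_add]; ring
  have e2 : ∑ l ∈ Icc j L, f i l * (t ^ l * (G i t - ∑ q ∈ Icc k L, g i q * t ^ q))
      = (∑ l ∈ Icc j L, f i l * t ^ l) * (G i t - ∑ q ∈ Icc k L, g i q * t ^ q) := by
    rw [sum_mul]
    exact sum_congr rfl fun l _ => by ring
  rw [e1, e2]
  ring

theorem pow (hb : 0 ≤ b) (hL : b ≤ L + 1) (hF : HasExp b L j F) (n : ℕ) :
    HasExp b L (n * j) (fun i t => F i t ^ n) := by
  induction n with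
  | zero => simpa using monomial (ι := ι) (j := 0) hL 0 le_rfl
  | succ n ih =>
    rw [Nat.succ_mul]
    exact (ih.mul hb hL hF).congr fun i t _ => pow_succ _ _

/-- Beyond order `L` an expansion reduces to its error term. -/
theorem le_of_lt (hj : L < j) (hF : HasExp b L j F) :
    ∃ K, 0 ≤ K ∧ ∀ i, ∀ t ∈ Set.Ioc (0 : ℝ) 1, |F i t| ≤ K * t ^ b := by
  obtain ⟨f, K, hK, hf, hF⟩ := hF
  exact ⟨K, hK, fun i t ht => by simpa [Icc_eq_empty (not_le.2 hj)] using hF i t ht⟩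

/-- Composition with a function that is approximated by polynomials near the origin. -/
theorem comp (hb : 0 ≤ b) (hL : b ≤ L + 1) (hF : HasExp b L 1 F) (φ : ℝ → ℝ) (c : ℕ → ℝ) (C : ℝ)
    {p : ℕ} (hc : ∀ m < p, c m = 0)
    (hφ : ∀ i, ∀ t ∈ Set.Ioc (0 : ℝ) 1,
      |φ (F i t) - ∑ m ∈ range (L + 1), c m * F i t ^ m| ≤ C * |F i t| ^ (L + 1)) :
    HasExp b L p (fun i t => φ (F i t)) := by
  have h1 : HasExp b L p (fun i t => ∑ m ∈ range (L + 1), c m * F i t ^ m) := by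
    refine finset_sum _ _ fun m _ => ?_
    rcases lt_or_ge m p with h | h
    · exact of_le (C := 0) (by simp [hc m h])
    · exact ((hF.pow hb hL m).weaken hL (by simpa using h)).smul (fun _ => c m) fun _ => le_rfl
  obtain ⟨K, hK, hKF⟩ := (hF.pow hb hL (L + 1)).le_of_lt (by simp)
  have h2 : HasExp b L p (fun i t => φ (F i t) - ∑ m ∈ range (L + 1), c m * F i t ^ m) := by
    refine of_le (C := |C| * K) fun i t ht => (hφ i t ht).trans ?_
    rw [← abs_pow, mul_assoc]
    exact mul_le_mul (le_abs_self C) (hKF i t ht) (abs_nonneg _) (abs_nonneg _)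
  exact (h1.add h2).congr fun i t _ => by ring

theorem log_one_add (hb : 0 ≤ b) (hL : b ≤ L + 1) (hF : HasExp b L 1 F)
    (hF4 : ∀ i, ∀ t ∈ Set.Ioc (0 : ℝ) 1, |F i t| ≤ 1 / 4) :
    HasExp b L 1 (fun i t => Real.log (1 + F i t)) := by
  refine hF.comp hb hL (fun y => Real.log (1 + y))
    (fun m => if m = 0 then 0 else -(-1) ^ m / (m : ℝ)) (4 / 3) (by simp) fun i t ht => ?_
  have hy := hF4 i t ht
  have hlt : |-(F i t)| < 1 := by rw [abs_neg]; linarith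
  have h := Real.abs_log_sub_add_sum_range_le hlt L
  rw [sub_neg_eq_add, abs_neg] at h
  have e : ∑ m ∈ range (L + 1), (if m = 0 then 0 else -(-1) ^ m / (m : ℝ)) * F i t ^ m
      = -∑ m ∈ range L, (-F i t) ^ (m + 1) / ((m : ℝ) + 1) := by
    rw [sum_range_succ', ← sum_neg_distrib]
    simp only [Nat.add_eq_zero_iff, one_ne_zero, and_false, if_false, if_true, zero_mul, add_zero]
    refine sum_congr rfl fun m _ => ?_
    rw [neg_pow (F i t) (m + 1)]
    push_cast
    ring
  rw [e, sub_neg_eq_add, add_comm]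
  refine h.trans ?_
  rw [div_le_iff₀ (by linarith)]
  have h0 : 0 ≤ |F i t| ^ (L + 1) := by positivity
  nlinarith

theorem exp_comp (hb : 0 ≤ b) (hL : b ≤ L + 1) (hF : HasExp b L 1 F)
    (hF1 : ∀ i, ∀ t ∈ Set.Ioc (0 : ℝ) 1, |F i t| ≤ 1) :
    HasExp b L 1 (fun i t => Real.exp (F i t) - 1) := by
  refine hF.comp hb hL (fun y => Real.exp y - 1)
    (fun m => if m = 0 then 0 else 1 / (m.factorial : ℝ))
    (((L + 1).succ : ℕ) / ((L + 1).factorial * ((L + 1 : ℕ) : ℝ))) (by simp) fun i t ht => ?_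
  have h := Real.exp_bound (hF1 i t ht) (Nat.succ_pos L)
  rw [mul_comm (|F i t| ^ _)] at h
  refine le_trans (le_of_eq ?_) h
  rw [Nat.succ_eq_add_one, sum_range_succ', sum_range_succ' (n := L)]
  simp only [Nat.add_eq_zero_iff, one_ne_zero, and_false, if_false, if_true, zero_mul, add_zero,
    pow_zero, Nat.factorial_zero, Nat.cast_one, div_one]
  rw [sub_sub, add_comm (1 : ℝ)]
  congr 3
  exact sum_congr rfl fun m _ => by ring

/-- Change of variable: a function that expands in powers of `t` also expands in powers of
`t (1 + q)`, if `q` has an expansion without constant term. The system is triangular: subtracting a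
multiple of `(t (1 + q))^j` removes the term of order `j`. -/
theorem change_variable (hb : 0 ≤ b) (hL : b ≤ L + 1) {q : ι → ℝ → ℝ} (hq : HasExp b L 1 q)
    (hj : j ≤ L + 1) (hF : HasExp b L j F) :
    ∃ (e : ι → ℕ → ℝ) (K : ℝ), 0 ≤ K ∧ (∀ i l, |e i l| ≤ K) ∧
      ∀ i, ∀ t ∈ Set.Ioc (0 : ℝ) 1,
        |F i t - ∑ l ∈ Icc j L, e i l * (t * (1 + q i t)) ^ l| ≤ K * t ^ b := by
  induction hj using Nat.decreasingInduction generalizing F with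
  | self =>
    obtain ⟨K, hK, h⟩ := hF.le_of_lt (Nat.lt_succ_self L)
    exact ⟨fun _ _ => 0, K, hK, by simp [hK], fun i t ht => by simpa using h i t ht⟩
  | of_succ j hj ih =>
    obtain ⟨f, K, hK, hf, hF⟩ := hF
    have hIoc : Ioc j L = Icc (j + 1) L := by ext; simp
    have one : HasExp b L 0 (fun (_ : ι) (_ : ℝ) => (1 : ℝ)) := by
      simpa using monomial (ι := ι) (j := 0) hL 0 le_rfl
    -- `(1 + q)^j - 1` has no constant term
    have hpow : ∀ n : ℕ, HasExp b L 1 (fun i t => (1 + q i t) ^ n - 1) := by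
      intro n
      induction n with
      | zero => exact of_le (C := 0) (by simp)
      | succ n ihn =>
        have h0 : HasExp b L 0 (fun i t => 1 + q i t) := one.add (hq.weaken hL (Nat.zero_le 1))
        have h1 := ihn.mul hb hL h0
        exact (h1.add hq).congr fun i t _ => by ring
    have hrest : HasExp b L (j + 1)
        (fun i t => f i j * (t ^ j * ((1 + q i t) ^ j - 1))) :=
      ((monomial hL j le_rfl).mul hb hL (hpow j)).smul (fun i => f i j) (fun i => hf i j)
    have hG : HasExp b L (j + 1) (fun i t => F i t - f i j * t ^ j) := by
      refine ⟨f, K, hK, hf, fun i t ht => ?_⟩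
      have := hF i t ht
      rwa [← Finset.sum_Ioc_add_eq_sum_Icc (Nat.lt_succ_iff.1 hj), ← sub_sub,
        sub_right_comm, hIoc] at this
    obtain ⟨e, K', hK', he, h⟩ := ih (hG.add (hrest.smul (fun _ => -1) (fun _ => le_rfl)))
    refine ⟨fun i l => if l = j then f i j else e i l, max K K', le_max_of_le_left hK,
      fun i l => ?_, fun i t ht => ?_⟩
    · dsimp only
      split_ifs
      · exact (hf i j).trans (le_max_left _ _)
      · exact (he i l).trans (le_max_right _ _)
    · refine le_trans (le_of_eq ?_) ((h i t ht).trans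
        (mul_le_mul_of_nonneg_right (le_max_right K K') (Real.rpow_nonneg ht.1.le _)))
      rw [← Finset.sum_Ioc_add_eq_sum_Icc (Nat.lt_succ_iff.1 hj)]
      have hs : ∑ l ∈ Icc (j + 1) L, (if l = j then f i j else e i l) * (t * (1 + q i t)) ^ l
          = ∑ l ∈ Icc (j + 1) L, e i l * (t * (1 + q i t)) ^ l :=
        sum_congr rfl fun l hl => by rw [if_neg (Nat.lt_of_succ_le (mem_Icc.1 hl).1).ne']
      rw [hIoc, hs]
      dsimp only
      rw [if_pos rfl, mul_pow]
      congr 1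
      ring

end HasExp

/-- If `y(t) = ∑_{l=1}^L c_l t^l + O(t^b)` is small, then `-log (1 + y)` has an expansion in powers
of `t (1 + y)^δ`, with an error term that is uniform in `y`. -/
theorem exists_log_expansion {b δ : ℝ} {L : ℕ} (hb : 0 ≤ b) (hL : b ≤ L + 1) (hδ0 : 0 ≤ δ)
    (hδ : δ ≤ 2) :
    ∃ K : ℝ, 0 ≤ K ∧ ∀ (c : ℕ → ℝ) (y : ℝ → ℝ), (∀ l, |c l| ≤ 1) →
      (∀ t ∈ Set.Ioc (0 : ℝ) 1, |y t| ≤ 1 / 4) →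
      (∀ t ∈ Set.Ioc (0 : ℝ) 1, |y t - ∑ l ∈ Icc 1 L, c l * t ^ l| ≤ t ^ b) →
      ∃ e : ℕ → ℝ, (∀ l, |e l| ≤ K) ∧ ∀ t ∈ Set.Ioc (0 : ℝ) 1,
        |-Real.log (1 + y t) - ∑ l ∈ Icc 1 L, e l * (t * (1 + y t) ^ δ) ^ l| ≤ K * t ^ b := by
  -- all admissible `(c, y)` at once: the constants of `HasExp` are uniform in the index
  let ι := {p : (ℕ → ℝ) × (ℝ → ℝ) // (∀ l, |p.1 l| ≤ 1) ∧
      (∀ t ∈ Set.Ioc (0 : ℝ) 1, |p.2 t| ≤ 1 / 4) ∧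
      (∀ t ∈ Set.Ioc (0 : ℝ) 1, |p.2 t - ∑ l ∈ Icc 1 L, p.1 l * t ^ l| ≤ t ^ b)}
  let y : ι → ℝ → ℝ := fun p => p.1.2
  have hy4 : ∀ i : ι, ∀ t ∈ Set.Ioc (0 : ℝ) 1, |y i t| ≤ 1 / 4 := fun i => i.2.2.1
  have hy : HasExp b L 1 y := ⟨fun p => p.1.1, 1, zero_le_one, fun p => p.2.1, fun p t ht => by
    rw [one_mul]; exact p.2.2.2 t ht⟩
  have hlog := hy.log_one_add hb hL hy4
  have hlogb : ∀ i : ι, ∀ t ∈ Set.Ioc (0 : ℝ) 1, |δ * Real.log (1 + y i t)| ≤ 1 := by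
    intro i t ht
    have h1 := abs_le.1 (hy4 i t ht)
    have hpos : 0 < 1 + y i t := by linarith
    have h2 := Real.log_le_sub_one_of_pos hpos
    have h3 := Real.one_sub_inv_le_log_of_pos hpos
    have h4 : (1 + y i t)⁻¹ ≤ 4 / 3 := by
      rw [inv_le_comm₀ hpos (by norm_num)]; linarith
    have h5 : |Real.log (1 + y i t)| ≤ 1 / 2 := abs_le.2 ⟨by linarith, by linarith⟩
    rw [abs_mul, abs_of_nonneg hδ0]
    nlinarith [abs_nonneg (Real.log (1 + y i t))]
  -- `(1 + y)^δ - 1` as an exponential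
  have hq := (hlog.smul (fun _ => δ) (fun _ => le_rfl)).exp_comp hb hL hlogb
  obtain ⟨e, K, hK, he, h⟩ := HasExp.change_variable hb hL hq (Nat.le_add_left 1 L)
    (hlog.smul (fun _ => -1) (fun _ => le_rfl))
  refine ⟨K, hK, fun c y' h1 h2 h3 => ?_⟩
  let i : ι := ⟨(c, y'), h1, h2, h3⟩
  refine ⟨e i, he i, fun t ht => ?_⟩
  have hpos : 0 < 1 + y' t := by linarith [abs_le.1 (h2 t ht)]
  have := h i t ht
  simp only [y, i, add_sub_cancel, neg_one_mul] at this
  rw [Real.rpow_def_of_pos hpos, mul_comm (Real.log _)]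
  exact this

end

/-! ### Order statistics -/

section

/-- The `k`-th smallest of the nonnegative numbers `u j`. -/
noncomputable def orderStat {N : ℕ} (k : ℕ) (u : Fin N → ℝ) : ℝ :=
  sInf {r : ℝ | 0 ≤ r ∧ k ≤ #{j | u j ≤ r}}

section OrderStat

variable {N k : ℕ} {u : Fin N → ℝ}

/-- The infimum that defines the order statistic is attained, at one of the given numbers. -/
theorem exists_isLeast_orderStat (hk : 1 ≤ k) (hkN : k ≤ N) (hu : ∀ j, 0 ≤ u j) :
    ∃ j, IsLeast {r : ℝ | 0 ≤ r ∧ k ≤ #{j | u j ≤ r}} (u j) := by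
  -- every admissible `r` can be lowered to some value `u i`
  have key : ∀ r : ℝ, k ≤ #{j | u j ≤ r} → ∃ i, u i ≤ r ∧ k ≤ #{j | u j ≤ u i} := by
    intro r hr
    have hne : (univ.filter fun j => u j ≤ r).Nonempty := card_pos.1 (by omega)
    obtain ⟨i, hi, hmax⟩ := exists_max_image _ u hne
    refine ⟨i, (mem_filter.1 hi).2, hr.trans (card_le_card fun j hj => ?_)⟩
    exact mem_filter.2 ⟨mem_univ _, hmax j hj⟩
  have hJ : (univ.filter fun i => k ≤ #{j | u j ≤ u i}).Nonempty := by
    obtain ⟨i, -, hi⟩ := key (∑ j, u j) (by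
      rw [filter_true_of_mem fun j _ => single_le_sum (fun i _ => hu i) (mem_univ j)]
      simpa using hkN)
    exact ⟨i, mem_filter.2 ⟨mem_univ _, hi⟩⟩
  obtain ⟨j, hj, hmin⟩ := exists_min_image _ u hJ
  refine ⟨j, ⟨hu j, (mem_filter.1 hj).2⟩, fun r hr => ?_⟩
  obtain ⟨i, hir, hi⟩ := key r hr.2
  exact (hmin i (mem_filter.2 ⟨mem_univ _, hi⟩)).trans hir

theorem orderStat_nonneg (u : Fin N → ℝ) : 0 ≤ orderStat k u := Real.sInf_nonneg fun _ h => h.1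

theorem le_card_orderStat (hk : 1 ≤ k) (hkN : k ≤ N) (hu : ∀ j, 0 ≤ u j) :
    k ≤ #{j | u j ≤ orderStat k u} := by
  obtain ⟨j, hj⟩ := exists_isLeast_orderStat hk hkN hu
  rw [orderStat, hj.csInf_eq]
  exact hj.1.2

theorem orderStat_le (hk : 1 ≤ k) (hu : ∀ j, 0 ≤ u j) {r : ℝ} (hr : k ≤ #{j | u j ≤ r}) :
    orderStat k u ≤ r := by
  obtain ⟨i, hi⟩ : (univ.filter fun j => u j ≤ r).Nonempty := card_pos.1 (by omega)
  exact csInf_le ⟨0, fun _ h => h.1⟩ ⟨(hu i).trans (mem_filter.1 hi).2, hr⟩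

theorem orderStat_le_iff (hk : 1 ≤ k) (hkN : k ≤ N) (hu : ∀ j, 0 ≤ u j) {r : ℝ} :
    orderStat k u ≤ r ↔ k ≤ #{j | u j ≤ r} := by
  refine ⟨fun h => (le_card_orderStat hk hkN hu).trans (card_le_card fun j hj => ?_),
    orderStat_le hk hu⟩
  exact mem_filter.2 ⟨mem_univ _, (mem_filter.1 hj).2.trans h⟩

/-- A nondecreasing function commutes with taking order statistics. -/
theorem comp_orderStat_le_iff (hk : 1 ≤ k) (hkN : k ≤ N) (hu : ∀ j, 0 ≤ u j) {h : ℝ → ℝ}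
    (hh : Monotone h) {s : ℝ} : h (orderStat k u) ≤ s ↔ k ≤ #{j | h (u j) ≤ s} := by
  refine ⟨fun hs => (le_card_orderStat hk hkN hu).trans (card_le_card fun j hj => ?_),
    fun hs => ?_⟩
  · exact mem_filter.2 ⟨mem_univ _, (hh (mem_filter.1 hj).2).trans hs⟩
  · obtain ⟨i, hi, hmax⟩ := exists_max_image (univ.filter fun j => h (u j) ≤ s) u
      (card_pos.1 (by omega))
    refine (hh (orderStat_le hk hu (r := u i) (hs.trans (card_le_card fun j hj => ?_)))).trans
      (mem_filter.1 hi).2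
    exact mem_filter.2 ⟨mem_univ _, hmax j hj⟩

/-- At least `N - k + 1` of the numbers are no less than the `k`-th smallest. -/
theorem orderStat_rpow_le_sum (hk : 1 ≤ k) (hu : ∀ j, 0 ≤ u j) {p : ℝ}
    (hp : 0 ≤ p) :
    ((N : ℝ) - k + 1) * orderStat k u ^ p ≤ ∑ j, u j ^ p := by
  have hlt : #{j | u j < orderStat k u} < k := by
    by_contra! hcon
    obtain ⟨i, hi, hmax⟩ := exists_max_image (univ.filter fun j => u j < orderStat k u) u
      (card_pos.1 (by omega))
    have := orderStat_le hk hu (r := u i) (hcon.trans (card_le_card fun j hj =>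
      mem_filter.2 ⟨mem_univ _, hmax j hj⟩))
    exact absurd (mem_filter.1 hi).2 (not_lt.2 this)
  have hcard := card_filter_add_card_filter_not (s := (univ : Finset (Fin N)))
    (fun j => u j < orderStat k u)
  rw [card_univ, Fintype.card_fin] at hcard
  have hge : (N : ℝ) - k + 1 ≤ #{j | ¬ u j < orderStat k u} := by
    have : N + 1 ≤ #{j | ¬ u j < orderStat k u} + k := by omega
    have : (N : ℝ) + 1 ≤ #{j | ¬ u j < orderStat k u} + k := by exact_mod_cast this
    linarith
  calc ((N : ℝ) - k + 1) * orderStat k u ^ p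
      ≤ #{j | ¬ u j < orderStat k u} * orderStat k u ^ p :=
        mul_le_mul_of_nonneg_right hge (Real.rpow_nonneg (orderStat_nonneg u) _)
    _ = ∑ j with ¬ u j < orderStat k u, orderStat k u ^ p := by
        rw [sum_const, nsmul_eq_mul]
    _ ≤ ∑ j with ¬ u j < orderStat k u, u j ^ p := sum_le_sum fun j hj =>
        Real.rpow_le_rpow (orderStat_nonneg u) (not_lt.1 (mem_filter.1 hj).2) hp
    _ ≤ ∑ j, u j ^ p := sum_le_sum_of_subset_of_nonneg (filter_subset _ _)
        fun j _ _ => Real.rpow_nonneg (hu j) _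

end OrderStat

/-- The number of sample points in a set of probability `p` has the binomial distribution. -/
theorem pi_le_card_filter {E : Type*} [MeasurableSpace E] (P : Measure E) [IsProbabilityMeasure P]
    {A : Set E} [DecidablePred (· ∈ A)] (hA : MeasurableSet A) (N k : ℕ) :
    (Measure.pi fun _ : Fin N => P) {Y | k ≤ #{j | Y j ∈ A}} =
      ENNReal.ofReal (∑ i ∈ (range (N + 1)).filter (k ≤ ·),
        N.choose i * P.real A ^ i * (1 - P.real A) ^ (N - i)) := by
  classical
  have hset : {Y : Fin N → E | k ≤ #{j | Y j ∈ A}} =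
      ⋃ T ∈ (univ : Finset (Fin N)).powerset.filter (fun T => k ≤ #T),
        Set.univ.pi fun j => if j ∈ T then A else Aᶜ := by
    ext Y
    simp only [Set.mem_ofPred_eq, Set.mem_iUnion, Set.mem_pi, Set.mem_univ, true_implies,
      exists_prop, mem_filter, mem_powerset, subset_univ, true_and]
    constructor
    · intro h
      refine ⟨_, h, fun j => ?_⟩
      split_ifs with hj <;> simpa using hj
    · rintro ⟨T, hT, h⟩
      refine hT.trans (card_le_card fun j hj => ?_)
      have := h j
      rw [if_pos hj] at this
      simpa using this
  have hdisj : Set.PairwiseDisjoint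
      ((univ : Finset (Fin N)).powerset.filter (fun T => k ≤ #T) : Set (Finset (Fin N)))
      (fun T => Set.univ.pi fun j => if j ∈ T then A else Aᶜ) := by
    intro T _ T' _ hne
    refine Set.disjoint_left.2 fun Y h1 h2 => hne ?_
    ext j
    have h1 := h1 j trivial
    have h2 := h2 j trivial
    by_cases h : j ∈ T <;> by_cases h' : j ∈ T' <;> simp_all
  have hcompl : P Aᶜ = ENNReal.ofReal (1 - P.real A) := by
    rw [← probReal_compl_eq_one_sub hA, ofReal_measureReal]
  have h1 : 0 ≤ 1 - P.real A := sub_nonneg.2 measureReal_le_one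
  rw [hset, measure_biUnion_finset hdisj fun T _ => MeasurableSet.univ_pi fun j => by
    split_ifs; exacts [hA, hA.compl]]
  have hterm : ∀ T : Finset (Fin N), (Measure.pi fun _ : Fin N => P)
      (Set.univ.pi fun j => if j ∈ T then A else Aᶜ) =
      ENNReal.ofReal (P.real A ^ #T * (1 - P.real A) ^ (N - #T)) := by
    intro T
    rw [Measure.pi_pi]
    have : ∀ j, P (if j ∈ T then A else Aᶜ) =
        ENNReal.ofReal (if j ∈ T then P.real A else 1 - P.real A) := by
      intro j
      split_ifs
      · rw [ofReal_measureReal]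
      · exact hcompl
    simp_rw [this]
    rw [← ENNReal.ofReal_prod_of_nonneg fun j _ => by split_ifs; exacts [measureReal_nonneg, h1]]
    rw [prod_ite]
    simp [filter_not, card_sdiff]
  simp_rw [hterm]
  rw [← ENNReal.ofReal_sum_of_nonneg fun T _ =>
    mul_nonneg (pow_nonneg measureReal_nonneg _) (pow_nonneg h1 _), sum_filter,
    sum_powerset_apply_card (fun m => if k ≤ m then P.real A ^ m * (1 - P.real A) ^ (N - m) else 0),
    sum_filter, card_univ, Fintype.card_fin]
  congr 1
  refine sum_congr rfl fun i _ => ?_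
  split_ifs <;> simp [mul_assoc]

end

/-! ### Beta distributions and the digamma function -/

section

/-- The probability that a binomial variable with parameters `N` and `s` is at least `k`. -/
noncomputable def binomTail (N k : ℕ) (s : ℝ) : ℝ :=
  ∑ i ∈ (range (N + 1)).filter (k ≤ ·), N.choose i * s ^ i * (1 - s) ^ (N - i)

section Beta

-- Throughout, the sample size is `M + 1` and the order of the order statistic is `κ + 1`, which
-- avoids truncated subtraction.
variable {M κ : ℕ}

/-- In terms of Bernstein polynomials, whose derivatives make the sum telescope. -/
theorem binomTail_eq_sum_Ico (s : ℝ) : binomTail (M + 1) (κ + 1) s =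
    ∑ ν ∈ Ico κ (M + 1), (bernsteinPolynomial ℝ (M + 1) (ν + 1)).eval s := by
  have : (range (M + 1 + 1)).filter (κ + 1 ≤ ·) = Ico (κ + 1) (M + 1 + 1) := by
    ext; simp [and_comm]
  rw [binomTail, this, ← sum_Ico_add' _ κ (M + 1) 1]
  simp [bernsteinPolynomial]

theorem hasDerivAt_binomTail (h : κ ≤ M) (s : ℝ) :
    HasDerivAt (binomTail (M + 1) (κ + 1)) ((M + 1) * (bernsteinPolynomial ℝ M κ).eval s) s := by
  have e : binomTail (M + 1) (κ + 1) = fun s =>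
      (∑ ν ∈ Ico κ (M + 1), bernsteinPolynomial ℝ (M + 1) (ν + 1)).eval s := by
    funext s; rw [binomTail_eq_sum_Ico, Polynomial.eval_finsetSum]
  rw [e]
  have h0 : bernsteinPolynomial ℝ M (M + 1) = 0 := bernsteinPolynomial.eq_zero_of_lt ℝ (by simp)
  have hs := sum_Ico_sub (fun ν => bernsteinPolynomial ℝ M ν) (h.trans (Nat.le_succ M))
  rw [h0] at hs
  have : ∑ i ∈ Ico κ (M + 1), (bernsteinPolynomial ℝ M i - bernsteinPolynomial ℝ M (i + 1))
      = bernsteinPolynomial ℝ M κ := by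
    rw [← neg_inj, ← sum_neg_distrib]
    simpa using hs
  have hd := Polynomial.hasDerivAt (∑ ν ∈ Ico κ (M + 1), bernsteinPolynomial ℝ (M + 1) (ν + 1)) s
  rw [Polynomial.derivative_sum] at hd
  simp_rw [bernsteinPolynomial.derivative_succ_aux] at hd
  rw [← mul_sum, this] at hd
  simpa using hd

theorem binomTail_zero : binomTail (M + 1) (κ + 1) 0 = 0 := by
  refine sum_eq_zero fun i hi => ?_
  have : i ≠ 0 := by have := (mem_filter.1 hi).2; omega
  simp [this]

theorem binomTail_one (h : κ ≤ M) : binomTail (M + 1) (κ + 1) 1 = 1 := by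
  rw [binomTail, sum_eq_single (M + 1)]
  · simp
  · intro i hi hne
    have : M + 1 - i ≠ 0 := by have := mem_range.1 (mem_filter.1 hi).1; omega
    simp [this]
  · intro hn; exact absurd (mem_filter.2 ⟨by simp, by omega⟩) hn

theorem betaPDFReal_eq (h : κ ≤ M) {x : ℝ} (hx : x ∈ Set.Ioo (0 : ℝ) 1) :
    ProbabilityTheory.betaPDFReal (κ + 1) (M + 1 - κ) x =
      (M + 1) * (bernsteinPolynomial ℝ M κ).eval x := by
  obtain ⟨j, rfl⟩ := Nat.exists_eq_add_of_le h
  rw [ProbabilityTheory.betaPDFReal, if_pos ⟨hx.1, hx.2⟩, ProbabilityTheory.beta]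
  have e1 : ((κ + j : ℕ) : ℝ) + 1 - κ = j + 1 := by push_cast; ring
  have e2 : (κ : ℝ) + 1 + (j + 1) = ((κ + j + 1 : ℕ) : ℝ) + 1 := by push_cast; ring
  rw [e1, e2, Real.Gamma_nat_eq_factorial, Real.Gamma_nat_eq_factorial,
    Real.Gamma_nat_eq_factorial, add_sub_cancel_right, add_sub_cancel_right, Real.rpow_natCast,
    Real.rpow_natCast, Nat.factorial_succ]
  simp only [bernsteinPolynomial, Polynomial.eval_mul, Polynomial.eval_natCast,
    Polynomial.eval_pow, Polynomial.eval_X, Polynomial.eval_sub, Polynomial.eval_one,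
    Nat.add_sub_cancel_left]
  rw [Nat.cast_add_choose]
  have h1 : (κ.factorial : ℝ) ≠ 0 := by positivity
  have h2 : (j.factorial : ℝ) ≠ 0 := by positivity
  push_cast
  field_simp

theorem betaPDF_eq_indicator (a b : ℝ) : ProbabilityTheory.betaPDF a b =
    (Set.Ioo (0 : ℝ) 1).indicator
      fun x => ENNReal.ofReal (ProbabilityTheory.betaPDFReal a b x) := by
  funext x
  by_cases hx : x ∈ Set.Ioo (0 : ℝ) 1
  · rw [Set.indicator_of_mem hx]; rfl
  · rw [Set.indicator_of_notMem hx, ProbabilityTheory.betaPDF_eq, if_neg (by exact hx),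
      ENNReal.ofReal_zero]

theorem beta_params_pos (h : κ ≤ M) : (0 : ℝ) < κ + 1 ∧ (0 : ℝ) < M + 1 - κ := by
  have : (κ : ℝ) ≤ M := by exact_mod_cast h
  exact ⟨by positivity, by linarith⟩

theorem bernstein_eval_nonneg (n ν : ℕ) {x : ℝ} (hx : x ∈ Set.Icc (0 : ℝ) 1) :
    0 ≤ (bernsteinPolynomial ℝ n ν).eval x := by
  simp only [bernsteinPolynomial, Polynomial.eval_mul, Polynomial.eval_natCast,
    Polynomial.eval_pow, Polynomial.eval_X, Polynomial.eval_sub, Polynomial.eval_one]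
  have h1 := hx.1
  have h2 : 0 ≤ 1 - x := sub_nonneg.2 hx.2
  positivity

theorem betaMeasure_Iic (h : κ ≤ M) {s : ℝ} (hs : s ∈ Set.Ico (0 : ℝ) 1) :
    ProbabilityTheory.betaMeasure (κ + 1) (M + 1 - κ) (Set.Iic s) =
      ENNReal.ofReal (binomTail (M + 1) (κ + 1) s) := by
  rw [ProbabilityTheory.betaMeasure, withDensity_apply _ measurableSet_Iic, betaPDF_eq_indicator,
    lintegral_indicator measurableSet_Ioo, Measure.restrict_restrict measurableSet_Ioo]
  have e : Set.Ioo (0 : ℝ) 1 ∩ Set.Iic s = Set.Ioc 0 s := by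
    ext x
    simp only [Set.mem_inter_iff, Set.mem_Ioo, Set.mem_Iic, Set.mem_Ioc]
    exact ⟨fun h => ⟨h.1.1, h.2⟩, fun h => ⟨⟨h.1, h.2.trans_lt hs.2⟩, h.2⟩⟩
  have hint : IntervalIntegrable (fun x => (M + 1) * (bernsteinPolynomial ℝ M κ).eval x)
      volume 0 s :=
    (continuous_const.mul (Polynomial.continuous _)).intervalIntegrable _ _
  have h1 := intervalIntegral.integral_eq_sub_of_hasDerivAt
    (fun x _ => hasDerivAt_binomTail h x) hint
  rw [binomTail_zero, sub_zero, intervalIntegral.integral_of_le hs.1] at h1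
  rw [e, ← h1, ofReal_integral_eq_lintegral_ofReal]
  · refine setLIntegral_congr_fun measurableSet_Ioc fun x hx => ?_
    rw [betaPDFReal_eq h ⟨hx.1, hx.2.trans_lt hs.2⟩]
  · exact (intervalIntegrable_iff_integrableOn_Ioc_of_le hs.1).1 hint
  · refine (ae_restrict_iff' measurableSet_Ioc).2 (.of_forall fun x hx => ?_)
    have := bernstein_eval_nonneg M κ (x := x) ⟨hx.1.le, hx.2.trans hs.2.le⟩
    simp only [Pi.zero_apply]
    positivity

/-- A law on `ℝ` whose distribution function is that of the `k`-th order statistic of a uniform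
sample of size `N` is a beta law. -/
theorem eq_betaMeasure_of_Iic (h : κ ≤ M) (ν : Measure ℝ) [IsProbabilityMeasure ν]
    (hν : ∀ s ∈ Set.Ico (0 : ℝ) 1, ν (Set.Iic s) =
      ENNReal.ofReal (binomTail (M + 1) (κ + 1) s))
    (hν1 : ν (Set.Iic 1) = 1) :
    ν = ProbabilityTheory.betaMeasure (κ + 1) (M + 1 - κ) := by
  have hp := beta_params_pos h
  have := ProbabilityTheory.isProbabilityMeasureBeta hp.1 hp.2
  refine Measure.ext_of_Iic _ _ fun s => ?_
  have h0 : ν (Set.Iic 0) = 0 := by rw [hν 0 (by simp), binomTail_zero, ENNReal.ofReal_zero]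
  have h0' : ProbabilityTheory.betaMeasure (κ + 1) (M + 1 - κ) (Set.Iic 0) = 0 := by
    rw [betaMeasure_Iic h (by simp), binomTail_zero, ENNReal.ofReal_zero]
  rcases lt_or_ge s 0 with hs | hs
  · rw [measure_mono_null (Set.Iic_subset_Iic.2 hs.le) h0,
      measure_mono_null (Set.Iic_subset_Iic.2 hs.le) h0']
  rcases lt_or_ge s 1 with hs1 | hs1
  · rw [hν s ⟨hs, hs1⟩, betaMeasure_Iic h ⟨hs, hs1⟩]
  · have e1 : ν (Set.Iic s) = 1 :=
      le_antisymm prob_le_one (hν1 ▸ measure_mono (Set.Iic_subset_Iic.2 hs1))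
    have e2 : ProbabilityTheory.betaMeasure (κ + 1) (M + 1 - κ) (Set.Iic s)ᶜ = 0 := by
      rw [ProbabilityTheory.betaMeasure, withDensity_apply _ measurableSet_Iic.compl]
      refine setLIntegral_eq_zero measurableSet_Iic.compl fun x hx => ?_
      refine ProbabilityTheory.betaPDF_eq_zero_of_one_le (hs1.trans ?_)
      exact (not_le.1 (show ¬ x ≤ s from hx)).le
    rw [e1, (prob_compl_eq_zero_iff measurableSet_Iic).1 e2]

theorem betaMeasure_compl_Ioo (a b : ℝ) :
    ProbabilityTheory.betaMeasure a b (Set.Ioo (0 : ℝ) 1)ᶜ = 0 := by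
  rw [ProbabilityTheory.betaMeasure, withDensity_apply _ measurableSet_Ioo.compl]
  refine setLIntegral_eq_zero measurableSet_Ioo.compl fun x hx => ?_
  rw [betaPDF_eq_indicator, Set.indicator_of_notMem hx]; rfl

theorem lintegral_rpow_betaMeasure {a b τ : ℝ} (ha : 0 < a) (hb : 0 < b) (hτ : 0 ≤ τ) :
    ∫⁻ x, ENNReal.ofReal (x ^ τ) ∂(ProbabilityTheory.betaMeasure a b) =
      ENNReal.ofReal (Real.Gamma (a + τ) * Real.Gamma (a + b) /
        (Real.Gamma a * Real.Gamma (a + b + τ))) := by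
  have hc := ProbabilityTheory.beta_pos ha hb
  have hc' := ProbabilityTheory.beta_pos (add_pos_of_pos_of_nonneg ha hτ) hb
  have hm : Measurable (ProbabilityTheory.betaPDF a b) :=
    (ProbabilityTheory.measurable_betaPDFReal a b).ennreal_ofReal
  have key : ∀ x, ProbabilityTheory.betaPDF a b x * ENNReal.ofReal (x ^ τ) =
      ENNReal.ofReal (ProbabilityTheory.beta (a + τ) b / ProbabilityTheory.beta a b) *
        ProbabilityTheory.betaPDF (a + τ) b x := by
    intro x
    by_cases hx : 0 < x ∧ x < 1
    · rw [ProbabilityTheory.betaPDF_of_pos_lt_one hx.1 hx.2,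
        ProbabilityTheory.betaPDF_of_pos_lt_one hx.1 hx.2,
        ← ENNReal.ofReal_mul' (Real.rpow_nonneg hx.1.le _),
        ← ENNReal.ofReal_mul (by positivity), show a + τ - 1 = (a - 1) + τ by ring,
        Real.rpow_add hx.1]
      congr 1
      field_simp
    · rw [ProbabilityTheory.betaPDF_eq, ProbabilityTheory.betaPDF_eq, if_neg hx, if_neg hx]
      simp
  rw [ProbabilityTheory.betaMeasure, lintegral_withDensity_eq_lintegral_mul _ hm (by fun_prop)]
  simp_rw [Pi.mul_apply, key]
  have hm' : Measurable (ProbabilityTheory.betaPDF (a + τ) b) :=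
    (ProbabilityTheory.measurable_betaPDFReal (a + τ) b).ennreal_ofReal
  rw [lintegral_const_mul _ hm',
    ProbabilityTheory.lintegral_betaPDF_eq_one (by positivity) hb, mul_one]
  congr 1
  rw [ProbabilityTheory.beta, ProbabilityTheory.beta, add_right_comm a τ b]
  have h1 := (Real.Gamma_pos_of_pos ha).ne'
  have h2 := (Real.Gamma_pos_of_pos hb).ne'
  have h3 := (Real.Gamma_pos_of_pos (add_pos ha hb)).ne'
  have h4 := (Real.Gamma_pos_of_pos (add_pos_of_pos_of_nonneg (add_pos ha hb) hτ)).ne'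
  field_simp

theorem integral_bernstein (h : κ ≤ M) :
    ∫ x in (0 : ℝ)..1, (bernsteinPolynomial ℝ M κ).eval x = 1 / (M + 1) := by
  have h1 := intervalIntegral.integral_eq_sub_of_hasDerivAt
    (a := (0 : ℝ)) (b := 1) (fun x _ => hasDerivAt_binomTail h x)
    ((continuous_const.mul (Polynomial.continuous _)).intervalIntegrable _ _)
  rw [binomTail_zero, binomTail_one h, intervalIntegral.integral_const_mul] at h1
  have : (M : ℝ) + 1 ≠ 0 := by positivity
  field_simp
  linarith

/-- Integration by parts against the derivative of the binomial tail. -/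
theorem integral_log_mul_bernstein (h : κ ≤ M) :
    IntervalIntegrable (fun x => (M + 1) * (bernsteinPolynomial ℝ M κ).eval x * Real.log x)
      volume 0 1 ∧
    ∫ x in (0 : ℝ)..1, (M + 1) * (bernsteinPolynomial ℝ M κ).eval x * Real.log x =
      -∑ ν ∈ Ico κ (M + 1), 1 / ((ν : ℝ) + 1) := by
  -- the quotient of the binomial tail by `x`
  set q : ℝ → ℝ := fun x => ∑ ν ∈ Ico κ (M + 1),
    ((M + 1) / ((ν : ℝ) + 1)) * (bernsteinPolynomial ℝ M ν).eval x with hq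
  have hqc : Continuous q := continuous_finsetSum _ fun ν _ =>
    continuous_const.mul (Polynomial.continuous _)
  have hqx : ∀ x, binomTail (M + 1) (κ + 1) x = x * q x := by
    intro x
    rw [binomTail_eq_sum_Ico, hq, mul_sum]
    refine sum_congr rfl fun ν hν => ?_
    simp only [bernsteinPolynomial, Polynomial.eval_mul, Polynomial.eval_natCast,
      Polynomial.eval_pow, Polynomial.eval_X, Polynomial.eval_sub, Polynomial.eval_one,
      Nat.add_sub_add_right]
    have hc : ((M + 1).choose (ν + 1) : ℝ) * (ν + 1) = (M + 1) * M.choose ν := by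
      exact_mod_cast (Nat.add_one_mul_choose_eq M ν).symm
    have hν0 : (ν : ℝ) + 1 ≠ 0 := by positivity
    rw [eq_div_of_mul_eq hν0 hc, pow_succ]
    ring
  have hlogI : IntervalIntegrable
      (fun x => (M + 1) * (bernsteinPolynomial ℝ M κ).eval x * Real.log x) volume 0 1 :=
    intervalIntegral.intervalIntegrable_log'.continuousOn_mul
      (continuous_const.mul (Polynomial.continuous _)).continuousOn
  refine ⟨hlogI, ?_⟩
  have hF : ContinuousOn (fun x => x * Real.log x * q x) (Set.Icc 0 1) :=
    (Real.continuous_mul_log.mul hqc).continuousOn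
  have hd : ∀ x ∈ Set.Ioo (0 : ℝ) 1, HasDerivAt (fun x => x * Real.log x * q x)
      ((M + 1) * (bernsteinPolynomial ℝ M κ).eval x * Real.log x + q x) x := by
    intro x hx
    have h1 := (hasDerivAt_binomTail h x).mul (Real.hasDerivAt_log hx.1.ne')
    rw [hqx, mul_comm x (q x), mul_inv_cancel_right₀ hx.1.ne'] at h1
    refine h1.congr_of_eventuallyEq (.of_forall fun y => ?_)
    simp only [Pi.mul_apply, hqx]
    ring
  have h2 := intervalIntegral.integral_eq_sub_of_hasDerivAt_of_le zero_le_one hF hd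
    (hlogI.add (hqc.intervalIntegrable 0 1))
  rw [intervalIntegral.integral_add hlogI (hqc.intervalIntegrable 0 1)] at h2
  have h3 : ∫ x in (0 : ℝ)..1, q x = ∑ ν ∈ Ico κ (M + 1), 1 / ((ν : ℝ) + 1) := by
    rw [hq, intervalIntegral.integral_finsetSum fun ν _ =>
      ((Polynomial.continuous _).intervalIntegrable _ _).const_mul _]
    refine sum_congr rfl fun ν hν => ?_
    rw [intervalIntegral.integral_const_mul,
      integral_bernstein (Nat.lt_succ_iff.1 (mem_Ico.1 hν).2)]
    have : (M : ℝ) + 1 ≠ 0 := by positivity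
    field_simp
  rw [h3] at h2
  simp only [Real.log_one, mul_zero, zero_mul, sub_zero] at h2
  linarith

theorem integral_log_betaMeasure (h : κ ≤ M) :
    Integrable Real.log (ProbabilityTheory.betaMeasure (κ + 1) (M + 1 - κ)) ∧
    ∫ x, Real.log x ∂(ProbabilityTheory.betaMeasure (κ + 1) (M + 1 - κ)) =
      -∑ ν ∈ Ico κ (M + 1), 1 / ((ν : ℝ) + 1) := by
  have hm : Measurable (ProbabilityTheory.betaPDF (κ + 1) (M + 1 - κ)) :=
    (ProbabilityTheory.measurable_betaPDFReal _ _).ennreal_ofReal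
  have hfin : ∀ᵐ x : ℝ, ProbabilityTheory.betaPDF (κ + 1) (M + 1 - κ) x < ⊤ :=
    .of_forall fun x => ENNReal.ofReal_lt_top
  have e : (fun x => (ProbabilityTheory.betaPDF (κ + 1) (M + 1 - κ) x).toReal • Real.log x) =
      (Set.Ioo (0 : ℝ) 1).indicator
        fun x => (M + 1) * (bernsteinPolynomial ℝ M κ).eval x * Real.log x := by
    funext x
    rw [betaPDF_eq_indicator]
    by_cases hx : x ∈ Set.Ioo (0 : ℝ) 1
    · have := bernstein_eval_nonneg M κ (x := x) ⟨hx.1.le, hx.2.le⟩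
      rw [Set.indicator_of_mem hx, Set.indicator_of_mem hx, betaPDFReal_eq h hx,
        ENNReal.toReal_ofReal (by positivity), smul_eq_mul]
    · rw [Set.indicator_of_notMem hx, Set.indicator_of_notMem hx]; simp
  obtain ⟨h1, h2⟩ := integral_log_mul_bernstein h
  rw [intervalIntegrable_iff_integrableOn_Ioo_of_le zero_le_one] at h1
  rw [intervalIntegral.integral_of_le zero_le_one, integral_Ioc_eq_integral_Ioo] at h2
  constructor
  · rw [ProbabilityTheory.betaMeasure, integrable_withDensity_iff_integrable_smul' hm hfin, e]
    exact (integrable_indicator_iff measurableSet_Ioo).2 h1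
  · rw [ProbabilityTheory.betaMeasure, integral_withDensity_eq_integral_toReal_smul hm hfin, e,
      integral_indicator measurableSet_Ioo, h2]

theorem digamma_natCast_succ (n : ℕ) :
    digamma (n + 1 : ℕ) = -Real.eulerMascheroniConstant + harmonic n := by
  have : (n.factorial : ℝ) ≠ 0 := by positivity
  rw [digamma, logDeriv_apply, Nat.cast_add_one, Real.deriv_Gamma_nat, Real.Gamma_nat_eq_factorial]
  field_simp

theorem sum_Ico_eq_harmonic_sub (h : κ ≤ M) :
    ∑ ν ∈ Ico κ (M + 1), 1 / ((ν : ℝ) + 1) = (harmonic (M + 1) : ℝ) - harmonic κ := by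
  rw [sum_Ico_eq_sub _ (h.trans (Nat.le_succ M))]
  simp [harmonic]

/-- `log (n - 1)` approximates `Ψ(n)` to order `1 / n`. -/
theorem abs_log_sub_digamma_le {N : ℕ} (hN : 1 ≤ N) :
    |Real.log N - digamma (N + 1 : ℕ)| ≤ 1 / N := by
  have hN0 : (0 : ℝ) < N := by exact_mod_cast hN
  have h1 := Real.eulerMascheroniSeq_lt_eulerMascheroniConstant N
  have h2 := Real.eulerMascheroniConstant_lt_eulerMascheroniSeq' N
  rw [Real.eulerMascheroniSeq] at h1
  rw [Real.eulerMascheroniSeq', if_neg (by omega)] at h2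
  rw [digamma_natCast_succ]
  have h3 : Real.log (N + 1) - Real.log N ≤ 1 / N := by
    rw [← Real.log_div (by positivity) hN0.ne']
    refine (Real.log_le_sub_one_of_pos (by positivity)).trans (le_of_eq ?_)
    field_simp
    ring
  rw [abs_le]
  constructor <;> linarith [one_div_pos.2 hN0]

end Beta

end

/-! ### Masses of balls and nearest neighbours -/

section

section BallMass

variable {E : Type*} [NormedAddCommGroup E] [MeasurableSpace E]

/-- The mass `h_x(r)` of the closed ball of radius `r` about `x`. -/
noncomputable def ballMass (P : Measure E) (x : E) (r : ℝ) : ℝ := P.real (Metric.closedBall x r)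

variable {P : Measure E} {x : E}

theorem ballMass_nonneg (r : ℝ) : 0 ≤ ballMass P x r := measureReal_nonneg

theorem ballMass_le_one [IsProbabilityMeasure P] (r : ℝ) : ballMass P x r ≤ 1 := measureReal_le_one

theorem ballMass_mono [IsFiniteMeasure P] : Monotone (ballMass P x) := fun _ _ h =>
  measureReal_mono (Metric.closedBall_subset_closedBall h)

theorem ballMass_of_neg {r : ℝ} (hr : r < 0) : ballMass P x r = 0 := by
  rw [ballMass, Metric.closedBall_eq_empty.2 hr, measureReal_empty]

variable [BorelSpace E]

/-- The distribution of the distance to `x`. -/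
theorem ballMass_eq_map_Iic (r : ℝ) :
    ballMass P x r = (P.map fun y => ‖y - x‖).real (Set.Iic r) := by
  rw [ballMass, map_measureReal_apply (by fun_prop) measurableSet_Iic]
  congr 1
  ext y
  simp [dist_eq_norm]

theorem continuous_ballMass [IsProbabilityMeasure P]
    (hP : ∀ r, P (Metric.sphere x r) = 0) : Continuous (ballMass P x) := by
  have hmeas : Measurable fun y : E => ‖y - x‖ := by fun_prop
  have : IsProbabilityMeasure (P.map fun y => ‖y - x‖) :=
    Measure.isProbabilityMeasure_map hmeas.aemeasurable
  have : NullSingletonClass (P.map fun y => ‖y - x‖) := by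
    refine ⟨fun r => ?_⟩
    rw [Measure.map_apply hmeas (measurableSet_singleton r)]
    refine measure_mono_null (fun y hy => ?_) (hP r)
    simpa [dist_eq_norm] using hy
  have e : ballMass P x = ProbabilityTheory.cdf (P.map fun y => ‖y - x‖) := by
    funext r; rw [ballMass_eq_map_Iic, ProbabilityTheory.cdf_eq_real]
  rw [e, continuous_iff_continuousAt]
  intro r
  rw [(ProbabilityTheory.cdf _).mono.continuousAt_iff_leftLim_eq_rightLim,
    StieltjesFunction.rightLim_eq]
  have h := (ProbabilityTheory.cdf (P.map fun y => ‖y - x‖)).measure_singleton r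
  rw [ProbabilityTheory.measure_cdf, measure_singleton, eq_comm, ENNReal.ofReal_eq_zero] at h
  exact le_antisymm ((ProbabilityTheory.cdf _).mono.leftLim_le le_rfl) (by linarith)

theorem tendsto_ballMass [IsProbabilityMeasure P] :
    Filter.Tendsto (ballMass P x) Filter.atTop (nhds 1) := by
  have hmeas : Measurable fun y : E => ‖y - x‖ := by fun_prop
  have : IsProbabilityMeasure (P.map fun y => ‖y - x‖) :=
    Measure.isProbabilityMeasure_map hmeas.aemeasurable
  have e : ballMass P x = ProbabilityTheory.cdf (P.map fun y => ‖y - x‖) := by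
    funext r; rw [ballMass_eq_map_Iic, ProbabilityTheory.cdf_eq_real]
  rw [e]
  exact ProbabilityTheory.tendsto_cdf_atTop _

/-- Probability integral transform: the mass of the ball that reaches out to a random point is
uniformly distributed. -/
theorem measureReal_ballMass_le [IsProbabilityMeasure P] (hP : ∀ r, P (Metric.sphere x r) = 0)
    {s : ℝ} (hs : s ∈ Set.Ico (0 : ℝ) 1) : P.real {y | ballMass P x ‖y - x‖ ≤ s} = s := by
  have hc := continuous_ballMass hP
  -- the largest radius of a ball of mass `s`
  set A : Set ℝ := {r | ballMass P x r ≤ s} with hA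
  have hcl : IsClosed A := isClosed_le hc continuous_const
  have hbdd : BddAbove A := by
    obtain ⟨r, hr⟩ := (tendsto_ballMass (P := P) (x := x)).eventually (lt_mem_nhds hs.2) |>.exists
    refine ⟨r, fun r' hr' => ?_⟩
    by_contra! h
    exact absurd (hr.trans_le (ballMass_mono h.le)) (not_lt.2 hr')
  have hne : A.Nonempty := ⟨-1, by
    change ballMass P x (-1) ≤ s
    rw [ballMass_of_neg (by norm_num)]; exact hs.1⟩
  have hmem : sSup A ∈ A := hcl.csSup_mem hne hbdd
  have hval : ballMass P x (sSup A) = s := by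
    refine le_antisymm hmem (le_of_not_gt fun hlt => ?_)
    obtain ⟨r, hr1, hr2⟩ := (Filter.Eventually.and (self_mem_nhdsWithin (s := Set.Ioi (sSup A)))
      ((hc.continuousAt.eventually (gt_mem_nhds hlt)).filter_mono nhdsWithin_le_nhds)).exists
    exact absurd (le_csSup hbdd (show r ∈ A from le_of_lt hr2)) (not_le.2 hr1)
  have hset : {y | ballMass P x ‖y - x‖ ≤ s} = Metric.closedBall x (sSup A) := by
    ext y
    rw [Metric.mem_closedBall, dist_eq_norm]
    exact ⟨fun h => le_csSup hbdd h, fun h => (ballMass_mono h).trans hmem⟩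
  rw [hset]
  exact hval

/-- The distance from `x` to its `k`-th nearest neighbour among the points `Y j`. -/
noncomputable def kthDist {N : ℕ} (k : ℕ) (x : E) (Y : Fin N → E) : ℝ :=
  orderStat k fun j => ‖Y j - x‖

theorem measurableSet_le_card {Ω : Type*} [MeasurableSpace Ω] {N : ℕ} (k : ℕ)
    {g : Fin N → Ω → ℝ} (hg : ∀ j, Measurable (g j)) (r : ℝ) :
    MeasurableSet {ω | k ≤ #{j | g j ω ≤ r}} := by
  have : Measurable fun ω => #{j | g j ω ≤ r} := by
    simp_rw [card_filter]
    exact Finset.measurable_sum _ fun j _ =>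
      Measurable.ite (measurableSet_le (hg j) measurable_const) measurable_const measurable_const
  exact measurableSet_le measurable_const this

theorem measurable_kthDist [SecondCountableTopology E] {N k : ℕ} (hk : 1 ≤ k) (hkN : k ≤ N) :
    Measurable fun p : E × (Fin N → E) => kthDist k p.1 p.2 := by
  refine measurable_of_Iic fun r => ?_
  have : (fun p : E × (Fin N → E) => kthDist k p.1 p.2) ⁻¹' Set.Iic r =
      {p | k ≤ #{j | ‖p.2 j - p.1‖ ≤ r}} := by
    ext p
    exact orderStat_le_iff hk hkN fun _ => norm_nonneg _
  rw [this]
  exact measurableSet_le_card k (fun j => by fun_prop) r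

theorem measurable_ballMass [SecondCountableTopology E] [SFinite P] :
    Measurable fun p : E × ℝ => ballMass P p.1 p.2 := by
  have h : MeasurableSet {q : (E × ℝ) × E | ‖q.2 - q.1.1‖ ≤ q.1.2} :=
    measurableSet_le (by fun_prop) (by fun_prop)
  have h2 := (measurable_measure_prodMk_left (ν := P) h).ennreal_toReal
  convert! h2 using 2 with p
  rw [ballMass, Measure.real]
  congr 2
  ext y
  simp [dist_eq_norm]

theorem measurable_ballMass_left [SecondCountableTopology E] [SFinite P] (r : ℝ) :
    Measurable fun x => ballMass P x r := measurable_ballMass.comp measurable_prodMk_right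

theorem measurable_ballMass_kthDist [SecondCountableTopology E] [SFinite P] {N k : ℕ} (hk : 1 ≤ k)
    (hkN : k ≤ N) :
    Measurable fun p : E × (Fin N → E) => ballMass P p.1 (kthDist k p.1 p.2) :=
  measurable_ballMass.comp (measurable_fst.prodMk (measurable_kthDist hk hkN))

theorem measurable_kthDist_right {N k : ℕ} [SecondCountableTopology E] (hk : 1 ≤ k) (hkN : k ≤ N)
    (x : E) : Measurable fun Y : Fin N → E => kthDist k x Y := by
  refine measurable_of_Iic fun r => ?_
  have : (fun Y : Fin N → E => kthDist k x Y) ⁻¹' Set.Iic r = {Y | k ≤ #{j | ‖Y j - x‖ ≤ r}} := by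
    ext p
    exact orderStat_le_iff hk hkN fun _ => norm_nonneg _
  rw [this]
  exact measurableSet_le_card k (fun j => by fun_prop) r

theorem measurable_ballMass_kthDist_right [SecondCountableTopology E] [IsFiniteMeasure P]
    {N k : ℕ} (hk : 1 ≤ k) (hkN : k ≤ N) (x : E) :
    Measurable fun Y : Fin N → E => ballMass P x (kthDist k x Y) :=
  ballMass_mono.measurable.comp (measurable_kthDist_right hk hkN x)

/-- The mass of the ball about `x` that reaches out to the `k`-th nearest neighbour of `x` has a
beta distribution. -/
theorem map_ballMass_kthDist [SecondCountableTopology E] [IsProbabilityMeasure P]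
    (hP : ∀ r, P (Metric.sphere x r) = 0) {κ M : ℕ} (h : κ ≤ M) :
    (Measure.pi fun _ : Fin (M + 1) => P).map
        (fun Y => ballMass P x (kthDist (κ + 1) x Y)) =
      ProbabilityTheory.betaMeasure (κ + 1) (M + 1 - κ) := by
  classical
  have hm : Measurable fun Y : Fin (M + 1) → E => ballMass P x (kthDist (κ + 1) x Y) :=
    measurable_ballMass_kthDist_right (Nat.le_add_left 1 κ) (Nat.succ_le_succ h) x
  have : IsProbabilityMeasure ((Measure.pi fun _ : Fin (M + 1) => P).map
        (fun Y => ballMass P x (kthDist (κ + 1) x Y))) :=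
    Measure.isProbabilityMeasure_map hm.aemeasurable
  refine eq_betaMeasure_of_Iic h _ (fun s hs => ?_) ?_
  · rw [Measure.map_apply hm measurableSet_Iic]
    have hA : MeasurableSet {y | ballMass P x ‖y - x‖ ≤ s} :=
      measurableSet_le (ballMass_mono.measurable.comp (by fun_prop)) measurable_const
    have hset : (fun Y : Fin (M + 1) → E => ballMass P x (kthDist (κ + 1) x Y)) ⁻¹' Set.Iic s =
        {Y | κ + 1 ≤ #{j | Y j ∈ {y | ballMass P x ‖y - x‖ ≤ s}}} := by
      ext Y
      exact comp_orderStat_le_iff (Nat.le_add_left 1 κ) (Nat.succ_le_succ h)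
        (fun _ => norm_nonneg _) ballMass_mono
    rw [hset, pi_le_card_filter P hA, measureReal_ballMass_le hP hs, binomTail]
  · rw [Measure.map_apply hm measurableSet_Iic]
    convert measure_univ (μ := Measure.pi fun _ : Fin (M + 1) => P)
    ext Y
    simpa using ballMass_le_one _

end BallMass

/-- Dropping the `i`-th point, the `k`-th nearest neighbour distance of the `i`-th point is its
distance to the `k`-th nearest among the remaining points. -/
theorem nnDist_eq_kthDist {d N : ℕ} (k : ℕ) (X : Fin (N + 1) → EuclideanSpace ℝ (Fin d))
    (i : Fin (N + 1)) : nnDist k X i = kthDist k (X i) fun j => X (i.succAbove j) := by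
  rw [nnDist, kthDist, orderStat]
  congr 1
  ext r
  simp only [Set.mem_ofPred_eq]
  have : (univ.filter fun j => j ≠ i ∧ ‖X j - X i‖ ≤ r) =
      (univ.filter fun j => ‖X (i.succAbove j) - X i‖ ≤ r).map i.succAboveEmb := by
    ext j
    simp only [mem_filter, mem_univ, true_and, mem_map, Fin.succAboveEmb_apply]
    constructor
    · rintro ⟨h1, h2⟩
      obtain ⟨j', rfl⟩ := Fin.exists_succAbove_eq h1
      exact ⟨j', h2, rfl⟩
    · rintro ⟨j', h, rfl⟩
      exact ⟨Fin.succAbove_ne i j', h⟩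
  rw [this, card_map]

end

/-! ### Taylor's formula -/

section

/-- Taylor's formula with the remainder controlled by the oscillation of the top derivative. The
top derivative need not be continuous. -/
theorem abs_sub_taylor_le {m : ℕ} {B : ℝ} : ∀ (g : ℕ → ℝ → ℝ),
    (∀ j < m, ∀ τ, HasDerivAt (g j) (g (j + 1) τ) τ) →
    (∀ τ ∈ Set.Icc (0 : ℝ) 1, |g m τ - g m 0| ≤ B) →
    ∀ τ ∈ Set.Icc (0 : ℝ) 1,
      |g 0 τ - ∑ j ∈ range (m + 1), g j 0 * (τ ^ j / j.factorial)| ≤ B := by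
  induction m with
  | zero => intro g _ h τ hτ; simpa using h τ hτ
  | succ m ih =>
    intro g hd h τ hτ
    have ih' := ih (fun j => g (j + 1)) (fun j hj => hd (j + 1) (by omega)) h
    set q : ℝ → ℝ := fun τ => g 0 τ - ∑ j ∈ range (m + 1 + 1), g j 0 * (τ ^ j / j.factorial) with hq
    have hder : ∀ τ, HasDerivAt q
        (g 1 τ - ∑ j ∈ range (m + 1), g (j + 1) 0 * (τ ^ j / j.factorial)) τ := by
      intro τ
      refine (hd 0 (by omega) τ).sub ?_
      simp_rw [sum_range_succ' _ (m + 1)]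
      have h1 : HasDerivAt (fun τ : ℝ =>
          ∑ j ∈ range (m + 1), g (j + 1) 0 * (τ ^ (j + 1) / (j + 1).factorial))
          (∑ j ∈ range (m + 1), g (j + 1) 0 * (τ ^ j / j.factorial)) τ := by
        refine HasDerivAt.fun_sum fun j _ => HasDerivAt.const_mul _ ?_
        have := (hasDerivAt_pow (j + 1) τ).div_const ((j + 1).factorial : ℝ)
        convert this using 1
        rw [Nat.factorial_succ]
        have h1 : (j.factorial : ℝ) ≠ 0 := by positivity
        push_cast
        field_simp
      simpa using h1.add_const (g 0 0)
    have h0 : q 0 = 0 := by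
      simp only [hq, sum_range_succ' _ (m + 1)]
      simp
    have hB : 0 ≤ B := (abs_nonneg _).trans (ih' 0 (by simp))
    have hmv := (convex_Icc (0 : ℝ) 1).norm_image_sub_le_of_norm_hasDerivWithin_le
      (fun τ _ => (hder τ).hasDerivWithinAt) (fun τ hτ => ih' τ hτ)
      (Set.left_mem_Icc.2 zero_le_one) hτ
    rw [h0, sub_zero, sub_zero, Real.norm_eq_abs, Real.norm_eq_abs, abs_of_nonneg hτ.1] at hmv
    exact hmv.trans (mul_le_of_le_one_right hB hτ.2)

variable {d : ℕ}

local notation "E" => EuclideanSpace ℝ (Fin d)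

theorem arrayNorm_nonneg {m : ℕ} (T : ContinuousMultilinearMap ℝ (fun _ : Fin m => E) ℝ) :
    0 ≤ arrayNorm T := Real.sqrt_nonneg _

/-- By the Cauchy-Schwarz inequality, applied to the array of coordinates. -/
theorem abs_apply_le_arrayNorm {m : ℕ} (T : ContinuousMultilinearMap ℝ (fun _ : Fin m => E) ℝ)
    (v : E) : |T fun _ => v| ≤ arrayNorm T * ‖v‖ ^ m := by
  classical
  have hv : v = ∑ i, v i • EuclideanSpace.single i (1 : ℝ) := by
    ext j
    simp [Pi.single_apply]
  have e : (T fun _ => v) = ∑ j : Fin m → Fin d,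
      (T fun i => EuclideanSpace.single (j i) (1 : ℝ)) * ∏ i, v (j i) := by
    conv_lhs => rw [hv]
    rw [T.map_sum]
    refine sum_congr rfl fun j _ => ?_
    rw [T.map_smul_univ, smul_eq_mul, mul_comm]
  have hnorm : ∑ j : Fin m → Fin d, (∏ i, v (j i)) ^ 2 = (‖v‖ ^ m) ^ 2 := by
    rw [← pow_mul, mul_comm m 2, pow_mul, EuclideanSpace.norm_sq_eq]
    simp_rw [← prod_pow, Real.norm_eq_abs, sq_abs]
    rw [← Fintype.piFinset_univ, ← prod_univ_sum (fun _ : Fin m => (univ : Finset (Fin d)))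
      (fun _ i => v i ^ 2)]
    simp
  rw [e, arrayNorm]
  refine abs_le_of_sq_le_sq ?_ (by positivity)
  rw [mul_pow, Real.sq_sqrt (sum_nonneg fun _ _ => sq_nonneg _), ← hnorm]
  exact sum_mul_sq_le_sq_mul_sq _ _ _

theorem hasDerivAt_iteratedFDeriv_line {f : E → ℝ} {j : ℕ}
    (hf : Differentiable ℝ (iteratedFDeriv ℝ j f)) (x v : E) (τ : ℝ) :
    HasDerivAt (fun τ : ℝ => iteratedFDeriv ℝ j f (x + τ • v) fun _ => v)
      (iteratedFDeriv ℝ (j + 1) f (x + τ • v) fun _ => v) τ := by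
  have h1 : HasDerivAt (fun τ : ℝ => x + τ • v) v τ := by
    simpa using ((hasDerivAt_id τ).smul_const v).const_add x
  have h2 := (hf (x + τ • v)).hasFDerivAt.comp_hasDerivAt τ h1
  have h3 := (ContinuousMultilinearMap.apply ℝ (fun _ : Fin j => E) ℝ
    (fun _ => v)).hasFDerivAt.comp_hasDerivAt τ h2
  exact h3

/-- Taylor's formula along the segment from `x` to `x + v`. -/
theorem TimesDifferentiable.abs_sub_taylor_le {f : E → ℝ} {m : ℕ} (hf : TimesDifferentiable m f)
    {x v : E} {B : ℝ}
    (hB : ∀ τ ∈ Set.Icc (0 : ℝ) 1,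
      |(iteratedFDeriv ℝ m f (x + τ • v) - iteratedFDeriv ℝ m f x) fun _ => v| ≤ B) :
    |f (x + v) - ∑ j ∈ range (m + 1), (iteratedFDeriv ℝ j f x fun _ => v) / j.factorial| ≤ B := by
  have h := KLEntropy.abs_sub_taylor_le (m := m) (B := B)
    (fun j τ => iteratedFDeriv ℝ j f (x + τ • v) fun _ => v)
    (fun j hj τ => hasDerivAt_iteratedFDeriv_line (hf j hj) x v τ)
    (fun τ hτ => by simpa using hB τ hτ) 1 (by simp)
  simpa [div_eq_mul_inv] using h

end

/-! ### The mass of a small ball -/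

section

variable {d : ℕ}

local notation "E" => EuclideanSpace ℝ (Fin d)

/-- The law with density `f`. -/
noncomputable def densityLaw (f : E → ℝ) : Measure E :=
  volume.withDensity fun x => ENNReal.ofReal (f x)

theorem IsDensity.isProbabilityMeasure {f : E → ℝ} (hf : IsDensity f) :
    IsProbabilityMeasure (densityLaw f) :=
  ⟨by rw [densityLaw, withDensity_apply _ MeasurableSet.univ, Measure.restrict_univ, hf.2.2]⟩

theorem IsDensity.integrable {f : E → ℝ} (hf : IsDensity f) : Integrable f := by
  refine ⟨hf.1.aestronglyMeasurable, ?_⟩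
  rw [hasFiniteIntegral_iff_ofReal (.of_forall hf.2.1), hf.2.2]
  exact ENNReal.one_lt_top

theorem ballMass_densityLaw {f : E → ℝ} (hf : IsDensity f) (x : E) (r : ℝ) :
    ballMass (densityLaw f) x r = ∫ y in Metric.closedBall x r, f y := by
  rw [ballMass, Measure.real, densityLaw, withDensity_apply _ measurableSet_closedBall,
    integral_eq_lintegral_of_nonneg_ae (.of_forall hf.2.1) hf.1.aestronglyMeasurable]

theorem densityLaw_sphere (hd : 1 ≤ d) (f : E → ℝ) (x : E) (r : ℝ) :
    densityLaw f (Metric.sphere x r) = 0 := by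
  have : Nontrivial E := by
    have : Nonempty (Fin d) := ⟨⟨0, hd⟩⟩
    infer_instance
  exact withDensity_absolutelyContinuous _ _ (Measure.addHaar_sphere volume x r)

theorem unitBallVolume_pos (d : ℕ) : 0 < unitBallVolume d := by
  rw [unitBallVolume]
  have := Real.Gamma_pos_of_pos (show (0 : ℝ) < 1 + (d : ℝ) / 2 by positivity)
  positivity

theorem volume_real_closedBall_one (hd : 1 ≤ d) :
    volume.real (Metric.closedBall (0 : E) 1) = unitBallVolume d := by
  have : Nonempty (Fin d) := ⟨⟨0, hd⟩⟩
  rw [Measure.real, EuclideanSpace.volume_closedBall, ENNReal.ofReal_one, one_pow, one_mul,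
    ENNReal.toReal_ofReal, unitBallVolume, Fintype.card_fin, add_comm (1 : ℝ)]
  · congr 1
    rw [Real.sqrt_eq_rpow, ← Real.rpow_mul_natCast Real.pi_pos.le]
    congr 1
    ring
  · have := Real.Gamma_pos_of_pos (show (0 : ℝ) < (Fintype.card (Fin d) : ℝ) / 2 + 1 by positivity)
    positivity

/-- Integrals over balls, rescaled to the unit ball. -/
theorem setIntegral_closedBall (g : E → ℝ) (x : E) {r : ℝ} (hr : 0 < r) :
    ∫ y in Metric.closedBall x r, g y =
      r ^ d * ∫ u in Metric.closedBall (0 : E) 1, g (x + r • u) := by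
  have h1 := (measurePreserving_add_left (volume : Measure E) x).setIntegral_preimage_emb
    (measurableEmbedding_addLeft x) g (Metric.closedBall x r)
  have h2 := Measure.setIntegral_comp_smul_of_pos (volume : Measure E) (fun v => g (x + v))
    (Metric.closedBall (0 : E) 1) hr
  have e1 : (fun v => x + v) ⁻¹' Metric.closedBall x r = Metric.closedBall (0 : E) r := by
    ext v; simp
  have e2 : r • Metric.closedBall (0 : E) 1 = Metric.closedBall 0 r := by
    rw [smul_closedBall _ _ zero_le_one]; simp [abs_of_pos hr]
  rw [e1] at h1
  rw [e2, h1, finrank_euclideanSpace_fin, smul_eq_mul] at h2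
  rw [h2, ← mul_assoc, mul_inv_cancel₀ (by positivity), one_mul]

/-- The integral of the form `u ↦ T(u, …, u)` over the unit ball. -/
noncomputable def ballIntegral {m : ℕ} (T : ContinuousMultilinearMap ℝ (fun _ : Fin m => E) ℝ) :
    ℝ := ∫ u in Metric.closedBall (0 : E) 1, T fun _ => u

theorem integrableOn_form {m : ℕ} (T : ContinuousMultilinearMap ℝ (fun _ : Fin m => E) ℝ) :
    IntegrableOn (fun u => T fun _ => u) (Metric.closedBall (0 : E) 1) := by
  have : Continuous fun u => T fun _ => u := T.cont.comp (continuous_pi fun _ => continuous_id)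
  exact this.continuousOn.integrableOn_compact (isCompact_closedBall _ _)

theorem ballIntegral_eq_zero {m : ℕ} (hm : Odd m)
    (T : ContinuousMultilinearMap ℝ (fun _ : Fin m => E) ℝ) : ballIntegral T = 0 := by
  rw [ballIntegral, ← integral_indicator measurableSet_closedBall]
  have h := integral_neg_eq_self
    ((Metric.closedBall (0 : E) 1).indicator fun u => T fun _ => u) volume
  have e : ∀ u, (Metric.closedBall (0 : E) 1).indicator (fun u => T fun _ => u) (-u) =
      -(Metric.closedBall (0 : E) 1).indicator (fun u => T fun _ => u) u := by
    intro u
    by_cases hu : u ∈ Metric.closedBall (0 : E) 1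
    · have hu' : -u ∈ Metric.closedBall (0 : E) 1 := by simpa using hu
      have hT := T.map_smul_univ (fun _ => (-1 : ℝ)) (fun _ => u)
      simp only [neg_smul, one_smul, prod_const, card_univ, Fintype.card_fin, hm.neg_one_pow] at hT
      rw [Set.indicator_of_mem hu, Set.indicator_of_mem hu', hT]
    · have hu' : -u ∉ Metric.closedBall (0 : E) 1 := by simpa using hu
      rw [Set.indicator_of_notMem hu, Set.indicator_of_notMem hu', neg_zero]
  simp_rw [e, integral_neg] at h
  linarith

theorem abs_ballIntegral_le (hd : 1 ≤ d) {m : ℕ}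
    (T : ContinuousMultilinearMap ℝ (fun _ : Fin m => E) ℝ) :
    |ballIntegral T| ≤ arrayNorm T * unitBallVolume d := by
  rw [← volume_real_closedBall_one hd, ballIntegral, ← Real.norm_eq_abs]
  have hlt : volume (Metric.closedBall (0 : E) 1) < ⊤ := measure_closedBall_lt_top
  refine norm_setIntegral_le_of_norm_le_const hlt fun u hu => ?_
  refine (abs_apply_le_arrayNorm T u).trans (mul_le_of_le_one_right (arrayNorm_nonneg T) ?_)
  exact pow_le_one₀ (norm_nonneg u) (by simpa using hu)

section DensityClass

variable {θ : Theta} {f : EuclideanSpace ℝ (Fin d) → ℝ} {x : EuclideanSpace ℝ (Fin d)}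

theorem one_le_a (θ : Theta) {δ : ℝ} (hδ : 0 < δ) : 1 ≤ θ.a δ := θ.a_mem.2.1 δ hδ

theorem smoothnessOrder_lt (θ : Theta) : (smoothnessOrder θ.β : ℝ) < θ.β := by
  have h := Nat.ceil_pos.2 θ.β_pos
  rw [← Nat.lt_ceil, smoothnessOrder]
  omega

theorem smoothness_le (hf : f ∈ densityClass d θ) (hx : 0 < f x) :
    smoothness f θ.a θ.β x ≤ ENNReal.ofReal (θ.a (f x)) :=
  (le_iSup₂ (f := fun y (_ : y ∈ {y | f x ≤ f y}) => smoothness f θ.a θ.β y) x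
    (le_refl (f x))).trans
    (hf.2.2.2.2 (f x) hx)

theorem arrayNorm_deriv_le (hf : f ∈ densityClass d θ) (hx : 0 < f x) {t : ℕ} (ht1 : 1 ≤ t)
    (ht : t ≤ smoothnessOrder θ.β) :
    arrayNorm (iteratedFDeriv ℝ t f x) ≤ θ.a (f x) * f x := by
  have h := (le_max_left _ _).trans (smoothness_le hf hx)
  rw [iSup₂_le_iff] at h
  have h := h t (mem_Icc.2 ⟨ht1, ht⟩)
  rwa [ENNReal.ofReal_le_ofReal_iff (zero_le_one.trans (one_le_a θ hx)), div_le_iff₀ hx] at h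

theorem arrayNorm_deriv_sub_le (hf : f ∈ densityClass d θ) (hx : 0 < f x)
    {y : EuclideanSpace ℝ (Fin d)} (hy : ‖y - x‖ ≤ radius f θ.a θ.β x) :
    arrayNorm (iteratedFDeriv ℝ (smoothnessOrder θ.β) f y
        - iteratedFDeriv ℝ (smoothnessOrder θ.β) f x) ≤
      θ.a (f x) * f x * ‖y - x‖ ^ (θ.β - smoothnessOrder θ.β) := by
  have ha := zero_le_one.trans (one_le_a θ hx)
  rcases eq_or_ne y x with rfl | hne
  · rw [sub_self]
    simp only [arrayNorm, zero_apply]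
    simp only [ne_eq, OfNat.ofNat_ne_zero, not_false_eq_true, zero_pow, sum_const_zero,
      Real.sqrt_zero]
    positivity
  · have h := (le_max_right _ _).trans (smoothness_le hf hx)
    rw [iSup₂_le_iff] at h
    have h := h y ⟨by rwa [Metric.mem_closedBall, dist_eq_norm], hne⟩
    have hpos : 0 < ‖y - x‖ := norm_pos_iff.2 (sub_ne_zero.2 hne)
    rwa [ENNReal.ofReal_le_ofReal_iff ha, div_le_iff₀ (by positivity), ← mul_assoc] at h

/-- Local Taylor expansion of a density of the class. -/
theorem abs_density_sub_taylor_le (hf : f ∈ densityClass d θ) (hx : 0 < f x)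
    {v : EuclideanSpace ℝ (Fin d)} (hv : ‖v‖ ≤ radius f θ.a θ.β x) :
    |f (x + v) - ∑ j ∈ range (smoothnessOrder θ.β + 1),
        (iteratedFDeriv ℝ j f x fun _ => v) / j.factorial| ≤ θ.a (f x) * f x * ‖v‖ ^ θ.β := by
  refine hf.2.1.abs_sub_taylor_le fun τ hτ => ?_
  have ha := zero_le_one.trans (one_le_a θ hx)
  have hm := smoothnessOrder_lt θ
  have hn : ‖x + τ • v - x‖ = τ * ‖v‖ := by
    rw [add_sub_cancel_left, norm_smul, Real.norm_of_nonneg hτ.1]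
  have hle : τ * ‖v‖ ≤ ‖v‖ := mul_le_of_le_one_left (norm_nonneg v) hτ.2
  have h := arrayNorm_deriv_sub_le hf hx (y := x + τ • v) (by rw [hn]; exact hle.trans hv)
  rw [hn] at h
  have e : ‖v‖ ^ θ.β = ‖v‖ ^ (θ.β - smoothnessOrder θ.β) * ‖v‖ ^ smoothnessOrder θ.β := by
    rw [← Real.rpow_natCast, ← Real.rpow_add' (norm_nonneg v), sub_add_cancel]
    rw [sub_add_cancel]; exact θ.β_pos.ne'
  rw [e, ← mul_assoc]
  refine (abs_apply_le_arrayNorm _ v).trans (mul_le_mul_of_nonneg_right (h.trans ?_)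
    (by positivity))
  exact mul_le_mul_of_nonneg_left (Real.rpow_le_rpow (mul_nonneg hτ.1 (norm_nonneg v)) hle
    (by linarith)) (by positivity)

/-- The coefficient of `r ^ (2 l)` in the expansion of `h_x(r) / (V_d f(x) r ^ d)`. -/
noncomputable def massCoef (f : EuclideanSpace ℝ (Fin d) → ℝ) (x : EuclideanSpace ℝ (Fin d))
    (l : ℕ) : ℝ :=
  ballIntegral (iteratedFDeriv ℝ (2 * l) f x) / ((2 * l).factorial * (unitBallVolume d * f x))

theorem abs_massCoef_le (hd : 1 ≤ d) (hf : f ∈ densityClass d θ) (hx : 0 < f x) {l : ℕ}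
    (hl : l ∈ Icc 1 (smoothnessOrder θ.β / 2)) : |massCoef f x l| ≤ θ.a (f x) := by
  obtain ⟨h1, h2⟩ := mem_Icc.1 hl
  have hV := unitBallVolume_pos d
  have hfac : (1 : ℝ) ≤ (2 * l).factorial := by exact_mod_cast (2 * l).factorial_pos
  rw [massCoef, abs_div, abs_of_pos (a := _ * (_ * _)) (by positivity), div_le_iff₀ (by positivity)]
  have ha := zero_le_one.trans (one_le_a θ hx)
  calc |ballIntegral (iteratedFDeriv ℝ (2 * l) f x)|
      ≤ θ.a (f x) * f x * unitBallVolume d := (abs_ballIntegral_le hd _).trans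
        (mul_le_mul_of_nonneg_right (arrayNorm_deriv_le hf hx (by omega) (by omega)) hV.le)
    _ = θ.a (f x) * (1 * (unitBallVolume d * f x)) := by ring
    _ ≤ _ := by gcongr

theorem sum_range_eq_sum_even {m : ℕ} (q : ℕ → ℝ) (hq : ∀ j, Odd j → q j = 0) :
    ∑ j ∈ range (m + 1), q j = q 0 + ∑ l ∈ Icc 1 (m / 2), q (2 * l) := by
  have h : ∑ j ∈ range (m + 1), q j = ∑ l ∈ range (m / 2 + 1), q (2 * l) := by
    symm
    rw [← sum_image (g := fun l => 2 * l) (fun a _ b _ h => by simpa using h)]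
    refine sum_subset (fun j hj => ?_) fun j hj hj' => hq j ?_
    · obtain ⟨l, hl, rfl⟩ := mem_image.1 hj
      have := mem_range.1 hl
      exact mem_range.2 (by omega)
    · rw [← Nat.not_even_iff_odd]
      rintro ⟨l, rfl⟩
      have := mem_range.1 hj
      exact hj' (mem_image.2 ⟨l, mem_range.2 (by omega), by ring⟩)
  rw [h, sum_range_succ', add_comm]
  congr 1
  rw [range_eq_Ico, Finset.sum_Ico_add' (fun l => q (2 * l)) 0 (m / 2) 1]
  rfl

/-- Expansion of the mass of small balls. The odd terms of the Taylor expansion integrate to zero by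
symmetry. -/
theorem abs_ballMass_sub_le (hd : 1 ≤ d) (hf : f ∈ densityClass d θ) (hx : 0 < f x) {r : ℝ}
    (hr : 0 < r) (hrx : r ≤ radius f θ.a θ.β x) :
    |ballMass (densityLaw f) x r / (unitBallVolume d * f x * r ^ d) -
        (1 + ∑ l ∈ Icc 1 (smoothnessOrder θ.β / 2), massCoef f x l * (r ^ 2) ^ l)| ≤
      θ.a (f x) * r ^ θ.β := by
  have hV := unitBallVolume_pos d
  have ha := zero_le_one.trans (one_le_a θ hx)
  set m := smoothnessOrder θ.β
  set T : ℕ → EuclideanSpace ℝ (Fin d) → ℝ := fun j u => iteratedFDeriv ℝ j f x fun _ => u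
  have hfi : IntegrableOn (fun u => f (x + r • u)) (Metric.closedBall 0 1) := by
    have h1 : Integrable (fun v => f (x + v)) := hf.1.integrable.comp_add_left x
    exact (h1.comp_smul hr.ne').integrableOn
  have hTi : ∀ j, IntegrableOn (fun u => T j u) (Metric.closedBall 0 1) :=
    fun j => integrableOn_form _
  have hsm : ∀ j u, T j (r • u) = r ^ j * T j u := by
    intro j u
    have := (iteratedFDeriv ℝ j f x).map_smul_univ (fun _ => r) (fun _ => u)
    simpa using this
  have hpoly : IntegrableOn (fun u => ∑ j ∈ range (m + 1), T j (r • u) / j.factorial)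
      (Metric.closedBall 0 1) := by
    refine integrable_finsetSum _ fun j _ => ?_
    simp_rw [hsm]
    exact ((hTi j).const_mul _).div_const _
  have hint : ∫ u in Metric.closedBall (0 : EuclideanSpace ℝ (Fin d)) 1,
      ∑ j ∈ range (m + 1), T j (r • u) / j.factorial =
      unitBallVolume d * f x *
        (1 + ∑ l ∈ Icc 1 (m / 2), massCoef f x l * (r ^ 2) ^ l) := by
    rw [integral_finsetSum _ fun j _ => by
      simp_rw [hsm]; exact ((hTi j).const_mul _).div_const _]
    simp_rw [hsm, integral_div, integral_const_mul]
    rw [sum_range_eq_sum_even]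
    · rw [mul_add, mul_sum]
      congr 1
      · simp only [T, iteratedFDeriv_zero_apply]
        rw [setIntegral_const, volume_real_closedBall_one hd]
        simp
      · refine sum_congr rfl fun l _ => ?_
        rw [massCoef, ← pow_mul, ballIntegral]
        have : ((2 * l).factorial : ℝ) ≠ 0 := by positivity
        field_simp
        rfl
    · intro j hj
      have : ∫ u in Metric.closedBall (0 : EuclideanSpace ℝ (Fin d)) 1, T j u = 0 :=
        ballIntegral_eq_zero hj _
      rw [this]; simp
  have hbound : |(∫ u in Metric.closedBall (0 : EuclideanSpace ℝ (Fin d)) 1, f (x + r • u)) -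
      ∫ u in Metric.closedBall (0 : EuclideanSpace ℝ (Fin d)) 1,
        ∑ j ∈ range (m + 1), T j (r • u) / j.factorial| ≤
      θ.a (f x) * f x * r ^ θ.β * unitBallVolume d := by
    rw [← integral_sub hfi hpoly, ← volume_real_closedBall_one hd, ← Real.norm_eq_abs]
    have hlt : volume (Metric.closedBall (0 : EuclideanSpace ℝ (Fin d)) 1) < ⊤ :=
      measure_closedBall_lt_top
    refine norm_setIntegral_le_of_norm_le_const hlt fun u hu => ?_
    have hu1 : ‖r • u‖ ≤ r := by
      rw [norm_smul, Real.norm_of_nonneg hr.le]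
      exact mul_le_of_le_one_right hr.le (by simpa using hu)
    refine (abs_density_sub_taylor_le hf hx (hu1.trans hrx)).trans ?_
    exact mul_le_mul_of_nonneg_left (Real.rpow_le_rpow (norm_nonneg _) hu1 θ.β_pos.le)
      (by positivity)
  rw [ballMass_densityLaw hf.1, setIntegral_closedBall f x hr]
  rw [hint] at hbound
  have hc : 0 < unitBallVolume d * f x := by positivity
  have e : ∀ I Z : ℝ, r ^ d * I / (unitBallVolume d * f x * r ^ d) - Z =
      (I - unitBallVolume d * f x * Z) / (unitBallVolume d * f x) := by
    intro I Z
    have : r ^ d ≠ 0 := by positivity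
    field_simp
  rw [e, abs_div, abs_of_pos hc, div_le_iff₀ hc]
  refine hbound.trans (le_of_eq (by ring))

end DensityClass

end

/-! ### The expansion in powers of the mass -/

section

/-- The coefficients of an asymptotic expansion in powers of `q → 0` are successive limits. -/
theorem tendsto_expansion_coef {q G : ℕ → ℝ} {e : ℕ → ℝ} {K b : ℝ} {L : ℕ} (hb : (L : ℝ) < b)
    (hq0 : ∀ N, 0 < q N) (hq : Filter.Tendsto q Filter.atTop (nhds 0))
    (h : ∀ᶠ N in Filter.atTop, |G N - ∑ l ∈ range (L + 1), e l * q N ^ l| ≤ K * q N ^ b)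
    {l : ℕ} (hl : l ≤ L) :
    Filter.Tendsto (fun N => (G N - ∑ j ∈ range l, e j * q N ^ j) / q N ^ l) Filter.atTop
      (nhds (e l)) := by
  have hlb : 0 < b - l := by
    have : (l : ℝ) ≤ L := by exact_mod_cast hl
    linarith
  -- the terms of higher order
  have h1 : Filter.Tendsto (fun N => ∑ j ∈ Ico (l + 1) (L + 1), e j * q N ^ (j - l)) Filter.atTop
      (nhds 0) := by
    rw [← sum_const_zero (s := Ico (l + 1) (L + 1))]
    refine tendsto_finsetSum _ fun j hj => ?_
    have hj' : j - l ≠ 0 := by have := (mem_Ico.1 hj).1; omega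
    have := (hq.pow (j - l)).const_mul (e j)
    rwa [zero_pow hj', mul_zero] at this
  have h2 : Filter.Tendsto (fun N => K * q N ^ (b - l)) Filter.atTop (nhds 0) := by
    have := (hq.rpow_const (Or.inr hlb.le)).const_mul K
    rwa [Real.zero_rpow hlb.ne', mul_zero] at this
  have h3 : Filter.Tendsto (fun N => (G N - ∑ j ∈ range (L + 1), e j * q N ^ j) / q N ^ l)
      Filter.atTop (nhds 0) := by
    refine squeeze_zero_norm' (h.mono fun N hN => ?_) h2
    have hp := pow_pos (hq0 N) l
    rw [norm_div, Real.norm_eq_abs, Real.norm_eq_abs, abs_of_pos hp, div_le_iff₀ hp, mul_assoc,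
      ← Real.rpow_natCast, ← Real.rpow_add (hq0 N), sub_add_cancel]
    exact hN
  have h4 := (tendsto_const_nhds (x := e l)).add (h1.add h3)
  rw [add_zero, add_zero] at h4
  refine h4.congr fun N => ?_
  have hp := (pow_pos (hq0 N) l).ne'
  rw [← sum_range_add_sum_Ico _ (Nat.succ_le_succ hl), sum_range_succ]
  have h5 : ∑ j ∈ Ico (l + 1) (L + 1), e j * q N ^ (j - l) =
      (∑ j ∈ Ico (l + 1) (L + 1), e j * q N ^ j) / q N ^ l := by
    rw [sum_div]
    refine sum_congr rfl fun j hj => ?_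
    rw [eq_div_iff hp, mul_assoc, ← pow_add, Nat.sub_add_cancel (by
      have := (mem_Ico.1 hj).1; omega)]
  rw [h5]
  simp only [Nat.succ_eq_add_one]
  field_simp
  ring

variable {d : ℕ}

local notation "E" => EuclideanSpace ℝ (Fin d)

/-- `log (V_d f(x) r^d / h_x(r))`, the logarithm of the ratio between the mass of a ball for the
constant density `f(x)` and its actual mass. -/
noncomputable def logRatio (f : E → ℝ) (x : E) (r : ℝ) : ℝ :=
  Real.log (unitBallVolume d * f x * r ^ d / ballMass (densityLaw f) x r)

/-- The coefficient of `h_x(r) ^ (2 l / d)` in the asymptotic expansion of `logRatio f x r` as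
`r → 0`. It is defined as a limit along `r = 1 / (N + 1)`, so that it is measurable in `x` and
depends on nothing but `f`, `x` and `l`. For a density of the class the limit exists at the points
with `f x > 0`, for all `l` up to the order of the expansion; elsewhere the value is arbitrary. -/
noncomputable def expansionCoef (f : E → ℝ) (l : ℕ) (x : E) : ℝ :=
  Filter.limUnder Filter.atTop fun N : ℕ =>
    (logRatio f x (1 / ((N : ℝ) + 1)) - ∑ j : Fin l, expansionCoef f j x *
      (ballMass (densityLaw f) x (1 / ((N : ℝ) + 1)) ^ (2 / (d : ℝ))) ^ (j : ℕ)) /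
    (ballMass (densityLaw f) x (1 / ((N : ℝ) + 1)) ^ (2 / (d : ℝ))) ^ l
termination_by l

theorem measurable_expansionCoef {f : E → ℝ} (hf : IsDensity f) (l : ℕ) :
    Measurable (expansionCoef f l) := by
  have := hf.isProbabilityMeasure
  induction l using Nat.strong_induction_on with
  | _ l ih =>
    have hm : ∀ r, Measurable fun x => ballMass (densityLaw f) x r := measurable_ballMass_left
    have e : expansionCoef f l = fun x => Filter.limUnder Filter.atTop fun N : ℕ =>
        (logRatio f x (1 / ((N : ℝ) + 1)) - ∑ j : Fin l, expansionCoef f j x *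
          (ballMass (densityLaw f) x (1 / ((N : ℝ) + 1)) ^ (2 / (d : ℝ))) ^ (j : ℕ)) /
        (ballMass (densityLaw f) x (1 / ((N : ℝ) + 1)) ^ (2 / (d : ℝ))) ^ l := by
      funext x; rw [expansionCoef]
    rw [e]
    refine (StronglyMeasurable.limUnder fun N => Measurable.stronglyMeasurable ?_).measurable
    have h1 := hm (1 / ((N : ℝ) + 1))
    refine Measurable.div (Measurable.sub ?_ ?_) ((h1.pow_const _).pow_const _)
    · exact (((measurable_const.mul hf.1).mul_const _).div h1).log
    · exact Finset.measurable_sum _ fun j _ =>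
        (ih j j.2).mul ((h1.pow_const _).pow_const _)

/-- An asymptotic expansion of `logRatio` determines `expansionCoef`. -/
theorem expansionCoef_eq {f : E → ℝ} {x : E} {e : ℕ → ℝ} {K b : ℝ} {L : ℕ} (hb : (L : ℝ) < b)
    (hq0 : ∀ N : ℕ, 0 < ballMass (densityLaw f) x (1 / ((N : ℝ) + 1)) ^ (2 / (d : ℝ)))
    (hq : Filter.Tendsto
      (fun N : ℕ => ballMass (densityLaw f) x (1 / ((N : ℝ) + 1)) ^ (2 / (d : ℝ)))
      Filter.atTop (nhds 0))
    (h : ∀ᶠ N : ℕ in Filter.atTop, |logRatio f x (1 / ((N : ℝ) + 1)) - ∑ l ∈ range (L + 1),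
      e l * (ballMass (densityLaw f) x (1 / ((N : ℝ) + 1)) ^ (2 / (d : ℝ))) ^ l| ≤
      K * (ballMass (densityLaw f) x (1 / ((N : ℝ) + 1)) ^ (2 / (d : ℝ))) ^ b)
    {l : ℕ} (hl : l ≤ L) : expansionCoef f l x = e l := by
  induction l using Nat.strong_induction_on with
  | _ l ih =>
    rw [expansionCoef]
    refine Filter.Tendsto.limUnder_eq ?_
    have h1 := tendsto_expansion_coef hb hq0 hq h hl
    refine h1.congr fun N => ?_
    congr 2
    rw [← Fin.sum_univ_eq_sum_range (fun j => e j *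
      (ballMass (densityLaw f) x (1 / ((N : ℝ) + 1)) ^ (2 / (d : ℝ))) ^ j)]
    exact sum_congr rfl fun j _ => by rw [ih j j.2 (j.2.le.trans hl)]

section DensityClass

/-- With `m = ⌈β⌉ - 1`, the last even order `2 l ≤ m` of Taylor's formula is `l = ⌈β / 2⌉ - 1`. -/
theorem order_bounds (θ : Theta) : ((smoothnessOrder θ.β / 2 : ℕ) : ℝ) < θ.β / 2 ∧
    θ.β / 2 ≤ ((smoothnessOrder θ.β / 2 : ℕ) : ℝ) + 1 ∧
    ⌈θ.β / 2⌉₊ - 1 = smoothnessOrder θ.β / 2 := by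
  have h1 := smoothnessOrder_lt θ
  have h2 : θ.β ≤ smoothnessOrder θ.β + 1 := by
    refine (Nat.le_ceil θ.β).trans ?_
    rw [smoothnessOrder]
    exact_mod_cast (by omega : ⌈θ.β⌉₊ ≤ ⌈θ.β⌉₊ - 1 + 1)
  set m := smoothnessOrder θ.β
  have h3 : ((m / 2 : ℕ) : ℝ) * 2 ≤ m := by exact_mod_cast Nat.div_mul_le_self m 2
  have h4 : (m : ℝ) ≤ ((m / 2 : ℕ) : ℝ) * 2 + 1 := by
    exact_mod_cast (by omega : m ≤ m / 2 * 2 + 1)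
  refine ⟨by linarith, by linarith, ?_⟩
  have : ⌈θ.β / 2⌉₊ = m / 2 + 1 := by
    rw [Nat.ceil_eq_iff (by simp)]
    simp only [Nat.add_sub_cancel]
    push_cast
    exact ⟨by linarith, by linarith⟩
  omega

/-- The small constant in the definition of `goodRadius`. The factor `8 √d` keeps `goodRadius` below
`radius`, the last factor keeps the sum of the terms of the expansion of the mass below `1 / 4`. -/
noncomputable def goodConst (d : ℕ) (θ : Theta) : ℝ :=
  1 / (8 * Real.sqrt d * ((smoothnessOrder θ.β / 2 : ℕ) + 1))

/-- A radius, depending on `x` through `δ = f(x)` only, up to which the mass of balls about `x` is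
comparable to that for the constant density `f(x)`. -/
noncomputable def goodRadius (d : ℕ) (θ : Theta) (δ : ℝ) : ℝ :=
  (goodConst d θ / θ.a δ) ^ (1 / min θ.β 1)

/-- The mass that the constant density `δ` gives to a ball of radius `goodRadius d θ δ`. -/
noncomputable def goodMass (d : ℕ) (θ : Theta) (δ : ℝ) : ℝ :=
  unitBallVolume d * δ * goodRadius d θ δ ^ d

variable {θ : Theta} {f : EuclideanSpace ℝ (Fin d) → ℝ} {x : EuclideanSpace ℝ (Fin d)}

theorem goodConst_pos (hd : 1 ≤ d) (θ : Theta) : 0 < goodConst d θ := by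
  have : 0 < Real.sqrt d := Real.sqrt_pos.2 (by exact_mod_cast hd)
  rw [goodConst]; positivity

theorem one_le_sqrt (hd : 1 ≤ d) : 1 ≤ Real.sqrt d := by
  rw [Real.one_le_sqrt]; exact_mod_cast hd

theorem goodConst_le (hd : 1 ≤ d) (θ : Theta) :
    goodConst d θ ≤ 1 / (8 * Real.sqrt d) ∧
    goodConst d θ * ((smoothnessOrder θ.β / 2 : ℕ) + 1) ≤ 1 / 4 ∧ goodConst d θ ≤ 1 := by
  have h1 := one_le_sqrt hd
  have hL : (0 : ℝ) ≤ (smoothnessOrder θ.β / 2 : ℕ) := Nat.cast_nonneg _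
  have h2 : goodConst d θ ≤ 1 / (8 * Real.sqrt d) := by
    rw [goodConst]
    exact one_div_le_one_div_of_le (by positivity) (le_mul_of_one_le_right (by positivity)
      (by linarith))
  refine ⟨h2, ?_, ?_⟩
  · rw [goodConst, div_mul_eq_mul_div, one_mul, div_le_iff₀ (by positivity)]
    nlinarith
  · refine h2.trans ?_
    rw [div_le_one (by positivity)]
    linarith

theorem min_pos (θ : Theta) : 0 < min θ.β 1 := lt_min θ.β_pos one_pos

theorem goodRadius_pos (hd : 1 ≤ d) {δ : ℝ} (hδ : 0 < δ) : 0 < goodRadius d θ δ :=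
  Real.rpow_pos_of_pos (div_pos (goodConst_pos hd θ) (zero_lt_one.trans_le (one_le_a θ hδ))) _

theorem goodMass_pos (hd : 1 ≤ d) {δ : ℝ} (hδ : 0 < δ) : 0 < goodMass d θ δ :=
  mul_pos (mul_pos (unitBallVolume_pos d) hδ) (pow_pos (goodRadius_pos hd hδ) d)

theorem goodRadius_le_one (hd : 1 ≤ d) {δ : ℝ} (hδ : 0 < δ) : goodRadius d θ δ ≤ 1 := by
  have ha := one_le_a θ hδ
  refine Real.rpow_le_one (div_nonneg (goodConst_pos hd θ).le (by linarith)) ?_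
    (one_div_pos.2 (min_pos θ)).le
  rw [div_le_one (by linarith)]
  exact (goodConst_le hd θ).2.2.trans ha

theorem goodRadius_le_radius (hd : 1 ≤ d) (hx : 0 < f x) :
    goodRadius d θ (f x) ≤ radius f θ.a θ.β x := by
  have ha := one_le_a θ hx
  have h1 := one_le_sqrt hd
  rw [radius, Real.rpow_neg (by positivity), ← Real.inv_rpow (by positivity)]
  refine Real.rpow_le_rpow (div_nonneg (goodConst_pos hd θ).le (by linarith)) ?_
    (one_div_pos.2 (min_pos θ)).le
  rw [mul_inv, ← one_div, div_eq_mul_inv]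
  exact mul_le_mul_of_nonneg_right (goodConst_le hd θ).1 (by positivity)

/-- The terms of the expansion of the mass are small up to `goodRadius`. -/
theorem a_mul_goodRadius_rpow_le (hd : 1 ≤ d) {δ : ℝ} (hδ : 0 < δ) {p : ℝ} (hp : min θ.β 1 ≤ p) :
    θ.a δ * goodRadius d θ δ ^ p ≤ goodConst d θ := by
  have ha := zero_lt_one.trans_le (one_le_a θ hδ)
  have h1 : goodRadius d θ δ ^ p ≤ goodRadius d θ δ ^ min θ.β 1 :=
    Real.rpow_le_rpow_of_exponent_ge (goodRadius_pos hd hδ) (goodRadius_le_one hd hδ) hp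
  have h2 : goodRadius d θ δ ^ min θ.β 1 = goodConst d θ / θ.a δ := by
    rw [goodRadius, ← Real.rpow_mul (div_nonneg (goodConst_pos hd θ).le ha.le),
      one_div_mul_cancel (min_pos θ).ne', Real.rpow_one]
  rw [h2] at h1
  calc _ ≤ θ.a δ * (goodConst d θ / θ.a δ) := mul_le_mul_of_nonneg_left h1 ha.le
    _ = _ := by field_simp

/-- Up to `goodRadius`, `logRatio` has an expansion in powers of the mass of the ball, uniformly
over the class. -/
theorem exists_expansion (hd : 1 ≤ d) (θ : Theta) : ∃ K : ℝ, 0 ≤ K ∧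
    ∀ f ∈ densityClass d θ, ∀ x, 0 < f x →
      ∃ e : ℕ → ℝ, (∀ l, |e l| ≤ K * ((goodMass d θ (f x) ^ (2 / (d : ℝ)))⁻¹) ^ l) ∧
      ∀ r, 0 < r → r ≤ goodRadius d θ (f x) →
        3 / 4 * goodMass d θ (f x) * (r / goodRadius d θ (f x)) ^ d ≤
          ballMass (densityLaw f) x r ∧
        ballMass (densityLaw f) x r ≤
          5 / 4 * goodMass d θ (f x) * (r / goodRadius d θ (f x)) ^ d ∧
        |logRatio f x r - ∑ l ∈ Icc 1 (smoothnessOrder θ.β / 2),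
            e l * (ballMass (densityLaw f) x r ^ (2 / (d : ℝ))) ^ l| ≤
          K * (ballMass (densityLaw f) x r / goodMass d θ (f x)) ^ (θ.β / d) := by
  obtain ⟨hL1, hL2, -⟩ := order_bounds θ
  set L := smoothnessOrder θ.β / 2
  have hd0 : (0 : ℝ) < d := by exact_mod_cast hd
  have hδ0 : (0 : ℝ) ≤ 2 / (d : ℝ) := by positivity
  have hδ : 2 / (d : ℝ) ≤ 2 := div_le_self (by norm_num) (by exact_mod_cast hd)
  obtain ⟨K, hK, hexp⟩ := exists_log_expansion (b := θ.β / 2) (by linarith [θ.β_pos]) hL2 hδ0 hδ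
  have hKle : K ≤ K * (4 / 3) ^ (θ.β / d) := le_mul_of_one_le_right hK
    (Real.one_le_rpow (by norm_num) (div_nonneg θ.β_pos.le hd0.le))
  refine ⟨K * (4 / 3) ^ (θ.β / d), by positivity, fun f hf x hx => ?_⟩
  set ρ := goodRadius d θ (f x) with hρ
  set v := goodMass d θ (f x) with hv
  have hρ0 : 0 < ρ := goodRadius_pos hd hx
  have hv0 : 0 < v := goodMass_pos hd hx
  have hρ1 : ρ ≤ 1 := goodRadius_le_one hd hx
  have hV := unitBallVolume_pos d
  have ha := zero_lt_one.trans_le (one_le_a θ hx)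
  obtain ⟨-, hκ2, hκ3⟩ := goodConst_le hd θ
  have hκ0 := goodConst_pos hd θ
  -- `y` is the relative deviation of the mass from its leading term, and `c` its coefficients, in
  -- terms of the dimensionless variable `t = (r / ρ)²`
  set y : ℝ → ℝ := fun t => ballMass (densityLaw f) x (ρ * Real.sqrt t) /
    (unitBallVolume d * f x * (ρ * Real.sqrt t) ^ d) - 1 with hy
  set c : ℕ → ℝ := fun l => if l ∈ Icc 1 L then massCoef f x l * (ρ ^ 2) ^ l else 0 with hc
  have hcκ : ∀ l, |c l| ≤ goodConst d θ := by
    intro l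
    simp only [hc]
    split_ifs with hl
    · rw [abs_mul, abs_of_pos (a := (ρ ^ 2) ^ l) (by positivity), ← pow_mul, ← Real.rpow_natCast]
      refine le_trans (mul_le_mul_of_nonneg_right (abs_massCoef_le hd hf hx hl) (by positivity)) ?_
      refine a_mul_goodRadius_rpow_le hd hx ((min_le_right _ _).trans ?_)
      have := (mem_Icc.1 hl).1
      exact_mod_cast (by omega : 1 ≤ 2 * l)
    · simpa using hκ0.le
  have hyc : ∀ t ∈ Set.Ioc (0 : ℝ) 1,
      |y t - ∑ l ∈ Icc 1 L, c l * t ^ l| ≤ goodConst d θ * t ^ (θ.β / 2) := by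
    intro t ht
    have hs0 : 0 < Real.sqrt t := Real.sqrt_pos.2 ht.1
    have hs1 : Real.sqrt t ≤ 1 := Real.sqrt_le_one.2 ht.2
    have h := abs_ballMass_sub_le hd hf hx (mul_pos hρ0 hs0)
      ((mul_le_of_le_one_right hρ0.le hs1).trans (goodRadius_le_radius hd hx))
    have e1 : ∑ l ∈ Icc 1 L, c l * t ^ l =
        ∑ l ∈ Icc 1 L, massCoef f x l * ((ρ * Real.sqrt t) ^ 2) ^ l := by
      refine sum_congr rfl fun l hl => ?_
      simp only [hc]
      rw [if_pos hl, mul_pow ρ, Real.sq_sqrt ht.1.le, mul_pow, mul_assoc]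
    rw [e1, hy]
    simp only
    rw [sub_sub]
    refine h.trans ?_
    rw [Real.mul_rpow hρ0.le hs0.le, ← mul_assoc, Real.sqrt_eq_rpow, ← Real.rpow_mul ht.1.le]
    refine le_trans (mul_le_mul_of_nonneg_right
      (a_mul_goodRadius_rpow_le hd hx (min_le_left _ _)) (Real.rpow_nonneg ht.1.le _)) (le_of_eq ?_)
    congr 2
    ring
  have hy4 : ∀ t ∈ Set.Ioc (0 : ℝ) 1, |y t| ≤ 1 / 4 := by
    intro t ht
    have h1 : |∑ l ∈ Icc 1 L, c l * t ^ l| ≤ ∑ l ∈ Icc 1 L, goodConst d θ := by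
      refine (abs_sum_le_sum_abs _ _).trans (sum_le_sum fun l _ => ?_)
      rw [abs_mul, abs_of_pos (pow_pos ht.1 l)]
      exact (mul_le_of_le_one_right (abs_nonneg _) (pow_le_one₀ ht.1.le ht.2)).trans (hcκ l)
    have h2 : goodConst d θ * t ^ (θ.β / 2) ≤ goodConst d θ :=
      mul_le_of_le_one_right hκ0.le (Real.rpow_le_one ht.1.le ht.2 (by linarith [θ.β_pos]))
    rw [sum_const, Nat.card_Icc, Nat.add_sub_cancel, nsmul_eq_mul] at h1
    have h3 := hyc t ht
    calc |y t| = |(y t - ∑ l ∈ Icc 1 L, c l * t ^ l) + ∑ l ∈ Icc 1 L, c l * t ^ l| := by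
          rw [sub_add_cancel]
      _ ≤ goodConst d θ + L * goodConst d θ := (abs_add_le _ _).trans (by linarith)
      _ = goodConst d θ * (L + 1) := by ring
      _ ≤ 1 / 4 := hκ2
  obtain ⟨e, he, hexp⟩ := hexp c y (fun l => (hcκ l).trans hκ3) hy4 fun t ht =>
    (hyc t ht).trans (mul_le_of_le_one_left (Real.rpow_nonneg ht.1.le _) hκ3)
  refine ⟨fun l => e l * ((v ^ (2 / (d : ℝ)))⁻¹) ^ l, fun l => ?_, fun r hr hrρ => ?_⟩
  · rw [abs_mul, abs_of_pos (a := _ ^ l) (by positivity)]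
    exact mul_le_mul_of_nonneg_right ((he l).trans hKle) (by positivity)
  · have hrr0 : 0 < r / ρ := div_pos hr hρ0
    have hrr1 : r / ρ ≤ 1 := (div_le_one hρ0).2 hrρ
    have ht : (r / ρ) ^ 2 ∈ Set.Ioc (0 : ℝ) 1 := ⟨by positivity, pow_le_one₀ hrr0.le hrr1⟩
    have hsq : ρ * Real.sqrt ((r / ρ) ^ 2) = r := by
      rw [Real.sqrt_sq hrr0.le]; field_simp
    have hvr : unitBallVolume d * f x * r ^ d = v * (r / ρ) ^ d := by
      rw [hv, goodMass, ← hρ, div_pow]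
      have : ρ ^ d ≠ 0 := by positivity
      field_simp
    have hyr : y ((r / ρ) ^ 2) = ballMass (densityLaw f) x r / (v * (r / ρ) ^ d) - 1 := by
      simp only [hy]; rw [hsq, hvr]
    have hvr0 : 0 < v * (r / ρ) ^ d := by positivity
    have hmass : ballMass (densityLaw f) x r = v * (r / ρ) ^ d * (1 + y ((r / ρ) ^ 2)) := by
      rw [hyr]; field_simp; ring
    have hyb := abs_le.1 (hy4 _ ht)
    have h1y : 0 < 1 + y ((r / ρ) ^ 2) := by linarith
    have hlow : 3 / 4 * v * (r / ρ) ^ d ≤ ballMass (densityLaw f) x r := by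
      rw [hmass]; nlinarith
    refine ⟨hlow, by rw [hmass]; nlinarith, ?_⟩
    have hm0 : 0 < ballMass (densityLaw f) x r := lt_of_lt_of_le (by positivity) hlow
    have hlog : logRatio f x r = -Real.log (1 + y ((r / ρ) ^ 2)) := by
      rw [logRatio, hvr, ← Real.log_inv, hmass]
      congr 1
      field_simp
    have hdpow : ((r / ρ) ^ d) ^ (2 / (d : ℝ)) = (r / ρ) ^ 2 := by
      rw [← Real.rpow_natCast, ← Real.rpow_mul hrr0.le, mul_div_cancel₀ _ hd0.ne',
        Real.rpow_ofNat]
    have hw : ∀ l, e l * ((v ^ (2 / (d : ℝ)))⁻¹) ^ l *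
        (ballMass (densityLaw f) x r ^ (2 / (d : ℝ))) ^ l =
        e l * ((r / ρ) ^ 2 * (1 + y ((r / ρ) ^ 2)) ^ (2 / (d : ℝ))) ^ l := by
      intro l
      have : 0 < v ^ (2 / (d : ℝ)) := by positivity
      rw [mul_assoc, ← mul_pow]
      congr 2
      conv_lhs => rw [hmass]
      rw [Real.mul_rpow hvr0.le h1y.le, Real.mul_rpow hv0.le (by positivity), hdpow]
      field_simp
    simp_rw [hw]
    rw [hlog]
    refine (hexp _ ht).trans ?_
    rw [mul_assoc]
    refine mul_le_mul_of_nonneg_left ?_ hK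
    rw [← Real.mul_rpow (by norm_num) (by positivity)]
    have e2 : ((r / ρ) ^ 2) ^ (θ.β / 2) = ((r / ρ) ^ d) ^ (θ.β / d) := by
      rw [← Real.rpow_natCast, ← Real.rpow_natCast, ← Real.rpow_mul hrr0.le,
        ← Real.rpow_mul hrr0.le]
      congr 1
      push_cast
      field_simp
    rw [e2]
    refine Real.rpow_le_rpow (by positivity) ?_ (div_nonneg θ.β_pos.le hd0.le)
    rw [mul_div_assoc', le_div_iff₀ hv0]
    linarith

theorem tendsto_ballMass_zero (hd : 1 ≤ d) (hf : IsDensity f) (x : EuclideanSpace ℝ (Fin d)) :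
    Filter.Tendsto (ballMass (densityLaw f) x) (nhds 0) (nhds 0) := by
  have := hf.isProbabilityMeasure
  have h := (continuous_ballMass (P := densityLaw f) (x := x) (densityLaw_sphere hd f x)).tendsto 0
  have h0 : ballMass (densityLaw f) x 0 = 0 := by
    have := densityLaw_sphere hd f x 0
    rw [Metric.sphere_zero] at this
    rw [ballMass, Metric.closedBall_zero, Measure.real, this, ENNReal.toReal_zero]
  rwa [h0] at h

/-- The expansion of `exists_expansion`, with its coefficients identified. -/
theorem exists_expansionCoef_bound (hd : 1 ≤ d) (θ : Theta) : ∃ K : ℝ, 0 ≤ K ∧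
    ∀ f ∈ densityClass d θ, ∀ x, 0 < f x →
      (∀ l ∈ Icc 1 (smoothnessOrder θ.β / 2),
        |expansionCoef f l x| ≤ K * ((goodMass d θ (f x) ^ (2 / (d : ℝ)))⁻¹) ^ l) ∧
      ∀ r, 0 < r → r ≤ goodRadius d θ (f x) →
        3 / 4 * goodMass d θ (f x) * (r / goodRadius d θ (f x)) ^ d ≤
          ballMass (densityLaw f) x r ∧
        ballMass (densityLaw f) x r ≤
          5 / 4 * goodMass d θ (f x) * (r / goodRadius d θ (f x)) ^ d ∧
        |logRatio f x r - ∑ l ∈ Icc 1 (smoothnessOrder θ.β / 2),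
            expansionCoef f l x * (ballMass (densityLaw f) x r ^ (2 / (d : ℝ))) ^ l| ≤
          K * (ballMass (densityLaw f) x r / goodMass d θ (f x)) ^ (θ.β / d) := by
  obtain ⟨hL1, hL2, -⟩ := order_bounds θ
  obtain ⟨K, hK, h⟩ := exists_expansion hd θ
  refine ⟨K, hK, fun f hf x hx => ?_⟩
  obtain ⟨e, he, h⟩ := h f hf x hx
  have := hf.1.isProbabilityMeasure
  have hd0 : (0 : ℝ) < d := by exact_mod_cast hd
  have hρ0 : 0 < goodRadius d θ (f x) := goodRadius_pos hd hx
  have hv0 : 0 < goodMass d θ (f x) := goodMass_pos hd hx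
  have hpos : ∀ r, 0 < r → 0 < ballMass (densityLaw f) x r := by
    intro r hr
    have h1 := (h (min r (goodRadius d θ (f x))) (lt_min hr hρ0) (min_le_right _ _)).1
    refine lt_of_lt_of_le ?_ (h1.trans (ballMass_mono (min_le_left _ _)))
    have := lt_min hr hρ0
    positivity
  have htend : Filter.Tendsto (fun N : ℕ => 1 / ((N : ℝ) + 1)) Filter.atTop (nhds 0) :=
    tendsto_one_div_add_atTop_nhds_zero_nat
  have hcoef : ∀ l ∈ Icc 1 (smoothnessOrder θ.β / 2), expansionCoef f l x = e l := by
    intro l hl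
    have key := expansionCoef_eq (f := f) (x := x) (L := smoothnessOrder θ.β / 2)
      (e := fun l => if l = 0 then 0 else e l)
      (K := K * ((goodMass d θ (f x)) ^ (θ.β / d))⁻¹) hL1
      (fun N => Real.rpow_pos_of_pos (hpos _ (by positivity)) _) ?_ ?_ (mem_Icc.1 hl).2
    · rw [key, if_neg (by have := (mem_Icc.1 hl).1; omega)]
    · have := ((tendsto_ballMass_zero hd hf.1 x).comp htend).rpow_const (p := 2 / (d : ℝ))
        (Or.inr (by positivity))
      rwa [Real.zero_rpow (by positivity)] at this
    · filter_upwards [htend.eventually (gt_mem_nhds hρ0)] with N hN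
      have hN0 : (0 : ℝ) < 1 / ((N : ℝ) + 1) := by positivity
      have h1 := (h _ hN0 hN.le).2.2
      have hm := hpos _ hN0
      rw [Real.div_rpow hm.le hv0.le, div_eq_mul_inv (_ ^ (θ.β / (d : ℝ))),
        mul_comm (_ ^ (θ.β / (d : ℝ))), ← mul_assoc] at h1
      rw [← Real.rpow_mul hm.le, show 2 / (d : ℝ) * (θ.β / 2) = θ.β / d by ring]
      refine le_trans (le_of_eq ?_) h1
      congr 2
      rw [range_eq_Ico, sum_eq_sum_Ico_succ_bot (Nat.succ_pos _)]
      simp only [if_true, zero_mul, zero_add]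
      refine sum_congr ?_ fun j hj => ?_
      · ext; simp
      · rw [if_neg (by have := (mem_Ico.1 hj).1; omega)]
  refine ⟨fun l hl => by rw [hcoef l hl]; exact he l, fun r hr hrρ => ?_⟩
  obtain ⟨h1, h2, h3⟩ := h r hr hrρ
  refine ⟨h1, h2, ?_⟩
  rwa [sum_congr rfl fun l hl => by rw [hcoef l hl]]

end DensityClass

end

/-! ### The first coefficient -/

section

variable {d : ℕ}

local notation "E" => EuclideanSpace ℝ (Fin d)

section SecondMoments

theorem integrableOn_coord_mul (i j : Fin d) :
    IntegrableOn (fun u : E => u i * u j) (Metric.closedBall 0 1) := by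
  have : Continuous fun u : E => u i * u j := by fun_prop
  exact this.continuousOn.integrableOn_compact (isCompact_closedBall _ _)

/-- The unit ball is invariant under isometries. -/
theorem setIntegral_closedBall_comp (Φ : E ≃ₗᵢ[ℝ] E) (g : E → ℝ) :
    ∫ u in Metric.closedBall (0 : E) 1, g (Φ u) = ∫ u in Metric.closedBall (0 : E) 1, g u := by
  have h := Φ.measurePreserving.setIntegral_preimage_emb
    Φ.toHomeomorph.measurableEmbedding g (Metric.closedBall 0 1)
  have e : Φ ⁻¹' Metric.closedBall (0 : E) 1 = Metric.closedBall 0 1 := by ext u; simp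
  rwa [e] at h

theorem integral_coord_mul_of_ne {i j : Fin d} (hij : i ≠ j) :
    ∫ u in Metric.closedBall (0 : E) 1, u i * u j = 0 := by
  -- reflection in the `i`-th coordinate
  let Φ : E ≃ₗᵢ[ℝ] E := LinearIsometryEquiv.piLpCongrRight 2 fun l =>
    if l = i then LinearIsometryEquiv.neg ℝ else LinearIsometryEquiv.refl ℝ ℝ
  have h := setIntegral_closedBall_comp Φ fun u => u i * u j
  have e : ∀ u : E, Φ u i * Φ u j = -(u i * u j) := by
    intro u
    have h1 : Φ u i = -u i := by simp [Φ]
    have h2 : Φ u j = u j := by simp [Φ, hij.symm]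
    rw [h1, h2]; ring
  simp_rw [e, integral_neg] at h
  linarith

theorem integral_coord_sq_eq (i j : Fin d) :
    ∫ u in Metric.closedBall (0 : E) 1, u i * u i =
      ∫ u in Metric.closedBall (0 : E) 1, u j * u j := by
  -- exchange of two coordinates
  let Φ : E ≃ₗᵢ[ℝ] E := LinearIsometryEquiv.piLpCongrLeft 2 ℝ ℝ (Equiv.swap i j)
  have h := setIntegral_closedBall_comp Φ fun u => u i * u i
  rw [← h]
  refine integral_congr_ae (.of_forall fun u => ?_)
  have : Φ u i = u j := by simp [Φ, LinearIsometryEquiv.piLpCongrLeft_apply,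
    Equiv.piCongrLeft'_apply]
  simp only [this]

theorem integral_norm_sq (hd : 1 ≤ d) :
    ∫ u in Metric.closedBall (0 : E) 1, ‖u‖ ^ 2 = d * unitBallVolume d / (d + 2) := by
  have : Nonempty (Fin d) := ⟨⟨0, hd⟩⟩
  have h := integral_fun_norm_addHaar (volume : Measure E)
    ((Set.Iic (1 : ℝ)).indicator fun y => y ^ 2)
  have e : (fun u : E => (Set.Iic (1 : ℝ)).indicator (fun y => y ^ 2) ‖u‖) =
      (Metric.closedBall (0 : E) 1).indicator fun u => ‖u‖ ^ 2 := by
    funext u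
    by_cases hu : ‖u‖ ≤ 1
    · rw [Set.indicator_of_mem (by exact hu), Set.indicator_of_mem (by simpa using hu)]
    · rw [Set.indicator_of_notMem (by exact hu), Set.indicator_of_notMem (by simpa using hu)]
  rw [e, integral_indicator measurableSet_closedBall] at h
  have hb : volume.real (Metric.ball (0 : E) 1) = unitBallVolume d := by
    rw [← volume_real_closedBall_one hd, Measure.real, Measure.real,
      Measure.addHaar_closedBall_eq_addHaar_ball]
  have e2 : ∀ y : ℝ, y ^ (d - 1) • (Set.Iic (1 : ℝ)).indicator (fun y => y ^ 2) y =
      (Set.Iic (1 : ℝ)).indicator (fun y => y ^ (d + 1)) y := by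
    intro y
    by_cases hy : y ∈ Set.Iic (1 : ℝ)
    · rw [Set.indicator_of_mem hy, Set.indicator_of_mem hy, smul_eq_mul, ← pow_add]
      congr 1; omega
    · rw [Set.indicator_of_notMem hy, Set.indicator_of_notMem hy, smul_zero]
  have e3 : ∫ y in Set.Ioi (0 : ℝ), (Set.Iic (1 : ℝ)).indicator (fun y => y ^ (d + 1)) y =
      1 / ((d : ℝ) + 2) := by
    rw [integral_indicator measurableSet_Iic, Measure.restrict_restrict measurableSet_Iic,
      Set.inter_comm, Set.Ioi_inter_Iic, ← intervalIntegral.integral_of_le zero_le_one,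
      integral_pow]
    push_cast
    simp
    ring
  rw [finrank_euclideanSpace_fin] at h
  simp_rw [e2] at h
  rw [h, e3, hb, nsmul_eq_mul, smul_eq_mul]
  ring

theorem integral_coord_mul (hd : 1 ≤ d) (i j : Fin d) :
    ∫ u in Metric.closedBall (0 : E) 1, u i * u j =
      if i = j then unitBallVolume d / (d + 2) else 0 := by
  split_ifs with hij
  · subst hij
    have h := integral_norm_sq hd
    simp_rw [EuclideanSpace.norm_sq_eq, Real.norm_eq_abs, sq_abs, pow_two] at h
    rw [integral_finsetSum _ fun j _ => integrableOn_coord_mul j j,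
      sum_congr rfl fun j _ => integral_coord_sq_eq j i, sum_const, card_univ, Fintype.card_fin,
      nsmul_eq_mul, mul_div_assoc] at h
    exact mul_left_cancel₀ (by positivity) h
  · exact integral_coord_mul_of_ne hij

end SecondMoments

/-- Of the second moments of the ball only the diagonal ones, all equal, contribute. -/
theorem ballIntegral_two (hd : 1 ≤ d) (f : E → ℝ) (x : E) :
    ballIntegral (iteratedFDeriv ℝ 2 f x) =
      unitBallVolume d / (d + 2) * Laplacian.laplacian f x := by
  classical
  set T := iteratedFDeriv ℝ 2 f x
  have e : ∀ u : E, (T fun _ => u) = ∑ j : Fin 2 → Fin d,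
      (T fun i => EuclideanSpace.single (j i) (1 : ℝ)) * (u (j 0) * u (j 1)) := by
    intro u
    have hu : u = ∑ i, u i • EuclideanSpace.single i (1 : ℝ) := by
      ext j
      simp [Pi.single_apply]
    conv_lhs => rw [hu]
    rw [T.map_sum]
    refine sum_congr rfl fun j _ => ?_
    rw [T.map_smul_univ, smul_eq_mul, mul_comm, Fin.prod_univ_two]
  rw [ballIntegral]
  simp_rw [e]
  rw [integral_finsetSum _ fun j _ => (integrableOn_coord_mul (j 0) (j 1)).const_mul _]
  simp_rw [integral_const_mul, integral_coord_mul hd]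
  rw [InnerProductSpace.laplacian_eq_iteratedFDeriv_orthonormalBasis f
    (EuclideanSpace.basisFun (Fin d) ℝ)]
  simp only [EuclideanSpace.basisFun_apply, mul_ite, mul_zero]
  rw [← sum_filter, mul_sum]
  symm
  refine sum_bij (fun i _ => fun _ => i) (by simp) (fun a _ b _ h => congrFun h 0)
    (fun j hj => ⟨j 0, mem_univ _, ?_⟩) fun i _ => ?_
  · funext l
    have := (mem_filter.1 hj).2
    fin_cases l <;> simp [this]
  · rw [mul_comm]
    congr 2
    funext l
    fin_cases l <;> rfl

theorem massCoef_one (hd : 1 ≤ d) (f : E → ℝ) {x : E} (hx : 0 < f x) :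
    massCoef f x 1 = Laplacian.laplacian f x / (2 * (d + 2) * f x) := by
  have hV := (unitBallVolume_pos d).ne'
  rw [massCoef]
  have := ballIntegral_two hd f x
  simp only [mul_one] at this ⊢
  rw [this]
  norm_num
  field_simp

theorem abs_log_one_add_sub_le {y : ℝ} (hy : |y| ≤ 1 / 2) : |Real.log (1 + y) - y| ≤ 2 * y ^ 2 := by
  have h := Real.abs_log_sub_add_sum_range_le (x := -y) (by rw [abs_neg]; linarith) 1
  simp only [sum_range_one, pow_one, zero_add, abs_neg, Nat.cast_zero, div_one,
    sub_neg_eq_add] at h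
  rw [← sub_eq_neg_add, show 1 + 1 = 2 from rfl, sq_abs] at h
  refine h.trans ?_
  rw [div_le_iff₀ (by linarith)]
  nlinarith [sq_nonneg y]

/-- The first coefficient of the expansion. It is the limit of `logRatio f x r / h_x(r) ^ (2 / d)`,
where the numerator is `-c_1 r ^ 2` and the denominator `(V_d f(x)) ^ (2 / d) r ^ 2` to leading
order. -/
theorem expansionCoef_one (hd : 1 ≤ d) {θ : Theta} (hβ : 2 < θ.β) {f : E → ℝ}
    (hf : f ∈ densityClass d θ) {x : E} (hx : 0 < f x) :
    expansionCoef f 1 x = -(Laplacian.laplacian f x / (2 * (d + 2) * f x)) /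
      (unitBallVolume d * f x) ^ (2 / (d : ℝ)) := by
  obtain ⟨hL1, hL2, -⟩ := order_bounds θ
  obtain ⟨K, hK, h⟩ := exists_expansionCoef_bound hd θ
  obtain ⟨-, h⟩ := h f hf x hx
  have := hf.1.isProbabilityMeasure
  have hd0 : (0 : ℝ) < d := by exact_mod_cast hd
  have hV := unitBallVolume_pos d
  have hL : 1 ≤ smoothnessOrder θ.β / 2 := by
    have h1 : (0 : ℝ) < ((smoothnessOrder θ.β / 2 : ℕ) : ℝ) := by linarith
    exact_mod_cast h1
  set L := smoothnessOrder θ.β / 2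
  have hρ0 : 0 < goodRadius d θ (f x) := goodRadius_pos hd hx
  have hv0 : 0 < goodMass d θ (f x) := goodMass_pos hd hx
  set r : ℕ → ℝ := fun N => goodRadius d θ (f x) * (1 / ((N : ℝ) + 1)) with hr
  have hr0 : ∀ N, 0 < r N := fun N => by positivity
  have hrρ : ∀ N, r N ≤ goodRadius d θ (f x) := fun N => by
    refine mul_le_of_le_one_right hρ0.le ?_
    rw [div_le_one (by positivity)]
    linarith [N.cast_nonneg (α := ℝ)]
  have hrt : Filter.Tendsto r Filter.atTop (nhds 0) := by
    have := (tendsto_one_div_add_atTop_nhds_zero_nat (𝕜 := ℝ)).const_mul (goodRadius d θ (f x))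
    rwa [mul_zero] at this
  have hr2t : Filter.Tendsto (fun N => r N ^ 2) Filter.atTop (nhds 0) := by
    simpa using hrt.pow 2
  have hm0 : ∀ N, 0 < ballMass (densityLaw f) x (r N) := fun N => by
    refine lt_of_lt_of_le ?_ (h _ (hr0 N) (hrρ N)).1
    have := hr0 N
    positivity
  set y : ℕ → ℝ := fun N => ballMass (densityLaw f) x (r N) /
    (unitBallVolume d * f x * r N ^ d) - 1 with hy
  have hmass : ∀ N, ballMass (densityLaw f) x (r N) =
      unitBallVolume d * f x * r N ^ d * (1 + y N) := fun N => by
    have := hr0 N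
    simp only [hy]; field_simp; ring
  have h1y : ∀ N, 0 < 1 + y N := fun N => by
    have h4 := hm0 N
    rw [hmass N] at h4
    have := hr0 N
    exact pos_of_mul_pos_right h4 (by positivity)
  -- the mass of small balls
  have hyt : Filter.Tendsto (fun N => y N / r N ^ 2) Filter.atTop (nhds (massCoef f x 1)) := by
    have key := tendsto_expansion_coef (q := fun N => r N ^ 2) (G := y)
      (e := fun l => if l = 0 then 0 else massCoef f x l) (K := θ.a (f x)) hL1
      (fun N => pow_pos (hr0 N) 2) hr2t (.of_forall fun N => ?_) hL
    · simpa using key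
    · have h1 := abs_ballMass_sub_le hd hf hx (hr0 N)
        ((hrρ N).trans (goodRadius_le_radius hd hx))
      rw [← Real.rpow_natCast, ← Real.rpow_mul (hr0 N).le]
      rw [show ((2 : ℕ) : ℝ) * (θ.β / 2) = θ.β by push_cast; ring]
      refine le_trans (le_of_eq ?_) h1
      rw [← sub_sub]
      congr 2
      rw [range_eq_Ico, sum_eq_sum_Ico_succ_bot (Nat.succ_pos _)]
      simp only [if_true, zero_mul, zero_add]
      refine sum_congr ?_ fun j hj => ?_
      · ext; simp [L]
      · rw [if_neg (by have := (mem_Ico.1 hj).1; omega)]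
        norm_cast
  have hy0 : Filter.Tendsto y Filter.atTop (nhds 0) := by
    have := hyt.mul hr2t
    rw [mul_zero] at this
    refine this.congr fun N => ?_
    have := (hr0 N).ne'
    field_simp
  have hlog : Filter.Tendsto (fun N => logRatio f x (r N) / r N ^ 2) Filter.atTop
      (nhds (-massCoef f x 1)) := by
    have h1 : Filter.Tendsto (fun N => (Real.log (1 + y N) - y N) / r N ^ 2) Filter.atTop
        (nhds 0) := by
      have h2 : Filter.Tendsto (fun N => 2 * (|y N / r N ^ 2| * |y N|)) Filter.atTop (nhds 0) := by
        simpa using (hyt.abs.mul hy0.abs).const_mul 2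
      have hsmall : ∀ᶠ N in Filter.atTop, |y N| < 1 / 2 := by
        have := hy0.abs
        rw [abs_zero] at this
        exact this.eventually (gt_mem_nhds (by norm_num))
      refine squeeze_zero_norm' (hsmall.mono fun N hN => ?_) h2
      have hp := pow_pos (hr0 N) 2
      rw [norm_div, Real.norm_eq_abs, Real.norm_eq_abs, abs_of_pos hp, div_le_iff₀ hp, abs_div,
        abs_of_pos hp]
      refine (abs_log_one_add_sub_le hN.le).trans (le_of_eq ?_)
      have := (hr0 N).ne'
      rw [← sq_abs]
      field_simp
    have h3 := (hyt.add h1).neg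
    rw [add_zero] at h3
    refine h3.congr fun N => ?_
    have hp := (hr0 N).ne'
    have h1y := h1y N
    have e : logRatio f x (r N) = -Real.log (1 + y N) := by
      rw [logRatio, ← Real.log_inv, hmass N]
      have := hr0 N
      congr 1
      field_simp
    rw [e]
    field_simp
    ring
  set q : ℕ → ℝ := fun N => ballMass (densityLaw f) x (r N) ^ (2 / (d : ℝ)) with hqdef
  have hq0 : ∀ N, 0 < q N := fun N => Real.rpow_pos_of_pos (hm0 N) _
  have hqr : Filter.Tendsto (fun N => q N / r N ^ 2) Filter.atTop
      (nhds ((unitBallVolume d * f x) ^ (2 / (d : ℝ)))) := by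
    have h1 : Filter.Tendsto (fun N => (unitBallVolume d * f x * (1 + y N)) ^ (2 / (d : ℝ)))
        Filter.atTop (nhds ((unitBallVolume d * f x) ^ (2 / (d : ℝ)))) := by
      have := ((hy0.const_add 1).const_mul (unitBallVolume d * f x)).rpow_const
        (p := 2 / (d : ℝ)) (Or.inr (by positivity))
      rwa [add_zero, mul_one] at this
    refine h1.congr fun N => ?_
    have h1y := h1y N
    have hrN := hr0 N
    have e : ballMass (densityLaw f) x (r N) = unitBallVolume d * f x * (1 + y N) * r N ^ d := by
      rw [hmass N]; ring
    simp only [hqdef]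
    rw [e, Real.mul_rpow (y := r N ^ d) (by positivity) (by positivity),
      ← Real.rpow_natCast (r N) d, ← Real.rpow_mul hrN.le, mul_div_cancel₀ _ hd0.ne',
      Real.rpow_ofNat]
    field_simp
  have hqt : Filter.Tendsto q Filter.atTop (nhds 0) := by
    have := hqr.mul hr2t
    rw [mul_zero] at this
    refine this.congr fun N => ?_
    have := (hr0 N).ne'
    field_simp
  have hcoef : Filter.Tendsto (fun N => logRatio f x (r N) / q N) Filter.atTop
      (nhds (expansionCoef f 1 x)) := by
    have key := tendsto_expansion_coef (q := q) (G := fun N => logRatio f x (r N))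
      (e := fun l => if l = 0 then 0 else expansionCoef f l x)
      (K := K * ((goodMass d θ (f x)) ^ (θ.β / d))⁻¹) hL1 hq0 hqt (.of_forall fun N => ?_) hL
    · simpa using key
    · have h1 := (h _ (hr0 N) (hrρ N)).2.2
      have hm := hm0 N
      rw [Real.div_rpow hm.le hv0.le, div_eq_mul_inv (_ ^ (θ.β / (d : ℝ))),
        mul_comm (_ ^ (θ.β / (d : ℝ))), ← mul_assoc] at h1
      simp only [hqdef]
      rw [← Real.rpow_mul hm.le, show 2 / (d : ℝ) * (θ.β / 2) = θ.β / d by ring]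
      refine le_trans (le_of_eq ?_) h1
      congr 2
      rw [range_eq_Ico, sum_eq_sum_Ico_succ_bot (Nat.succ_pos _)]
      simp only [if_true, zero_mul, zero_add]
      refine sum_congr ?_ fun j hj => ?_
      · ext; simp [L]
      · rw [if_neg (by have := (mem_Ico.1 hj).1; omega)]
  have hlim := hlog.div hqr (by positivity)
  rw [massCoef_one hd f hx] at hlim
  refine tendsto_nhds_unique hcoef (hlim.congr fun N => ?_)
  have := (hr0 N).ne'
  have := (hq0 N).ne'
  simp only [Pi.div_apply]
  field_simp

end

/-! ### Powers of the density and the truncated expansion -/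

section

section DensityClass

variable {d : ℕ} {θ : Theta} {f : EuclideanSpace ℝ (Fin d) → ℝ} {x : EuclideanSpace ℝ (Fin d)}

/-- The growth condition on `a`, on the whole range of the densities. -/
theorem exists_growth_bound (θ : Theta) {ε : ℝ} (hε : 0 < ε) :
    ∃ C : ℝ, 0 < C ∧ ∀ δ, 0 < δ → δ ≤ θ.γ → θ.a δ ≤ C * δ ^ (-ε) := by
  have h := (θ.a_mem.2.2 ε hε).bound one_pos
  rw [eventually_nhdsWithin_iff, Metric.eventually_nhds_iff] at h
  obtain ⟨δ₀, hδ₀, h⟩ := h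
  have hδ₁ : 0 < δ₀ / 2 := by positivity
  have ha := one_le_a θ hδ₁
  have hγ := θ.γ_pos
  refine ⟨1 + θ.a (δ₀ / 2) * θ.γ ^ ε, by positivity, fun δ hδ hδγ => ?_⟩
  have hp : 0 < δ ^ (-ε) := Real.rpow_pos_of_pos hδ _
  have hγε : 0 < θ.γ ^ ε := Real.rpow_pos_of_pos hγ _
  rw [add_mul, one_mul]
  rcases lt_or_ge δ (δ₀ / 2) with hlt | hge
  · have h1 := h (y := δ) (by rw [Real.dist_eq, sub_zero, abs_of_pos hδ]; linarith) hδ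
    rw [one_mul, Real.norm_of_nonneg hp.le] at h1
    have h2 := (le_abs_self _).trans h1
    have : 0 ≤ θ.a (δ₀ / 2) * θ.γ ^ ε * δ ^ (-ε) := by positivity
    linarith
  · have h1 : θ.a δ ≤ θ.a (δ₀ / 2) := θ.a_mem.1 hδ₁ hδ hge
    have h2 : 1 ≤ θ.γ ^ ε * δ ^ (-ε) := by
      rw [Real.rpow_neg hδ.le, ← div_eq_mul_inv, one_le_div (by positivity)]
      exact Real.rpow_le_rpow hδ.le hδγ hε.le
    have h3 : θ.a (δ₀ / 2) ≤ θ.a (δ₀ / 2) * (θ.γ ^ ε * δ ^ (-ε)) :=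
      le_mul_of_one_le_right (by linarith) h2
    rw [mul_assoc]
    linarith

/-- At small values `δ` of the density, `goodMass` is at least `δ` to any power above `1`, up to a
constant. -/
theorem exists_goodMass_rpow_le (hd : 1 ≤ d) (θ : Theta) {s s' : ℝ} (hs : 0 < s) (hss : s < s') :
    ∃ C : ℝ, 0 < C ∧ ∀ δ, 0 < δ → δ ≤ θ.γ → goodMass d θ δ ^ (-s) ≤ C * δ ^ (-s') := by
  have hb := min_pos θ
  have hd0 : (0 : ℝ) < d := by exact_mod_cast hd
  set b := min θ.β 1
  set ε := (s' - s) * b / (d * s) with hε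
  have hε0 : 0 < ε := div_pos (mul_pos (by linarith) hb) (by positivity)
  obtain ⟨C, hC, h⟩ := exists_growth_bound θ hε0
  have hκ := goodConst_pos hd θ
  have hV := unitBallVolume_pos d
  set c := unitBallVolume d * (goodConst d θ / C) ^ (d / b) with hc
  have hc0 : 0 < c := by positivity
  refine ⟨c ^ (-s), Real.rpow_pos_of_pos hc0 _, fun δ hδ hδγ => ?_⟩
  have ha := zero_lt_one.trans_le (one_le_a θ hδ)
  have h1 : c * δ ^ (s' / s) ≤ goodMass d θ δ := by
    have h2 : goodConst d θ / C * δ ^ ε ≤ goodConst d θ / θ.a δ := by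
      rw [le_div_iff₀ ha, div_mul_eq_mul_div, div_mul_eq_mul_div, div_le_iff₀ hC, mul_assoc]
      refine mul_le_mul_of_nonneg_left ?_ hκ.le
      calc δ ^ ε * θ.a δ ≤ δ ^ ε * (C * δ ^ (-ε)) :=
            mul_le_mul_of_nonneg_left (h δ hδ hδγ) (by positivity)
        _ = C * (δ ^ ε * δ ^ (-ε)) := by ring
        _ = C := by rw [← Real.rpow_add hδ, add_neg_cancel, Real.rpow_zero, mul_one]
    have h3 : goodRadius d θ δ ^ d = (goodConst d θ / θ.a δ) ^ ((d : ℝ) / b) := by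
      rw [goodRadius, ← Real.rpow_mul_natCast (by positivity)]
      congr 1
      field_simp
      exact div_self hb.ne'
    rw [goodMass, h3, hc]
    have h4 : δ ^ (s' / s) = δ * (δ ^ ε) ^ ((d : ℝ) / b) := by
      rw [← Real.rpow_mul hδ.le]
      nth_rewrite 2 [← Real.rpow_one δ]
      rw [← Real.rpow_add hδ]
      congr 1
      rw [hε]
      field_simp
      ring
    have h5 : (goodConst d θ / C * δ ^ ε) ^ ((d : ℝ) / b) ≤
        (goodConst d θ / θ.a δ) ^ ((d : ℝ) / b) :=
      Real.rpow_le_rpow (by positivity) h2 (by positivity)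
    rw [Real.mul_rpow (by positivity) (by positivity)] at h5
    rw [h4]
    calc _ = unitBallVolume d * δ * ((goodConst d θ / C) ^ ((d : ℝ) / b) *
          (δ ^ ε) ^ ((d : ℝ) / b)) := by ring
      _ ≤ _ := mul_le_mul_of_nonneg_left h5 (by positivity)
  refine (Real.rpow_le_rpow_of_nonpos (by positivity) h1 (by linarith)).trans (le_of_eq ?_)
  rw [Real.mul_rpow hc0.le (by positivity), ← Real.rpow_mul hδ.le]
  congr 2
  field_simp

theorem exists_goodMass_le (hd : 1 ≤ d) (θ : Theta) :
    ∃ C : ℝ, 1 ≤ C ∧ unitBallVolume d * θ.γ ≤ C ∧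
      ∀ δ, 0 < δ → δ ≤ θ.γ → goodMass d θ δ ≤ C := by
  refine ⟨max (unitBallVolume d * θ.γ) 1, le_max_right _ _, le_max_left _ _,
    fun δ hδ hδγ => le_trans ?_ (le_max_left _ _)⟩
  have hV := unitBallVolume_pos d
  rw [goodMass]
  refine (mul_le_of_le_one_right (by positivity) (pow_le_one₀ (goodRadius_pos hd hδ).le
    (goodRadius_le_one hd hδ))).trans (mul_le_mul_of_nonneg_left hδγ hV.le)

theorem rpow_one_add_norm_le {α t : ℝ} (hα : 0 ≤ α) (ht : 0 ≤ t) :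
    (1 + t) ^ α ≤ 2 ^ α * (1 + t ^ α) := by
  have h1 : (1 + t) ≤ 2 * max 1 t := by
    rcases le_total 1 t with h | h
    · rw [max_eq_right h]; linarith
    · rw [max_eq_left h]; linarith
  refine (Real.rpow_le_rpow (by positivity) h1 hα).trans ?_
  rw [Real.mul_rpow (by norm_num) (by positivity)]
  refine mul_le_mul_of_nonneg_left ?_ (by positivity)
  rcases le_total 1 t with h | h
  · rw [max_eq_right h]; linarith
  · rw [max_eq_left h, Real.one_rpow]
    linarith [Real.rpow_nonneg ht α]

theorem lintegral_densityLaw (hf : IsDensity f) (g : EuclideanSpace ℝ (Fin d) → ℝ)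
    (hg : Measurable g) :
    ∫⁻ x, ENNReal.ofReal (g x) ∂(densityLaw f) = ∫⁻ x, ENNReal.ofReal (f x * g x) := by
  rw [densityLaw, lintegral_withDensity_eq_lintegral_mul _ hf.1.ennreal_ofReal hg.ennreal_ofReal]
  refine lintegral_congr fun x => ?_
  rw [Pi.mul_apply, ENNReal.ofReal_mul (hf.2.1 x)]

/-- Negative powers of the density are integrable, uniformly over the class, as a consequence of the
moment bound: `f ^ (1 - τ) (1 + ‖x‖) ^ p` is at most `f (1 + ‖x‖) ^ α + (1 + ‖x‖) ^ (-q)` for some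
`q > d`. -/
theorem exists_lintegral_rpow_le (d : ℕ) (θ : Theta) {τ p : ℝ} (hτ : 0 < τ) (hτ1 : τ < 1)
    (h : τ * d + p < θ.α * (1 - τ)) :
    ∃ C : ℝ, 0 ≤ C ∧ ∀ f ∈ densityClass d θ,
      ∫⁻ x, ENNReal.ofReal (f x ^ (-τ) * (1 + ‖x‖) ^ p) ∂(densityLaw f) ≤ ENNReal.ofReal C := by
  set q := (θ.α * (1 - τ) - p) / τ with hq
  have hqd : (d : ℝ) < q := by rw [hq, lt_div_iff₀ hτ]; linarith
  have hint : Integrable (fun x : EuclideanSpace ℝ (Fin d) => (1 + ‖x‖) ^ (-q)) :=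
    integrable_one_add_norm (by rw [finrank_euclideanSpace_fin]; exact hqd)
  have hJ : 0 ≤ ∫ x : EuclideanSpace ℝ (Fin d), (1 + ‖x‖) ^ (-q) :=
    integral_nonneg fun x => by positivity
  have hν := θ.ν_pos
  refine ⟨2 ^ θ.α * (1 + θ.ν) + ∫ x : EuclideanSpace ℝ (Fin d), (1 + ‖x‖) ^ (-q), by positivity,
    fun f hf => ?_⟩
  have hgm : Measurable fun x => f x ^ (-τ) * (1 + ‖x‖) ^ p :=
    (hf.1.1.pow_const _).mul (by fun_prop)
  rw [lintegral_densityLaw hf.1 _ hgm]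
  have hpt : ∀ x, ENNReal.ofReal (f x * (f x ^ (-τ) * (1 + ‖x‖) ^ p)) ≤
      ENNReal.ofReal (2 ^ θ.α) * (ENNReal.ofReal (f x) + ENNReal.ofReal (‖x‖ ^ θ.α * f x)) +
        ENNReal.ofReal ((1 + ‖x‖) ^ (-q)) := by
    intro x
    have hfx := hf.1.2.1 x
    have h1 : (0 : ℝ) < 1 + ‖x‖ := by positivity
    rw [← ENNReal.ofReal_add hfx (by positivity), ← ENNReal.ofReal_mul (by positivity),
      ← ENNReal.ofReal_add (by positivity) (by positivity)]
    refine ENNReal.ofReal_le_ofReal ?_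
    rcases hfx.eq_or_lt with h0 | h0
    · rw [← h0]; simp only [zero_mul, mul_zero, add_zero]; positivity
    -- weighted arithmetic-geometric mean inequality
    have h2 := Real.geom_mean_le_arith_mean2_weighted (w₁ := 1 - τ) (w₂ := τ)
      (p₁ := f x * (1 + ‖x‖) ^ θ.α) (p₂ := (1 + ‖x‖) ^ (-q)) (by linarith) hτ.le (by positivity)
      (by positivity) (by ring)
    have e : (f x * (1 + ‖x‖) ^ θ.α) ^ (1 - τ) * ((1 + ‖x‖) ^ (-q)) ^ τ =
        f x * (f x ^ (-τ) * (1 + ‖x‖) ^ p) := by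
      rw [Real.mul_rpow hfx (by positivity), ← Real.rpow_mul h1.le, ← Real.rpow_mul h1.le,
        mul_assoc, ← Real.rpow_add h1, ← mul_assoc (f x)]
      congr 1
      · rw [sub_eq_add_neg, Real.rpow_add h0, Real.rpow_one]
      · congr 1
        rw [hq]; field_simp; ring
    rw [e] at h2
    refine h2.trans (add_le_add ?_ ?_)
    · refine (mul_le_of_le_one_left (by positivity) (by linarith)).trans ?_
      calc f x * (1 + ‖x‖) ^ θ.α ≤ f x * (2 ^ θ.α * (1 + ‖x‖ ^ θ.α)) :=
            mul_le_mul_of_nonneg_left (rpow_one_add_norm_le θ.α_pos.le (norm_nonneg x)) hfx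
        _ = _ := by ring
    · exact mul_le_of_le_one_left (by positivity) hτ1.le
  refine (lintegral_mono hpt).trans ?_
  have hm1 : Measurable fun x => ENNReal.ofReal (f x) := hf.1.1.ennreal_ofReal
  have hm2 : Measurable fun x : EuclideanSpace ℝ (Fin d) => ENNReal.ofReal ((1 + ‖x‖) ^ (-q)) := by
    fun_prop
  rw [lintegral_add_right _ hm2, lintegral_const_mul' _ _ ENNReal.ofReal_ne_top,
    lintegral_add_left hm1, hf.1.2.2, ← ofReal_integral_eq_lintegral_ofReal hint
      (.of_forall fun x => by positivity),
    ENNReal.ofReal_add (by positivity) hJ, ENNReal.ofReal_mul (by positivity),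
    ENNReal.ofReal_add zero_le_one hν.le, ENNReal.ofReal_one]
  gcongr
  exact hf.2.2.1

theorem neg_log_le_rpow {v η : ℝ} (hv : 0 < v) (hη : 0 < η) : -Real.log v ≤ v ^ (-η) / η := by
  rw [← Real.log_inv, Real.rpow_neg hv.le, ← Real.inv_rpow hv.le]
  exact Real.log_le_rpow_div (by positivity) hη

/-- Comparison of powers on a bounded interval. -/
theorem rpow_le_two_rpow_mul {z p q Q : ℝ} (hz : 0 < z) (hz2 : z ≤ 2) (hpq : p ≤ q)
    (hqQ : q - p ≤ Q) : z ^ q ≤ 2 ^ Q * z ^ p := by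
  rw [show q = (q - p) + p by ring, Real.rpow_add hz]
  refine mul_le_mul_of_nonneg_right ?_ (by positivity)
  exact (Real.rpow_le_rpow hz.le hz2 (by linarith)).trans
    (Real.rpow_le_rpow_of_exponent_le one_le_two hqQ)

/-- The error of the truncated expansion, at all radii `r`. Up to `goodRadius` it is controlled by
the expansion; beyond, the mass `h` of the ball is at least a multiple of `goodMass`, so that a
positive power of their ratio is bounded below. -/
theorem exists_truncated_expansion_bound (hd : 1 ≤ d) (θ : Theta) {τ η : ℝ} (hτ : 0 < τ)
    (hη : 0 < η) (hτβ : τ ≤ θ.β / d) (p : ℕ → Prop) [DecidablePred p]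
    (hp : ∀ l : ℕ, p l → 2 / (d : ℝ) * l ≤ τ) (hnp : ∀ l : ℕ, ¬p l → τ ≤ 2 / (d : ℝ) * l) :
    ∃ C : ℝ, 0 ≤ C ∧ ∀ f ∈ densityClass d θ, ∀ x, 0 < f x → ∀ r, 0 < r →
      |logRatio f x r - ∑ l ∈ (Icc 1 (smoothnessOrder θ.β / 2)).filter p,
        expansionCoef f l x * (ballMass (densityLaw f) x r ^ (2 / (d : ℝ))) ^ l| ≤
      C * goodMass d θ (f x) ^ (-(τ + η)) * (ballMass (densityLaw f) x r ^ τ * (1 + r ^ η)) := by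
  obtain ⟨hL1, hL2, -⟩ := order_bounds θ
  obtain ⟨K, hK, h⟩ := exists_expansionCoef_bound hd θ
  obtain ⟨w, hw1, hwγ, hw⟩ := exists_goodMass_le hd θ
  have hd0 : (0 : ℝ) < d := by exact_mod_cast hd
  have hβ := θ.β_pos
  set L := smoothnessOrder θ.β / 2
  have hw0 : 0 < w := by linarith
  have hlogw : 0 ≤ Real.log (2 * w) := Real.log_nonneg (by linarith)
  -- `C₁` bounds `logRatio` beyond `goodRadius`, `C₀` the terms and the error of the expansion
  set C₁ := w ^ η * Real.log (2 * w) + w ^ η * (d / η) + 1 / η with hC₁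
  set C₀ := K * (1 + L) * 2 ^ (θ.β / d) * w ^ η with hC₀
  have hC₁0 : 0 ≤ C₁ := by positivity
  have hC₀0 : 0 ≤ C₀ := by positivity
  refine ⟨C₀ * 2 ^ τ + C₁ * 2 ^ τ, by positivity, fun f hf x hx r hr => ?_⟩
  obtain ⟨he, h⟩ := h f hf x hx
  have := hf.1.isProbabilityMeasure
  set v := goodMass d θ (f x) with hv
  set ρ := goodRadius d θ (f x) with hρ
  set m := ballMass (densityLaw f) x r with hm
  have hv0 : 0 < v := goodMass_pos hd hx
  have hρ0 : 0 < ρ := goodRadius_pos hd hx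
  have hvw : v ≤ w := hw _ hx (hf.2.2.2.1 x)
  have hV := unitBallVolume_pos d
  have hm0 : 0 < m := by
    have h1 := (h (min r ρ) (lt_min hr hρ0) (min_le_right _ _)).1
    refine lt_of_lt_of_le ?_ (h1.trans (ballMass_mono (min_le_left _ _)))
    have := lt_min hr hρ0
    positivity
  -- terms of the expansion, in terms of `z = m / v`
  set z := m / v with hz
  have hz0 : 0 < z := div_pos hm0 hv0
  have hterm : ∀ l ∈ Icc 1 L, |expansionCoef f l x * (m ^ (2 / (d : ℝ))) ^ l| ≤
      K * z ^ (2 / (d : ℝ) * l) := by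
    intro l hl
    rw [abs_mul, abs_of_pos (a := _ ^ l) (by positivity)]
    refine (mul_le_mul_of_nonneg_right (he l hl) (by positivity)).trans (le_of_eq ?_)
    rw [mul_assoc, ← mul_pow, Real.rpow_mul_natCast hz0.le, hz, Real.div_rpow hm0.le hv0.le]
    congr 2
    ring
  have hzτ : z ^ τ = v ^ (-τ) * m ^ τ := by
    rw [hz, Real.div_rpow hm0.le hv0.le, Real.rpow_neg hv0.le]; ring
  have hsplit : v ^ (-(τ + η)) = v ^ (-τ) * v ^ (-η) := by
    rw [← Real.rpow_add hv0]; congr 1; ring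
  have hone : 1 ≤ w ^ η * v ^ (-η) := by
    rw [Real.rpow_neg hv0.le, ← div_eq_mul_inv, one_le_div (by positivity)]
    exact Real.rpow_le_rpow hv0.le hvw hη.le
  have hrη : 0 < r ^ η := Real.rpow_pos_of_pos hr _
  have hvη : 0 < v ^ (-η) := Real.rpow_pos_of_pos hv0 _
  have hcard : ∀ s : Finset ℕ, s ⊆ Icc 1 L → (s.card : ℝ) ≤ L := by
    intro s hs
    have := card_le_card hs
    rw [Nat.card_Icc, Nat.add_sub_cancel] at this
    exact_mod_cast this
  have h2τ : (1 : ℝ) ≤ 2 ^ τ := Real.one_le_rpow one_le_two hτ.le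
  -- it suffices to bound the error by `(C₀ v^{-η} + C₁ v^{-η} (1 + r^η)) (2 z)^τ`
  suffices hmain : |logRatio f x r - ∑ l ∈ (Icc 1 L).filter p,
      expansionCoef f l x * (m ^ (2 / (d : ℝ))) ^ l| ≤
      (C₀ * v ^ (-η) + C₁ * (v ^ (-η) * (1 + r ^ η))) * (2 ^ τ * z ^ τ) by
    refine hmain.trans ?_
    rw [hsplit, hzτ]
    have : C₀ * v ^ (-η) ≤ C₀ * (v ^ (-η) * (1 + r ^ η)) :=
      mul_le_mul_of_nonneg_left (le_mul_of_one_le_right hvη.le (by linarith)) hC₀0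
    calc _ ≤ (C₀ * (v ^ (-η) * (1 + r ^ η)) + C₁ * (v ^ (-η) * (1 + r ^ η))) *
          (2 ^ τ * (v ^ (-τ) * m ^ τ)) := by gcongr
      _ = _ := by ring
  have hzτ0 : 0 < z ^ τ := Real.rpow_pos_of_pos hz0 _
  rcases le_or_gt r ρ with hrρ | hrρ
  · -- here `z ≤ 2`, so that the omitted terms, with exponents at least `τ`, are `O(z ^ τ)`
    obtain ⟨h1, h2, h3⟩ := h r hr hrρ
    have hz2 : z ≤ 2 := by
      rw [hz, div_le_iff₀ hv0]
      have h4 : (r / ρ) ^ d ≤ 1 := pow_le_one₀ (by positivity) ((div_le_one hρ0).2 hrρ)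
      have : 5 / 4 * v * (r / ρ) ^ d ≤ 5 / 4 * v := mul_le_of_le_one_right (by positivity) h4
      linarith
    have hpow : ∀ q, τ ≤ q → q ≤ θ.β / d → z ^ q ≤ 2 ^ (θ.β / d) * z ^ τ := fun q h1 h2 =>
      rpow_le_two_rpow_mul hz0 hz2 h1 (by linarith)
    have hrest : |∑ l ∈ (Icc 1 L).filter (¬p ·),
        expansionCoef f l x * (m ^ (2 / (d : ℝ))) ^ l| ≤ L * (K * (2 ^ (θ.β / d) * z ^ τ)) := by
      refine (abs_sum_le_sum_abs _ _).trans ((sum_le_card_nsmul _ _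
        (K * (2 ^ (θ.β / d) * z ^ τ)) fun l hl => ?_).trans ?_)
      · obtain ⟨hl1, hl2⟩ := mem_filter.1 hl
        refine (hterm l hl1).trans (mul_le_mul_of_nonneg_left (hpow _ (hnp l hl2) ?_) hK)
        have : (l : ℝ) ≤ L := by exact_mod_cast (mem_Icc.1 hl1).2
        rw [div_mul_eq_mul_div]
        gcongr
        linarith
      · rw [nsmul_eq_mul]
        exact mul_le_mul_of_nonneg_right (hcard _ (filter_subset _ _)) (by positivity)
    have h4 : |logRatio f x r - ∑ l ∈ Icc 1 L, expansionCoef f l x * (m ^ (2 / (d : ℝ))) ^ l| ≤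
        K * (2 ^ (θ.β / d) * z ^ τ) :=
      h3.trans (mul_le_mul_of_nonneg_left (hpow _ hτβ le_rfl) hK)
    have e : logRatio f x r - ∑ l ∈ (Icc 1 L).filter p,
        expansionCoef f l x * (m ^ (2 / (d : ℝ))) ^ l =
        (logRatio f x r - ∑ l ∈ Icc 1 L, expansionCoef f l x * (m ^ (2 / (d : ℝ))) ^ l) +
        ∑ l ∈ (Icc 1 L).filter (¬p ·), expansionCoef f l x * (m ^ (2 / (d : ℝ))) ^ l := by
      rw [← sum_filter_add_sum_filter_not (Icc 1 L) p]; ring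
    rw [e]
    refine (abs_add_le _ _).trans ((add_le_add h4 hrest).trans ?_)
    have h5 : K * (1 + L) * 2 ^ (θ.β / d) ≤ C₀ * v ^ (-η) := by
      rw [hC₀, mul_assoc _ (w ^ η)]
      exact le_mul_of_one_le_right (by positivity) hone
    calc _ = (K * (1 + L) * 2 ^ (θ.β / d)) * z ^ τ := by ring
      _ ≤ (C₀ * v ^ (-η) + C₁ * (v ^ (-η) * (1 + r ^ η))) * (2 ^ τ * z ^ τ) := by
        refine mul_le_mul ?_ (le_mul_of_one_le_left hzτ0.le h2τ) hzτ0.le (by positivity)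
        have : 0 ≤ C₁ * (v ^ (-η) * (1 + r ^ η)) := by positivity
        linarith
  · -- here `1 ≤ 2 z`, so that the terms kept, with exponents at most `τ`, are `O((2 z) ^ τ)`
    have hmv : v ≤ 2 * m := by
      have h1 := (h ρ hρ0 le_rfl).1
      rw [div_self hρ0.ne', one_pow, mul_one] at h1
      have h2 : ballMass (densityLaw f) x ρ ≤ m := ballMass_mono hrρ.le
      linarith
    have hz1 : 1 ≤ 2 * z := by
      rw [hz, mul_div_assoc', le_div_iff₀ hv0]; linarith
    have h2z : (2 : ℝ) ^ τ * z ^ τ = (2 * z) ^ τ := (Real.mul_rpow (by norm_num) hz0.le).symm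
    have h1z : 1 ≤ (2 * z) ^ τ := Real.one_le_rpow hz1 hτ.le
    have hsum : |∑ l ∈ (Icc 1 L).filter p, expansionCoef f l x * (m ^ (2 / (d : ℝ))) ^ l| ≤
        L * (K * (2 * z) ^ τ) := by
      refine (abs_sum_le_sum_abs _ _).trans ((sum_le_card_nsmul _ _
        (K * (2 * z) ^ τ) fun l hl => ?_).trans ?_)
      · obtain ⟨hl1, hl2⟩ := mem_filter.1 hl
        refine (hterm l hl1).trans (mul_le_mul_of_nonneg_left ?_ hK)
        refine (Real.rpow_le_rpow hz0.le (by linarith : z ≤ 2 * z) (by positivity)).trans ?_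
        exact Real.rpow_le_rpow_of_exponent_le hz1 (hp l hl2)
      · rw [nsmul_eq_mul]
        exact mul_le_mul_of_nonneg_right (hcard _ (filter_subset _ _)) (by positivity)
    have hlog : |logRatio f x r| ≤ C₁ * (v ^ (-η) * (1 + r ^ η)) := by
      have hnum : 0 < unitBallVolume d * f x * r ^ d := by positivity
      have hlow : -(v ^ (-η) / η) ≤ logRatio f x r := by
        have h1 : v ≤ unitBallVolume d * f x * r ^ d / m := by
          rw [le_div_iff₀ hm0]
          refine (mul_le_of_le_one_right hv0.le (ballMass_le_one r)).trans ?_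
          rw [hv, goodMass]
          gcongr
        have h2 := Real.log_le_log hv0 h1
        have h3 := neg_log_le_rpow hv0 hη
        rw [logRatio]
        linarith
      have hup : logRatio f x r ≤ Real.log (2 * w) + d * (r ^ η / η) + v ^ (-η) / η := by
        rw [logRatio, Real.log_div hnum.ne' hm0.ne', Real.log_mul (by positivity) (by positivity),
          Real.log_pow]
        have h1 : Real.log (unitBallVolume d * f x) ≤ Real.log w :=
          Real.log_le_log (by positivity)
            ((mul_le_mul_of_nonneg_left (hf.2.2.2.1 x) hV.le).trans hwγ)
        have h2 : Real.log v ≤ Real.log 2 + Real.log m := by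
          rw [← Real.log_mul (by norm_num) hm0.ne']
          exact Real.log_le_log hv0 hmv
        have h3 := neg_log_le_rpow hv0 hη
        have h4 := mul_le_mul_of_nonneg_left (Real.log_le_rpow_div hr.le hη) hd0.le
        rw [Real.log_mul (by norm_num) hw0.ne']
        linarith
      have hbound : Real.log (2 * w) + d * (r ^ η / η) + v ^ (-η) / η ≤
          C₁ * (v ^ (-η) * (1 + r ^ η)) := by
        have e : C₁ * (v ^ (-η) * (1 + r ^ η)) =
            Real.log (2 * w) * (w ^ η * v ^ (-η)) * (1 + r ^ η) +
            (d / η) * (w ^ η * v ^ (-η)) * (1 + r ^ η) + v ^ (-η) / η * (1 + r ^ η) := by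
          rw [hC₁]; ring
        rw [e]
        refine add_le_add (add_le_add ?_ ?_) ?_
        · rw [mul_assoc]
          exact le_mul_of_one_le_right hlogw (one_le_mul_of_one_le_of_one_le hone (by linarith))
        · calc d * (r ^ η / η) = d / η * 1 * r ^ η := by ring
            _ ≤ _ := by gcongr; linarith
        · exact le_mul_of_one_le_right (by positivity) (by linarith)
      rw [abs_le]
      refine ⟨?_, hup.trans hbound⟩
      have : 0 ≤ Real.log (2 * w) + d * (r ^ η / η) := by positivity
      linarith
    have hX : 0 ≤ C₁ * (v ^ (-η) * (1 + r ^ η)) := by positivity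
    rw [h2z]
    refine (abs_sub _ _).trans ((add_le_add hlog hsum).trans ?_)
    have h5 : K * L ≤ C₀ * v ^ (-η) := by
      have h6 : (1 : ℝ) ≤ 2 ^ (θ.β / d) := Real.one_le_rpow one_le_two (by positivity)
      rw [hC₀, mul_assoc _ (w ^ η)]
      calc K * L ≤ K * (1 + L) * 2 ^ (θ.β / d) := by
            rw [mul_assoc]
            refine mul_le_mul_of_nonneg_left ?_ hK
            nlinarith [Nat.cast_nonneg (α := ℝ) L]
        _ ≤ _ := le_mul_of_one_le_right (by positivity) hone
    calc _ ≤ C₁ * (v ^ (-η) * (1 + r ^ η)) * (2 * z) ^ τ + K * L * (2 * z) ^ τ := by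
          refine add_le_add (le_mul_of_one_le_right hX h1z) (le_of_eq (by ring))
      _ ≤ _ := by
          have h6 := mul_le_mul_of_nonneg_right h5 (zero_le_one.trans h1z)
          linarith

end DensityClass

end

/-! ### The mean truncation error -/

section

variable {d : ℕ} {θ : Theta} {f : EuclideanSpace ℝ (Fin d) → ℝ}

/-- The joint law of `N` independent points with density `f`. -/
noncomputable def restLaw (f : EuclideanSpace ℝ (Fin d) → ℝ) (N : ℕ) :
    Measure (Fin N → EuclideanSpace ℝ (Fin d)) := Measure.pi fun _ => densityLaw f

/-- The mass of the ball about `x` that reaches out to the `k`-th nearest of the points `Y j`. -/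
noncomputable def neighbourMass (f : EuclideanSpace ℝ (Fin d) → ℝ) {N : ℕ} (k : ℕ)
    (x : EuclideanSpace ℝ (Fin d)) (Y : Fin N → EuclideanSpace ℝ (Fin d)) : ℝ :=
  ballMass (densityLaw f) x (kthDist k x Y)

theorem IsDensity.isProbabilityMeasure_restLaw (hf : IsDensity f) (N : ℕ) :
    IsProbabilityMeasure (restLaw f N) := by
  have := hf.isProbabilityMeasure
  rw [restLaw]; infer_instance

section FixedPoint

-- As before, the number of points `Y j` is `M + 1`, and the order of the neighbour is `κ + 1`.
variable {M κ : ℕ}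

theorem measurable_kthDist_pair (h : κ ≤ M) : Measurable
    fun p : EuclideanSpace ℝ (Fin d) × (Fin (M + 1) → EuclideanSpace ℝ (Fin d)) =>
      kthDist (κ + 1) p.1 p.2 :=
  measurable_kthDist (Nat.le_add_left 1 κ) (Nat.succ_le_succ h)

theorem measurable_neighbourMass_pair (hf : IsDensity f) (h : κ ≤ M) : Measurable
    fun p : EuclideanSpace ℝ (Fin d) × (Fin (M + 1) → EuclideanSpace ℝ (Fin d)) =>
      neighbourMass f (κ + 1) p.1 p.2 := by
  have := hf.isProbabilityMeasure
  exact measurable_ballMass_kthDist (Nat.le_add_left 1 κ) (Nat.succ_le_succ h)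

theorem measurable_neighbourMass (hf : IsDensity f) (h : κ ≤ M)
    (x : EuclideanSpace ℝ (Fin d)) : Measurable
    fun Y : Fin (M + 1) → EuclideanSpace ℝ (Fin d) => neighbourMass f (κ + 1) x Y := by
  have := hf.isProbabilityMeasure
  exact measurable_ballMass_kthDist_right (Nat.le_add_left 1 κ) (Nat.succ_le_succ h) x

theorem map_neighbourMass (hd : 1 ≤ d) (hf : IsDensity f) (h : κ ≤ M)
    (x : EuclideanSpace ℝ (Fin d)) :
    (restLaw f (M + 1)).map (fun Y => neighbourMass f (κ + 1) x Y) =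
      ProbabilityTheory.betaMeasure (κ + 1) (M + 1 - κ) := by
  have := hf.isProbabilityMeasure
  exact map_ballMass_kthDist (densityLaw_sphere hd f x) h

theorem ae_neighbourMass_mem (hd : 1 ≤ d) (hf : IsDensity f) (h : κ ≤ M)
    (x : EuclideanSpace ℝ (Fin d)) :
    ∀ᵐ Y ∂(restLaw f (M + 1)), neighbourMass f (κ + 1) x Y ∈ Set.Ioo (0 : ℝ) 1 := by
  refine ae_of_ae_map (measurable_neighbourMass hf h x).aemeasurable ?_
  rw [map_neighbourMass hd hf h x]
  exact betaMeasure_compl_Ioo _ _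

theorem kthDist_pos_of_neighbourMass_pos (hd : 1 ≤ d) {N k : ℕ} {x : EuclideanSpace ℝ (Fin d)}
    {Y : Fin N → EuclideanSpace ℝ (Fin d)} (h : 0 < neighbourMass f k x Y) : 0 < kthDist k x Y := by
  refine lt_of_le_of_ne (orderStat_nonneg _) fun h0 => ?_
  have h3 := densityLaw_sphere hd f x 0
  rw [Metric.sphere_zero] at h3
  rw [neighbourMass, ← h0, ballMass, Metric.closedBall_zero, Measure.real, h3] at h
  simp at h

theorem lintegral_neighbourMass_rpow (hd : 1 ≤ d) (hf : IsDensity f) (h : κ ≤ M)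
    (x : EuclideanSpace ℝ (Fin d)) {τ : ℝ} (hτ : 0 ≤ τ) :
    ∫⁻ Y, ENNReal.ofReal (neighbourMass f (κ + 1) x Y ^ τ) ∂(restLaw f (M + 1)) =
      ENNReal.ofReal (Real.Gamma (κ + 1 + τ) * Real.Gamma (M + 2) /
        (Real.Gamma (κ + 1) * Real.Gamma (M + 2 + τ))) := by
  have hp := beta_params_pos h
  have h1 := lintegral_rpow_betaMeasure hp.1 hp.2 hτ
  rw [← map_neighbourMass hd hf h x, lintegral_map (by fun_prop) (measurable_neighbourMass hf h x)]
    at h1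
  rw [h1]
  congr 3 <;> ring_nf

theorem lintegral_neighbourMass (hd : 1 ≤ d) (hf : IsDensity f) (h : κ ≤ M)
    (x : EuclideanSpace ℝ (Fin d)) :
    ∫⁻ Y, ENNReal.ofReal (neighbourMass f (κ + 1) x Y) ∂(restLaw f (M + 1)) =
      ENNReal.ofReal ((κ + 1) / (M + 2)) := by
  have h1 := lintegral_neighbourMass_rpow hd hf h x zero_le_one
  simp_rw [Real.rpow_one] at h1
  rw [h1]
  have hκ : (0 : ℝ) < κ + 1 := by positivity
  have hM : (0 : ℝ) < M + 2 := by positivity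
  rw [Real.Gamma_add_one hκ.ne', Real.Gamma_add_one hM.ne']
  have h2 := (Real.Gamma_pos_of_pos hκ).ne'
  have h3 := (Real.Gamma_pos_of_pos hM).ne'
  congr 1
  field_simp

theorem integral_log_neighbourMass (hd : 1 ≤ d) (hf : IsDensity f) (h : κ ≤ M)
    (x : EuclideanSpace ℝ (Fin d)) :
    Integrable (fun Y => Real.log (neighbourMass f (κ + 1) x Y)) (restLaw f (M + 1)) ∧
    ∫ Y, Real.log (neighbourMass f (κ + 1) x Y) ∂(restLaw f (M + 1)) =
      digamma (κ + 1 : ℕ) - digamma (M + 2 : ℕ) := by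
  obtain ⟨h1, h2⟩ := integral_log_betaMeasure h
  have hm := (measurable_neighbourMass hf h x).aemeasurable (μ := restLaw f (M + 1))
  rw [← map_neighbourMass hd hf h x] at h1 h2
  refine ⟨h1.comp_aemeasurable hm, ?_⟩
  rw [integral_map hm Real.measurable_log.aestronglyMeasurable] at h2
  rw [h2, sum_Ico_eq_harmonic_sub h, digamma_natCast_succ,
    show M + 2 = (M + 1) + 1 from rfl, digamma_natCast_succ]
  ring

/-- Moments of the nearest neighbour distance. Since at least half of the points are no closer than
the `k`-th nearest neighbour, its distance is at most twice an average. -/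
theorem lintegral_kthDist_rpow_le (hf : f ∈ densityClass d θ) (h2 : 2 * κ ≤ M + 1)
    (x : EuclideanSpace ℝ (Fin d)) {p : ℝ} (hp0 : 0 < p) (hp1 : p ≤ 1) (hpα : p ≤ θ.α) :
    ∫⁻ Y : Fin (M + 1) → EuclideanSpace ℝ (Fin d),
      ENNReal.ofReal (kthDist (κ + 1) x Y ^ p) ∂(restLaw f (M + 1)) ≤
      ENNReal.ofReal (2 * (2 + θ.ν) * (1 + ‖x‖) ^ p) := by
  have := hf.1.isProbabilityMeasure
  have hν := θ.ν_pos
  have hM : (0 : ℝ) < M + 1 := by positivity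
  have hpt : ∀ Y : Fin (M + 1) → EuclideanSpace ℝ (Fin d),
      ENNReal.ofReal (kthDist (κ + 1) x Y ^ p) ≤
      ENNReal.ofReal (2 / (M + 1)) * ∑ j, (ENNReal.ofReal (1 + ‖x‖ ^ p) +
        ENNReal.ofReal (‖Y j‖ ^ θ.α)) := by
    intro Y
    have h1 := orderStat_rpow_le_sum (k := κ + 1) (u := fun j => ‖Y j - x‖) (Nat.le_add_left 1 κ)
      (fun j => norm_nonneg _) hp0.le
    have h3 : ((M : ℝ) + 1) / 2 ≤ ((M + 1 : ℕ) : ℝ) - (κ + 1 : ℕ) + 1 := by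
      have : (2 : ℝ) * κ ≤ M + 1 := by exact_mod_cast h2
      push_cast
      linarith
    have h4 : ∀ j, ‖Y j - x‖ ^ p ≤ (1 + ‖x‖ ^ p) + ‖Y j‖ ^ θ.α := by
      intro j
      have h5 : ‖Y j - x‖ ^ p ≤ ‖Y j‖ ^ p + ‖x‖ ^ p :=
        (Real.rpow_le_rpow (norm_nonneg _) (norm_sub_le _ _) hp0.le).trans
          (Real.rpow_add_le_add_rpow (norm_nonneg _) (norm_nonneg _) hp0.le hp1)
      have h6 : ‖Y j‖ ^ p ≤ 1 + ‖Y j‖ ^ θ.α := by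
        have h7 : 0 ≤ ‖Y j‖ ^ θ.α := by positivity
        rcases le_total ‖Y j‖ 1 with hle | hge
        · linarith [Real.rpow_le_one (norm_nonneg (Y j)) hle hp0.le]
        · linarith [Real.rpow_le_rpow_of_exponent_le hge hpα]
      linarith
    have h8 : 0 ≤ kthDist (κ + 1) x Y ^ p := Real.rpow_nonneg (orderStat_nonneg _) _
    have h9 : kthDist (κ + 1) x Y ^ p ≤
        2 / (M + 1) * ∑ j, ((1 + ‖x‖ ^ p) + ‖Y j‖ ^ θ.α) := by
      have h10 := (mul_le_mul_of_nonneg_right h3 h8).trans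
        (h1.trans (sum_le_sum fun j _ => h4 j))
      rw [div_mul_eq_mul_div, le_div_iff₀ hM]
      linarith
    refine (ENNReal.ofReal_le_ofReal h9).trans (le_of_eq ?_)
    rw [ENNReal.ofReal_mul (by positivity), ENNReal.ofReal_sum_of_nonneg fun j _ => by positivity]
    congr 1
    exact sum_congr rfl fun j _ => ENNReal.ofReal_add (by positivity) (by positivity)
  have hmom : ∀ j : Fin (M + 1), ∫⁻ Y, ENNReal.ofReal (‖Y j‖ ^ θ.α) ∂(restLaw f (M + 1)) ≤
      ENNReal.ofReal θ.ν := by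
    intro j
    have hmp := measurePreserving_eval (fun _ : Fin (M + 1) => densityLaw f) j
    have hm : Measurable fun y : EuclideanSpace ℝ (Fin d) => ‖y‖ ^ θ.α := by fun_prop
    have h1 := hmp.lintegral_comp hm.ennreal_ofReal
    have h2 : ∫⁻ y, ENNReal.ofReal (‖y‖ ^ θ.α) ∂(densityLaw f) ≤ ENNReal.ofReal θ.ν := by
      rw [lintegral_densityLaw hf.1 _ hm]
      refine le_trans (le_of_eq (lintegral_congr fun y => ?_)) hf.2.2.1
      rw [mul_comm]
    exact h1.le.trans h2
  have := hf.1.isProbabilityMeasure_restLaw (M + 1)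
  refine (lintegral_mono hpt).trans ?_
  rw [lintegral_const_mul' _ _ ENNReal.ofReal_ne_top, lintegral_finsetSum _ fun j _ => by fun_prop]
  have hsum : ∑ j : Fin (M + 1), ∫⁻ Y, (ENNReal.ofReal (1 + ‖x‖ ^ p) +
      ENNReal.ofReal (‖Y j‖ ^ θ.α)) ∂(restLaw f (M + 1)) ≤
      ENNReal.ofReal ((M + 1) * (1 + ‖x‖ ^ p + θ.ν)) := by
    refine (sum_le_card_nsmul _ _ (ENNReal.ofReal (1 + ‖x‖ ^ p + θ.ν)) fun j _ => ?_).trans ?_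
    · rw [lintegral_add_left measurable_const, lintegral_const, measure_univ, mul_one,
        ENNReal.ofReal_add (by positivity) hν.le]
      gcongr
      exact hmom j
    · rw [card_univ, Fintype.card_fin, nsmul_eq_mul, ENNReal.ofReal_mul hM.le]
      refine le_of_eq ?_
      congr 1
      rw [← Nat.cast_one (R := ℝ), ← Nat.cast_add, ENNReal.ofReal_natCast]
  refine (mul_le_mul_right hsum _).trans ?_
  rw [← ENNReal.ofReal_mul (by positivity)]
  refine ENNReal.ofReal_le_ofReal ?_
  have h3 : ‖x‖ ^ p ≤ (1 + ‖x‖) ^ p :=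
    Real.rpow_le_rpow (norm_nonneg x) (by linarith) hp0.le
  have h4 : 1 ≤ (1 + ‖x‖) ^ p := Real.one_le_rpow (by linarith [norm_nonneg x]) hp0.le
  calc 2 / ((M : ℝ) + 1) * ((M + 1) * (1 + ‖x‖ ^ p + θ.ν)) = 2 * (1 + ‖x‖ ^ p + θ.ν) := by
        field_simp
    _ ≤ 2 * (2 + θ.ν) * (1 + ‖x‖) ^ p := by nlinarith

end FixedPoint

/-- The error of the expansion, truncated to the orders `l` with `p l`, at the `k`-th nearest
neighbour. -/
noncomputable def truncError (θ : Theta) (p : ℕ → Prop) [DecidablePred p]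
    (f : EuclideanSpace ℝ (Fin d) → ℝ) {N : ℕ} (k : ℕ)
    (z : EuclideanSpace ℝ (Fin d) × (Fin N → EuclideanSpace ℝ (Fin d))) : ℝ :=
  logRatio f z.1 (kthDist k z.1 z.2) - ∑ l ∈ (Icc 1 (smoothnessOrder θ.β / 2)).filter p,
    expansionCoef f l z.1 * (neighbourMass f k z.1 z.2 ^ (2 / (d : ℝ))) ^ l

theorem measurable_truncError (hf : IsDensity f) (p : ℕ → Prop) [DecidablePred p] {M κ : ℕ}
    (h : κ ≤ M) : Measurable (truncError θ p f (N := M + 1) (κ + 1)) := by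
  have hR := measurable_kthDist_pair (d := d) h
  have hS := measurable_neighbourMass_pair hf h
  refine Measurable.sub ?_ ?_
  · exact (((measurable_const.mul (hf.1.comp measurable_fst)).mul (hR.pow_const d)).div hS).log
  · exact Finset.measurable_sum _ fun l _ =>
      ((measurable_expansionCoef hf l).comp measurable_fst).mul ((hS.pow_const _).pow_const l)

theorem ae_pos_densityLaw (hf : IsDensity f) : ∀ᵐ x ∂(densityLaw f), 0 < f x := by
  rw [densityLaw, ae_withDensity_iff hf.1.ennreal_ofReal]
  exact .of_forall fun x hx => by simpa using hx

/-- Weighted arithmetic-geometric mean inequality, in the form used for the error term. -/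
theorem rpow_mul_one_add_rpow_le {s s₀ R τ p : ℝ} (hs : 0 ≤ s) (hs₀ : 0 < s₀) (hR : 0 ≤ R)
    (hτ : 0 < τ) (hτ1 : τ < 1) :
    s ^ τ * (1 + R ^ (p * (1 - τ))) ≤ 2 * s₀ ^ τ * (1 + R ^ p + s / s₀) := by
  have h1 := Real.geom_mean_le_arith_mean2_weighted (w₁ := τ) (w₂ := 1 - τ) (p₁ := s / s₀)
    (p₂ := 1) hτ.le (by linarith) (by positivity) zero_le_one (by ring)
  have h2 := Real.geom_mean_le_arith_mean2_weighted (w₁ := τ) (w₂ := 1 - τ) (p₁ := s / s₀)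
    (p₂ := R ^ p) hτ.le (by linarith) (by positivity) (by positivity) (by ring)
  rw [Real.one_rpow, mul_one, mul_one] at h1
  rw [← Real.rpow_mul hR] at h2
  have h3 : s ^ τ = s₀ ^ τ * (s / s₀) ^ τ := by
    rw [← Real.mul_rpow hs₀.le (by positivity), mul_div_cancel₀ _ hs₀.ne']
  have h4 : 0 ≤ s / s₀ := by positivity
  have h5 : 0 ≤ R ^ p := by positivity
  have h6 : τ * (s / s₀) ≤ s / s₀ := mul_le_of_le_one_left h4 hτ1.le
  have h7 : (1 - τ) * R ^ p ≤ R ^ p := mul_le_of_le_one_left h5 (by linarith)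
  rw [h3]
  calc s₀ ^ τ * (s / s₀) ^ τ * (1 + R ^ (p * (1 - τ)))
      = s₀ ^ τ * ((s / s₀) ^ τ + (s / s₀) ^ τ * R ^ (p * (1 - τ))) := by ring
    _ ≤ s₀ ^ τ * (2 * (1 + R ^ p + s / s₀)) := by
        refine mul_le_mul_of_nonneg_left ?_ (by positivity)
        linarith
    _ = _ := by ring

/-- The mean truncation error, for one point of the sample and its `k`-th nearest neighbour among
`N = M + 1` others, `k = κ + 1`, is of order `(k / (N + 1)) ^ τ`, uniformly over the class. -/
theorem exists_lintegral_truncError_le (hd : 1 ≤ d) (θ : Theta) {τ : ℝ} (hτ : 0 < τ)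
    (hτα : τ < θ.α / (θ.α + d)) (hτβ : τ ≤ θ.β / d) (p : ℕ → Prop) [DecidablePred p]
    (hp : ∀ l : ℕ, p l → 2 / (d : ℝ) * l ≤ τ) (hnp : ∀ l : ℕ, ¬p l → τ ≤ 2 / (d : ℝ) * l) :
    ∃ C : ℝ, 0 ≤ C ∧ ∀ M κ : ℕ, κ ≤ M → 2 * κ ≤ M + 1 → ∀ f ∈ densityClass d θ,
      ∫⁻ z, ‖truncError θ p f (N := M + 1) (κ + 1) z‖ₑ
        ∂((densityLaw f).prod (restLaw f (M + 1))) ≤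
      ENNReal.ofReal (C * (((κ : ℝ) + 1) / (M + 2)) ^ τ) := by
  have hα := θ.α_pos
  have hν := θ.ν_pos
  have hd0 : (0 : ℝ) < d := by exact_mod_cast hd
  have hslack : 0 < θ.α - τ * (θ.α + d) := by
    rw [lt_div_iff₀ (by positivity)] at hτα; linarith
  have hτ1 : τ < 1 := hτα.trans_le (by rw [div_le_one (by positivity)]; linarith)
  -- a small exponent `q`, for the moments of the nearest neighbour distance
  obtain ⟨q, hq0, hq1, hqα, hq⟩ : ∃ q : ℝ, 0 < q ∧ q ≤ 1 ∧ q ≤ θ.α ∧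
      (τ + 2 * q) * d + q < θ.α * (1 - (τ + 2 * q)) := by
    have hden : 0 < 2 * d + 2 * θ.α + 1 := by positivity
    refine ⟨min (min 1 θ.α) ((θ.α - τ * (θ.α + d)) / (2 * (2 * d + 2 * θ.α + 1))),
      by positivity, (min_le_left _ _).trans (min_le_left _ _),
      (min_le_left _ _).trans (min_le_right _ _), ?_⟩
    set q := min (min 1 θ.α) ((θ.α - τ * (θ.α + d)) / (2 * (2 * d + 2 * θ.α + 1)))
    have h1 : q ≤ (θ.α - τ * (θ.α + d)) / (2 * (2 * d + 2 * θ.α + 1)) := min_le_right _ _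
    rw [le_div_iff₀ (by positivity)] at h1
    nlinarith
  have hτ' : 0 < τ + 2 * q := by linarith
  have hτ'1 : τ + 2 * q < 1 := by
    by_contra! hcon
    have h1 : θ.α * (1 - (τ + 2 * q)) ≤ 0 :=
      mul_nonpos_of_nonneg_of_nonpos hα.le (by linarith)
    have h2 : 0 < (τ + 2 * q) * d := by positivity
    linarith
  have hη : 0 < q * (1 - τ) := mul_pos hq0 (by linarith)
  obtain ⟨C₁, hC₁, hpt⟩ := exists_truncated_expansion_bound hd θ hτ hη hτβ p hp hnp
  obtain ⟨C₂, hC₂, hmass⟩ := exists_goodMass_rpow_le hd θ (s := τ + q * (1 - τ))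
    (s' := τ + 2 * q) (by positivity) (by nlinarith)
  obtain ⟨C₃, hC₃, hmom⟩ := exists_lintegral_rpow_le d θ hτ' hτ'1 hq
  set B := 2 * C₁ * C₂ with hB
  set D := 2 + 2 * (2 + θ.ν) with hD
  refine ⟨B * D * C₃, by positivity, fun M κ h h2 f hf => ?_⟩
  have := hf.1.isProbabilityMeasure
  have := hf.1.isProbabilityMeasure_restLaw (M + 1)
  set s₀ : ℝ := ((κ : ℝ) + 1) / (M + 2) with hs₀
  have hs₀0 : 0 < s₀ := by positivity
  rw [lintegral_prod _ (measurable_truncError hf.1 p h).enorm.aemeasurable]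
  -- the inner integral
  have hinner : ∀ x, 0 < f x → ∫⁻ Y, ‖truncError θ p f (N := M + 1) (κ + 1) (x, Y)‖ₑ
      ∂(restLaw f (M + 1)) ≤
      ENNReal.ofReal (B * D * s₀ ^ τ) * ENNReal.ofReal (f x ^ (-(τ + 2 * q)) * (1 + ‖x‖) ^ q) := by
    intro x hx
    have hfx : 0 < f x ^ (-(τ + 2 * q)) := Real.rpow_pos_of_pos hx _
    have hae : ∀ᵐ Y ∂(restLaw f (M + 1)), ‖truncError θ p f (N := M + 1) (κ + 1) (x, Y)‖ₑ ≤
        ENNReal.ofReal (B * s₀ ^ τ * f x ^ (-(τ + 2 * q))) *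
          (ENNReal.ofReal 1 + ENNReal.ofReal (kthDist (κ + 1) x Y ^ q) +
            ENNReal.ofReal s₀⁻¹ * ENNReal.ofReal (neighbourMass f (κ + 1) x Y)) := by
      filter_upwards [ae_neighbourMass_mem hd hf.1 h x] with Y hY
      have hR := kthDist_pos_of_neighbourMass_pos hd hY.1
      have h1 := hpt f hf x hx _ hR
      have h3 := hmass (f x) hx (hf.2.2.2.1 x)
      have h4 := rpow_mul_one_add_rpow_le (p := q) hY.1.le hs₀0 hR.le hτ hτ1
      rw [neighbourMass] at h4
      rw [← ENNReal.ofReal_mul (by positivity), ← ENNReal.ofReal_add zero_le_one (by positivity),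
        ← ENNReal.ofReal_add (by positivity) (mul_nonneg (by positivity) hY.1.le),
        ← ENNReal.ofReal_mul (by positivity),
        ← ofReal_norm, Real.norm_eq_abs]
      refine ENNReal.ofReal_le_ofReal (h1.trans ?_)
      refine (mul_le_mul (mul_le_mul_of_nonneg_left h3 hC₁) h4 ?_ (by positivity)).trans
        (le_of_eq ?_)
      · exact mul_nonneg (Real.rpow_nonneg measureReal_nonneg _) (by positivity)
      · rw [hB, neighbourMass, div_eq_inv_mul]; ring
    refine (lintegral_mono_ae hae).trans ?_
    have hmR : Measurable fun Y : Fin (M + 1) → EuclideanSpace ℝ (Fin d) =>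
        ENNReal.ofReal (kthDist (κ + 1) x Y ^ q) :=
      ((measurable_kthDist_right (Nat.le_add_left 1 κ) (Nat.succ_le_succ h) x).pow_const
        q).ennreal_ofReal
    have hmR' : Measurable fun Y : Fin (M + 1) → EuclideanSpace ℝ (Fin d) =>
        ENNReal.ofReal 1 + ENNReal.ofReal (kthDist (κ + 1) x Y ^ q) := measurable_const.add hmR
    rw [lintegral_const_mul' _ _ ENNReal.ofReal_ne_top,
      lintegral_add_left hmR', lintegral_add_left measurable_const,
      lintegral_const_mul' _ _ ENNReal.ofReal_ne_top, lintegral_neighbourMass hd hf.1 h x,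
      ← hs₀, lintegral_const, measure_univ, mul_one, ← ENNReal.ofReal_mul (by positivity),
      inv_mul_cancel₀ hs₀0.ne']
    have h5 := lintegral_kthDist_rpow_le hf h2 x hq0 hq1 hqα
    refine (mul_le_mul_right (add_le_add_left (add_le_add_right h5 _) _) _).trans ?_
    rw [← ENNReal.ofReal_add zero_le_one (by positivity),
      ← ENNReal.ofReal_add (by positivity) zero_le_one, ← ENNReal.ofReal_mul (by positivity),
      ← ENNReal.ofReal_mul (by positivity)]
    refine ENNReal.ofReal_le_ofReal ?_
    have h6 : 1 ≤ (1 + ‖x‖) ^ q := Real.one_le_rpow (by linarith [norm_nonneg x]) hq0.le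
    calc B * s₀ ^ τ * f x ^ (-(τ + 2 * q)) * (1 + 2 * (2 + θ.ν) * (1 + ‖x‖) ^ q + 1)
        ≤ B * s₀ ^ τ * f x ^ (-(τ + 2 * q)) * (D * (1 + ‖x‖) ^ q) := by
          refine mul_le_mul_of_nonneg_left ?_ (by positivity)
          rw [hD]; linarith
      _ = _ := by ring
  refine (lintegral_mono_ae ((ae_pos_densityLaw hf.1).mono hinner)).trans ?_
  rw [lintegral_const_mul' _ _ ENNReal.ofReal_ne_top]
  refine (mul_le_mul_right (hmom f hf) _).trans (le_of_eq ?_)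
  rw [← ENNReal.ofReal_mul (by positivity)]
  congr 1
  ring

end

/-! ### The mean of the estimator -/

section

variable {d : ℕ} {θ : Theta} {f : EuclideanSpace ℝ (Fin d) → ℝ}

theorem measurableSet_posSet (hf : IsDensity f) : MeasurableSet (posSet f) :=
  measurableSet_lt measurable_const hf.1

theorem mul_eq_zero_of_notMem_posSet (hf : IsDensity f) (g : EuclideanSpace ℝ (Fin d) → ℝ)
    {x : EuclideanSpace ℝ (Fin d)} (hx : x ∉ posSet f) : f x * g x = 0 := by
  have : f x = 0 := le_antisymm (not_lt.1 hx) (hf.2.1 x)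
  rw [this, zero_mul]

theorem integral_densityLaw (hf : IsDensity f) (g : EuclideanSpace ℝ (Fin d) → ℝ) :
    ∫ x, g x ∂(densityLaw f) = ∫ x in posSet f, f x * g x := by
  rw [densityLaw, integral_withDensity_eq_integral_toReal_smul hf.1.ennreal_ofReal
    (.of_forall fun _ => ENNReal.ofReal_lt_top),
    setIntegral_eq_integral_of_forall_compl_eq_zero fun x => mul_eq_zero_of_notMem_posSet hf g]
  refine integral_congr_ae (.of_forall fun x => ?_)
  simp only [smul_eq_mul, ENNReal.toReal_ofReal (hf.2.1 x)]

theorem integrable_densityLaw_iff (hf : IsDensity f) (g : EuclideanSpace ℝ (Fin d) → ℝ) :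
    Integrable g (densityLaw f) ↔ IntegrableOn (fun x => f x * g x) (posSet f) := by
  rw [densityLaw, integrable_withDensity_iff_integrable_smul' hf.1.ennreal_ofReal
    (.of_forall fun _ => ENNReal.ofReal_lt_top),
    integrableOn_iff_integrable_of_support_subset]
  · refine integrable_congr (.of_forall fun x => ?_)
    simp only [smul_eq_mul, ENNReal.toReal_ofReal (hf.2.1 x)]
  · intro x hx
    by_contra h
    exact hx (mul_eq_zero_of_notMem_posSet hf g h)

theorem exists_integral_rpow_le (d : ℕ) (θ : Theta) {τ : ℝ} (hτ : 0 < τ)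
    (hτα : τ < θ.α / (θ.α + d)) :
    ∃ C : ℝ, ∀ f ∈ densityClass d θ,
      Integrable (fun x => f x ^ (-τ)) (densityLaw f) ∧ ∫ x, f x ^ (-τ) ∂(densityLaw f) ≤ C := by
  have hα := θ.α_pos
  have hτ1 : τ < 1 := hτα.trans_le (by
    rw [div_le_one (by positivity)]; linarith [(Nat.cast_nonneg d : (0 : ℝ) ≤ d)])
  rw [lt_div_iff₀ (by positivity)] at hτα
  obtain ⟨C, hC, h⟩ := exists_lintegral_rpow_le d θ (p := 0) hτ hτ1 (by linarith)
  refine ⟨C, fun f hf => ?_⟩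
  have h1 := h f hf
  simp_rw [Real.rpow_zero, mul_one] at h1
  have hm : Measurable fun x => f x ^ (-τ) := hf.1.1.pow_const _
  have h0 : ∀ x, 0 ≤ f x ^ (-τ) := fun x => Real.rpow_nonneg (hf.1.2.1 x) _
  refine ⟨⟨hm.aestronglyMeasurable, ?_⟩, ?_⟩
  · rw [hasFiniteIntegral_iff_ofReal (.of_forall h0)]
    exact h1.trans_lt ENNReal.ofReal_lt_top
  · rw [integral_eq_lintegral_of_nonneg_ae (.of_forall h0) hm.aestronglyMeasurable]
    exact ENNReal.toReal_le_of_le_ofReal hC h1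

/-- The coefficients of the expansion are integrable, uniformly over the class, as long as the
moment condition allows. -/
theorem exists_integral_expansionCoef_le (hd : 1 ≤ d) (θ : Theta) {l : ℕ}
    (hl : l ∈ Icc 1 (smoothnessOrder θ.β / 2)) (hlα : 2 / (d : ℝ) * l < θ.α / (θ.α + d)) :
    ∃ B : ℝ, ∀ f ∈ densityClass d θ, Integrable (expansionCoef f l) (densityLaw f) ∧
      |∫ x, expansionCoef f l x ∂(densityLaw f)| ≤ B := by
  have hd0 : (0 : ℝ) < d := by exact_mod_cast hd
  have hl0 : (0 : ℝ) < l := by exact_mod_cast (mem_Icc.1 hl).1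
  obtain ⟨s, hs1, hs2⟩ := exists_between hlα
  have hs0 : 0 < 2 / (d : ℝ) * l := by positivity
  obtain ⟨K, hK, h⟩ := exists_expansionCoef_bound hd θ
  obtain ⟨C₁, hC₁, hmass⟩ := exists_goodMass_rpow_le hd θ hs0 hs1
  obtain ⟨C₂, hint⟩ := exists_integral_rpow_le d θ (hs0.trans hs1) hs2
  refine ⟨K * C₁ * C₂, fun f hf => ?_⟩
  have hb : ∀ᵐ x ∂(densityLaw f), ‖expansionCoef f l x‖ ≤ K * C₁ * f x ^ (-s) := by
    filter_upwards [ae_pos_densityLaw hf.1] with x hx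
    have h1 := (h f hf x hx).1 l hl
    have hg := goodMass_pos (θ := θ) hd hx
    have h2 : ((goodMass d θ (f x) ^ (2 / (d : ℝ)))⁻¹) ^ l =
        goodMass d θ (f x) ^ (-(2 / (d : ℝ) * l)) := by
      rw [← Real.rpow_neg hg.le, ← Real.rpow_natCast, ← Real.rpow_mul hg.le]
      ring_nf
    rw [h2] at h1
    rw [Real.norm_eq_abs, mul_assoc]
    exact h1.trans (mul_le_mul_of_nonneg_left (hmass _ hx (hf.2.2.2.1 x)) hK)
  have hi : Integrable (fun x => K * C₁ * f x ^ (-s)) (densityLaw f) :=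
    (hint f hf).1.const_mul _
  refine ⟨hi.mono' (measurable_expansionCoef hf.1 l).aestronglyMeasurable hb, ?_⟩
  rw [← Real.norm_eq_abs]
  refine (norm_integral_le_of_norm_le hi hb).trans ?_
  rw [integral_const_mul]
  exact mul_le_mul_of_nonneg_left (hint f hf).2 (by positivity)

theorem integrable_log_density (hf : f ∈ densityClass d θ) :
    Integrable (fun x => Real.log (f x)) (densityLaw f) := by
  have hα := θ.α_pos
  obtain ⟨η, hη0, hη⟩ := exists_between (show (0 : ℝ) < θ.α / (θ.α + d) by positivity)
  obtain ⟨C, hint⟩ := exists_integral_rpow_le d θ hη0 hη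
  have := hf.1.isProbabilityMeasure
  refine Integrable.mono' (((hint f hf).1.div_const η).add (integrable_const |Real.log θ.γ|))
    hf.1.1.log.aestronglyMeasurable ?_
  filter_upwards [ae_pos_densityLaw hf.1] with x hx
  have h1 := neg_log_le_rpow hx hη0
  have h2 := (Real.log_le_log hx (hf.2.2.2.1 x)).trans (le_abs_self _)
  have h3 : 0 ≤ f x ^ (-η) / η := by positivity
  rw [Real.norm_eq_abs]
  exact abs_le.2 ⟨by simp only [Pi.add_apply]; linarith [abs_nonneg (Real.log θ.γ)],
    by simp only [Pi.add_apply]; linarith⟩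

theorem integral_log_density (hf : IsDensity f) :
    ∫ x, Real.log (f x) ∂(densityLaw f) = -entropy f := by
  rw [entropy, neg_neg, integral_densityLaw hf]

/-- A product integral whose inner integral does not depend on the outer variable, up to a
factor. -/
theorem integrable_and_integral_prod_mul {X Y : Type*} [MeasurableSpace X] [MeasurableSpace Y]
    {μ : Measure X} {ν : Measure Y} [SFinite μ] [SFinite ν] {a : X → ℝ} {b : X × Y → ℝ} {c : ℝ}
    (ham : Measurable a) (ha : Integrable a μ) (hbm : Measurable b) (hb0 : ∀ z, 0 ≤ b z)
    (hb : ∀ x, Integrable (fun y => b (x, y)) ν) (hc : ∀ x, ∫ y, b (x, y) ∂ν = c) :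
    Integrable (fun z : X × Y => a z.1 * b z) (μ.prod ν) ∧
      ∫ z : X × Y, a z.1 * b z ∂(μ.prod ν) = c * ∫ x, a x ∂μ := by
  have hi : Integrable (fun z : X × Y => a z.1 * b z) (μ.prod ν) := by
    have hm : Measurable fun z : X × Y => a z.1 * b z := (ham.comp measurable_fst).mul hbm
    rw [integrable_prod_iff hm.aestronglyMeasurable]
    refine ⟨.of_forall fun x => (hb x).const_mul (a x), ?_⟩
    have : ∀ x, ∫ y, ‖a x * b (x, y)‖ ∂ν = ‖a x‖ * c := fun x => by
      simp_rw [norm_mul, Real.norm_of_nonneg (hb0 _)]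
      rw [integral_const_mul, hc]
    simp_rw [this]
    exact ha.norm.mul_const c
  refine ⟨hi, ?_⟩
  rw [integral_prod _ hi]
  simp_rw [integral_const_mul, hc]
  rw [integral_mul_const, mul_comm]

theorem integral_neighbourMass_rpow (hd : 1 ≤ d) (hf : IsDensity f) {M κ : ℕ} (h : κ ≤ M)
    (x : EuclideanSpace ℝ (Fin d)) (l : ℕ) :
    Integrable (fun Y => (neighbourMass f (κ + 1) x Y ^ (2 / (d : ℝ))) ^ l) (restLaw f (M + 1)) ∧
    ∫ Y, (neighbourMass f (κ + 1) x Y ^ (2 / (d : ℝ))) ^ l ∂(restLaw f (M + 1)) =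
      gammaFactor d (M + 2) (κ + 1) l := by
  have h0 : ∀ Y : Fin (M + 1) → EuclideanSpace ℝ (Fin d),
      0 ≤ (neighbourMass f (κ + 1) x Y ^ (2 / (d : ℝ))) ^ l := fun Y =>
    pow_nonneg (Real.rpow_nonneg (ballMass_nonneg _) _) _
  have hm := (((measurable_neighbourMass hf h x).pow_const (2 / (d : ℝ))).pow_const l)
  have h1 := lintegral_neighbourMass_rpow hd hf h x (τ := 2 * l / d) (by positivity)
  have h2 : ∀ Y : Fin (M + 1) → EuclideanSpace ℝ (Fin d),
      neighbourMass f (κ + 1) x Y ^ (2 * l / d : ℝ) =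
        (neighbourMass f (κ + 1) x Y ^ (2 / (d : ℝ))) ^ l := fun Y => by
    rw [neighbourMass, ← Real.rpow_mul_natCast (ballMass_nonneg _), div_mul_eq_mul_div]
  simp_rw [h2] at h1
  have h3 : 0 ≤ gammaFactor d (M + 2) (κ + 1) l := by
    have := Real.Gamma_pos_of_pos (s := (κ + 1 : ℕ) + 2 * l / d) (by positivity)
    have := Real.Gamma_pos_of_pos (s := (M + 2 : ℕ) + 2 * l / d) (by positivity)
    have := Real.Gamma_pos_of_pos (s := (κ + 1 : ℕ)) (by positivity)
    have := Real.Gamma_pos_of_pos (s := (M + 2 : ℕ)) (by positivity)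
    rw [gammaFactor]
    positivity
  have h4 : ∫⁻ Y, ENNReal.ofReal ((neighbourMass f (κ + 1) x Y ^ (2 / (d : ℝ))) ^ l)
      ∂(restLaw f (M + 1)) = ENNReal.ofReal (gammaFactor d (M + 2) (κ + 1) l) := by
    rw [h1, gammaFactor]
    push_cast
    rfl
  refine ⟨⟨hm.aestronglyMeasurable, ?_⟩, ?_⟩
  · rw [hasFiniteIntegral_iff_ofReal (.of_forall h0), h4]
    exact ENNReal.ofReal_lt_top
  · rw [integral_eq_lintegral_of_nonneg_ae (.of_forall h0) hm.aestronglyMeasurable, h4,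
      ENNReal.toReal_ofReal h3]

/-- The summand of the estimator, as a function of a sample point and of the other points. -/
noncomputable def klSummand {N : ℕ} (k : ℕ)
    (z : EuclideanSpace ℝ (Fin d) × (Fin N → EuclideanSpace ℝ (Fin d))) : ℝ :=
  Real.log (kthDist k z.1 z.2 ^ d * unitBallVolume d * (N : ℝ) / Real.exp (digamma k))

/-- Where nothing degenerates, the summand of the estimator splits into the mass of the ball
reaching out to the neighbour, whose law is known, the expansion, and its error. -/
theorem klSummand_eq (hd : 1 ≤ d) (θ : Theta) (p : ℕ → Prop) [DecidablePred p] {N k : ℕ}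
    (hN : 0 < N) {z : EuclideanSpace ℝ (Fin d) × (Fin N → EuclideanSpace ℝ (Fin d))}
    (hz : 0 < f z.1) (hS : 0 < neighbourMass f k z.1 z.2) :
    klSummand k z = truncError θ p f k z +
      ∑ l ∈ (Icc 1 (smoothnessOrder θ.β / 2)).filter p,
        expansionCoef f l z.1 * (neighbourMass f k z.1 z.2 ^ (2 / (d : ℝ))) ^ l +
      Real.log (neighbourMass f k z.1 z.2) - Real.log (f z.1) +
      (Real.log N - digamma k) := by
  have hR := kthDist_pos_of_neighbourMass_pos hd hS
  have hV := unitBallVolume_pos d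
  have hN' : (0 : ℝ) < N := by exact_mod_cast hN
  have hS' := hS
  rw [neighbourMass] at hS'
  rw [truncError, klSummand, logRatio, sub_add_cancel,
    Real.log_div (by positivity) (Real.exp_pos _).ne', Real.log_mul (by positivity) hN'.ne',
    Real.log_mul (by positivity) hV.ne', Real.log_exp, Real.log_div (by positivity) hS'.ne',
    Real.log_mul (by positivity) (by positivity), Real.log_mul hV.ne' hz.ne', neighbourMass]
  ring

/-- The bias of a single summand of the estimator. -/
theorem exists_integral_klSummand (hd : 1 ≤ d) (θ : Theta) {τ : ℝ} (hτ : 0 < τ)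
    (hτα : τ < θ.α / (θ.α + d)) (hτβ : τ ≤ θ.β / d) (p : ℕ → Prop) [DecidablePred p]
    (hp : ∀ l : ℕ, p l → 2 / (d : ℝ) * l ≤ τ) (hnp : ∀ l : ℕ, ¬p l → τ ≤ 2 / (d : ℝ) * l) :
    ∃ C : ℝ, 0 ≤ C ∧ ∀ M κ : ℕ, κ ≤ M → 2 * κ ≤ M + 1 → ∀ f ∈ densityClass d θ,
      Integrable (klSummand (N := M + 1) (κ + 1)) ((densityLaw f).prod (restLaw f (M + 1))) ∧
      |∫ z, klSummand (N := M + 1) (κ + 1) z ∂((densityLaw f).prod (restLaw f (M + 1))) -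
        entropy f - ∑ l ∈ (Icc 1 (smoothnessOrder θ.β / 2)).filter p,
          gammaFactor d (M + 2) (κ + 1) l * ∫ x, expansionCoef f l x ∂(densityLaw f)| ≤
      C * (((κ : ℝ) + 1) / (M + 2)) ^ τ := by
  have hα := θ.α_pos
  have hd0 : (0 : ℝ) < d := by exact_mod_cast hd
  have hτ1 : τ < 1 := hτα.trans_le (by rw [div_le_one (by positivity)]; linarith)
  obtain ⟨C, hC, herr⟩ := exists_lintegral_truncError_le hd θ hτ hτα hτβ p hp hnp
  refine ⟨C + 2, by positivity, fun M κ h h2 f hf => ?_⟩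
  have := hf.1.isProbabilityMeasure
  have := hf.1.isProbabilityMeasure_restLaw (M + 1)
  set μ := (densityLaw f).prod (restLaw f (M + 1)) with hμ
  set s : Finset ℕ := (Icc 1 (smoothnessOrder θ.β / 2)).filter p
  have hmS := measurable_neighbourMass_pair hf.1 h
  -- the error
  have hmE := measurable_truncError (θ := θ) hf.1 p h
  have hE1 : Integrable (truncError θ p f (N := M + 1) (κ + 1)) μ :=
    ⟨hmE.aestronglyMeasurable, (herr M κ h h2 f hf).trans_lt ENNReal.ofReal_lt_top⟩
  have hE2 : |∫ z, truncError θ p f (N := M + 1) (κ + 1) z ∂μ| ≤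
      C * (((κ : ℝ) + 1) / (M + 2)) ^ τ := by
    rw [← Real.norm_eq_abs]
    refine (norm_integral_le_lintegral_norm _).trans ?_
    refine ENNReal.toReal_le_of_le_ofReal (by positivity) ?_
    simp_rw [ofReal_norm]
    exact herr M κ h h2 f hf
  -- the expansion
  have hT : ∀ l ∈ s, Integrable (fun z => expansionCoef f l z.1 *
      (neighbourMass f (κ + 1) z.1 z.2 ^ (2 / (d : ℝ))) ^ l) μ ∧
      ∫ z, expansionCoef f l z.1 * (neighbourMass f (κ + 1) z.1 z.2 ^ (2 / (d : ℝ))) ^ l ∂μ =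
        gammaFactor d (M + 2) (κ + 1) l * ∫ x, expansionCoef f l x ∂(densityLaw f) := by
    intro l hl
    obtain ⟨hl1, hl2⟩ := mem_filter.1 hl
    obtain ⟨_, hB⟩ := exists_integral_expansionCoef_le hd θ hl1 ((hp l hl2).trans_lt hτα)
    exact integrable_and_integral_prod_mul (measurable_expansionCoef hf.1 l) (hB f hf).1
      ((hmS.pow_const _).pow_const l)
      (fun z => pow_nonneg (Real.rpow_nonneg (ballMass_nonneg _) _) _)
      (fun x => (integral_neighbourMass_rpow hd hf.1 h x l).1)
      (fun x => (integral_neighbourMass_rpow hd hf.1 h x l).2)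
  have hT1 := integrable_finsetSum s fun l hl => (hT l hl).1
  have hT2 := (integral_finsetSum s fun l hl => (hT l hl).1).trans
    (sum_congr rfl fun l hl => (hT l hl).2)
  -- the logarithms
  obtain ⟨hL1, hL2⟩ := integrable_and_integral_prod_mul (μ := densityLaw f)
    (ν := restLaw f (M + 1)) (a := fun _ => (-1 : ℝ))
    (b := fun z => -Real.log (neighbourMass f (κ + 1) z.1 z.2)) measurable_const
    (integrable_const _) hmS.log.neg
    (fun z => neg_nonneg.2 (Real.log_nonpos (ballMass_nonneg _) (ballMass_le_one _)))
    (fun x => (integral_log_neighbourMass hd hf.1 h x).1.neg)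
    (fun x => (integral_neg _).trans (congrArg _ (integral_log_neighbourMass hd hf.1 h x).2))
  obtain ⟨hF1, hF2⟩ := integrable_and_integral_prod_mul (ν := restLaw f (M + 1))
    (b := fun _ => (1 : ℝ)) hf.1.1.log (integrable_log_density hf) measurable_const
    (fun _ => zero_le_one) (fun x => integrable_const _) (fun x => by simp; rfl)
  simp only [one_mul, mul_one, integral_const, probReal_univ, smul_eq_mul, mul_neg, neg_mul,
    neg_neg] at hL1 hL2 hF1 hF2
  rw [integral_log_density hf.1] at hF2
  have hae : klSummand (N := M + 1) (κ + 1) =ᵐ[μ] fun z =>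
      truncError θ p f (κ + 1) z +
      ∑ l ∈ s, expansionCoef f l z.1 * (neighbourMass f (κ + 1) z.1 z.2 ^ (2 / (d : ℝ))) ^ l +
      Real.log (neighbourMass f (κ + 1) z.1 z.2) - Real.log (f z.1) +
      (Real.log (M + 1 : ℕ) - digamma (κ + 1 : ℕ)) := by
    have hset : MeasurableSet {z : EuclideanSpace ℝ (Fin d) ×
        (Fin (M + 1) → EuclideanSpace ℝ (Fin d)) |
        0 < f z.1 ∧ 0 < neighbourMass f (κ + 1) z.1 z.2} :=
      (measurableSet_lt measurable_const (hf.1.1.comp measurable_fst)).inter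
        (measurableSet_lt measurable_const hmS)
    have hpos : ∀ᵐ z ∂μ, 0 < f z.1 ∧ 0 < neighbourMass f (κ + 1) z.1 z.2 := by
      rw [hμ, Measure.ae_prod_iff_ae_ae hset]
      filter_upwards [ae_pos_densityLaw hf.1] with x hx
      filter_upwards [ae_neighbourMass_mem hd hf.1 h x] with Y hY
      exact ⟨hx, hY.1⟩
    filter_upwards [hpos] with z hz
    exact klSummand_eq hd θ p M.succ_pos hz.1 hz.2
  have hET := hE1.add hT1
  have hETL := hET.add hL1
  have hETLF := hETL.sub hF1
  refine ⟨(integrable_congr hae).2 (hETLF.add (integrable_const _)), ?_⟩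
  have hval : ∫ z, klSummand (N := M + 1) (κ + 1) z ∂μ =
      ∫ z, truncError θ p f (N := M + 1) (κ + 1) z ∂μ +
      ∑ l ∈ s, gammaFactor d (M + 2) (κ + 1) l * ∫ x, expansionCoef f l x ∂(densityLaw f) +
      (digamma (κ + 1 : ℕ) - digamma (M + 2 : ℕ)) - -entropy f +
      (Real.log (M + 1 : ℕ) - digamma (κ + 1 : ℕ)) := by
    rw [integral_congr_ae hae]
    refine (integral_add hETLF (integrable_const _)).trans ?_
    rw [integral_const, probReal_univ, one_smul]
    congr 1
    refine (integral_sub hETL hF1).trans (congrArg₂ _ ?_ hF2)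
    refine (integral_add hET hL1).trans (congrArg₂ _ ?_ hL2)
    exact (integral_add hE1 hT1).trans (congrArg _ hT2)
  have hdig := abs_log_sub_digamma_le (N := M + 1) M.succ_pos
  -- the difference of `log (n - 1)` and `Ψ(n)` is absorbed by the error, since `τ < 1`
  have hpow : 1 / ((M + 1 : ℕ) : ℝ) ≤ 2 * (((κ : ℝ) + 1) / (M + 2)) ^ τ := by
    have hκM : (κ : ℝ) ≤ M := by exact_mod_cast h
    have h3 : ((κ : ℝ) + 1) / (M + 2) ≤ (((κ : ℝ) + 1) / (M + 2)) ^ τ := by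
      conv_lhs => rw [← Real.rpow_one (((κ : ℝ) + 1) / (M + 2))]
      refine Real.rpow_le_rpow_of_exponent_ge (by positivity) ?_ hτ1.le
      rw [div_le_one (by positivity)]
      linarith
    refine le_trans ?_ (mul_le_mul_of_nonneg_left h3 zero_le_two)
    push_cast
    rw [← mul_div_assoc, div_le_div_iff₀ (by positivity) (by positivity)]
    nlinarith [(Nat.cast_nonneg κ : (0 : ℝ) ≤ κ), (Nat.cast_nonneg M : (0 : ℝ) ≤ M)]
  rw [hval]
  refine le_trans (le_of_eq ?_) ((abs_add_le _ _).trans (add_le_add hE2 (hdig.trans hpow)))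
    |>.trans (le_of_eq (by ring))
  congr 1
  ring

/-- Separating the `i`-th point of the sample from the others. -/
theorem klEstimator_eq {N k : ℕ} (X : Fin (N + 1) → EuclideanSpace ℝ (Fin d)) :
    klEstimator (N + 1) k X = (1 / ((N + 1 : ℕ) : ℝ)) * ∑ i : Fin (N + 1),
      klSummand k (MeasurableEquiv.piFinSuccAbove (fun _ => EuclideanSpace ℝ (Fin d)) i X) := by
  rw [klEstimator]
  congr 1
  refine sum_congr rfl fun i _ => ?_
  rw [nnDist_eq_kthDist, klSummand, Nat.cast_add_one, add_sub_cancel_right]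
  rfl

theorem integral_klEstimator (hf : IsDensity f) {N k : ℕ}
    (h : Integrable (klSummand (N := N) k) ((densityLaw f).prod (restLaw f N))) :
    Integrable (klEstimator (N + 1) k) (sampleLaw f (N + 1)) ∧
      ∫ X, klEstimator (N + 1) k X ∂(sampleLaw f (N + 1)) =
        ∫ z, klSummand (N := N) k z ∂((densityLaw f).prod (restLaw f N)) := by
  have := hf.isProbabilityMeasure
  have hmp (i : Fin (N + 1)) : MeasurePreserving
      (MeasurableEquiv.piFinSuccAbove (fun _ => EuclideanSpace ℝ (Fin d)) i) (sampleLaw f (N + 1))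
      ((densityLaw f).prod (restLaw f N)) :=
    measurePreserving_piFinSuccAbove (fun _ => densityLaw f) i
  have hi (i : Fin (N + 1)) : Integrable (fun X => klSummand k
      (MeasurableEquiv.piFinSuccAbove (fun _ => EuclideanSpace ℝ (Fin d)) i X))
      (sampleLaw f (N + 1)) := (hmp i).integrable_comp_of_integrable h
  have e : klEstimator (d := d) (N + 1) k = fun X => (1 / ((N + 1 : ℕ) : ℝ)) *
      ∑ i : Fin (N + 1),
        klSummand k (MeasurableEquiv.piFinSuccAbove (fun _ => EuclideanSpace ℝ (Fin d)) i X) :=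
    funext klEstimator_eq
  rw [e]
  refine ⟨(integrable_finsetSum _ fun i _ => hi i).const_mul _, ?_⟩
  rw [integral_const_mul, integral_finsetSum _ fun i _ => hi i,
    sum_congr rfl fun i _ => (hmp i).integral_comp' (klSummand k), sum_const, card_univ,
    Fintype.card_fin, nsmul_eq_mul]
  field_simp

/-- The exponent `τ` of the error term: so close to `α / (α + d)`, unless `β / d` is smaller, that
`2 l / d ≤ τ` holds for exactly those orders of the expansion for which the integral of the
coefficient is controlled. -/
theorem exists_exponent (hd : 1 ≤ d) (θ : Theta) {ε : ℝ} (hε : 0 < ε) :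
    ∃ τ : ℝ, 0 < τ ∧ τ < θ.α / (θ.α + d) ∧ τ ≤ θ.β / d ∧
      (∀ l ∈ Icc 1 (smoothnessOrder θ.β / 2),
        2 / (d : ℝ) * l ≤ τ ↔ 2 * (l : ℝ) < d * θ.α / (θ.α + d)) ∧
      ∀ k n : ℕ, 1 ≤ k → k ≤ n → ((k : ℝ) / n) ^ τ ≤
        max ((k : ℝ) ^ (θ.α / (θ.α + d) - ε) / (n : ℝ) ^ (θ.α / (θ.α + d) - ε))
          ((k : ℝ) ^ (θ.β / d) / (n : ℝ) ^ (θ.β / d)) := by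
  have hα := θ.α_pos
  have hβ := θ.β_pos
  have hd0 : (0 : ℝ) < d := by exact_mod_cast hd
  set A := θ.α / (θ.α + d) with hA
  have hA0 : 0 < A := by positivity
  have hev : ∀ᶠ t in nhdsWithin A (Set.Iio A), t < A ∧ 0 < t ∧ A - ε < t ∧
      ∀ l ∈ Icc 1 (smoothnessOrder θ.β / 2), 2 / (d : ℝ) * l < A → 2 / (d : ℝ) * l ≤ t := by
    refine Filter.Eventually.and self_mem_nhdsWithin
      (((lt_mem_nhds hA0).filter_mono nhdsWithin_le_nhds).and
      (((lt_mem_nhds (sub_lt_self A hε)).filter_mono nhdsWithin_le_nhds).and ?_))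
    rw [Filter.eventually_all_finset]
    intro l _
    by_cases hl : 2 / (d : ℝ) * l < A
    · exact ((lt_mem_nhds hl).filter_mono nhdsWithin_le_nhds).mono fun t ht _ => ht.le
    · exact .of_forall fun t h => absurd h hl
  obtain ⟨t, ht1, ht0, ht2, ht⟩ := hev.exists
  have hgood (l : ℕ) : 2 * (l : ℝ) < d * θ.α / (θ.α + d) ↔ 2 / (d : ℝ) * l < A := by
    rw [mul_div_assoc, ← hA, div_mul_eq_mul_div, div_lt_iff₀ hd0, mul_comm A]
  refine ⟨min t (θ.β / d), by positivity, (min_le_left _ _).trans_lt ht1, min_le_right _ _,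
    fun l hl => ?_, fun k n hk hkn => ?_⟩
  · rw [hgood]
    refine ⟨fun h => (h.trans (min_le_left _ _)).trans_lt ht1, fun h => le_min (ht l hl h) ?_⟩
    have h1 : (l : ℝ) ≤ (smoothnessOrder θ.β / 2 : ℕ) := by exact_mod_cast (mem_Icc.1 hl).2
    rw [div_mul_eq_mul_div]
    exact div_le_div_of_nonneg_right (by linarith [(order_bounds θ).1]) hd0.le
  · have hk0 : (0 : ℝ) < k := by exact_mod_cast hk
    have hn0 : (0 : ℝ) < n := by exact_mod_cast hk.trans hkn
    have hle : (k : ℝ) / n ≤ 1 := by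
      rw [div_le_one hn0]; exact_mod_cast hkn
    rw [← Real.div_rpow hk0.le hn0.le, ← Real.div_rpow hk0.le hn0.le]
    rcases min_choice t (θ.β / d) with h | h <;> rw [h]
    · exact le_max_of_le_left (Real.rpow_le_rpow_of_exponent_ge (by positivity) hle ht2.le)
    · exact le_max_right _ _

theorem eventually_two_mul_le {kstar : ℕ → ℕ} {ε₀ : ℝ} (hε₀ : 0 < ε₀)
    (h : Asymptotics.IsBigO Filter.atTop (fun n => (kstar n : ℝ))
      (fun n : ℕ => (n : ℝ) ^ (1 - ε₀))) : ∀ᶠ n : ℕ in Filter.atTop, 2 * kstar n ≤ n := by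
  obtain ⟨c, hc⟩ := h.bound
  have h1 : Filter.Tendsto (fun n : ℕ => c * (n : ℝ) ^ (-ε₀)) Filter.atTop (nhds (c * 0)) :=
    ((tendsto_rpow_neg_atTop hε₀).comp tendsto_natCast_atTop_atTop).const_mul c
  rw [mul_zero] at h1
  filter_upwards [hc, h1.eventually (gt_mem_nhds (show (0 : ℝ) < 1 / 2 by norm_num)),
    Filter.eventually_gt_atTop 0] with n hn h2 hn0
  have hn0' : (0 : ℝ) < n := by exact_mod_cast hn0
  rw [Real.norm_natCast, Real.norm_of_nonneg (by positivity), sub_eq_neg_add,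
    Real.rpow_add hn0', Real.rpow_one, ← mul_assoc] at hn
  have : (2 : ℝ) * kstar n ≤ n := by nlinarith
  exact_mod_cast this

/-- The bias expansion of the Kozachenko--Leonenko estimator, for all `k ≤ n / 2`. -/
theorem exists_bias_bound (hd : 1 ≤ d) (θ : Theta) {ε : ℝ} (hε : 0 < ε) :
    ∃ C : ℝ, ∀ n k : ℕ, 1 ≤ k → 2 * k ≤ n → ∀ f ∈ densityClass d θ,
      Integrable (klEstimator n k) (sampleLaw f n) ∧
      |∫ X, klEstimator n k X ∂(sampleLaw f n) - entropy f -
        ∑ l ∈ (Icc 1 (smoothnessOrder θ.β / 2)).filter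
          (fun l : ℕ => 2 * (l : ℝ) < d * θ.α / (θ.α + d)),
          gammaFactor d n k l * ∫ x, expansionCoef f l x ∂(densityLaw f)| ≤
      C * max ((k : ℝ) ^ (θ.α / (θ.α + d) - ε) / (n : ℝ) ^ (θ.α / (θ.α + d) - ε))
          ((k : ℝ) ^ (θ.β / d) / (n : ℝ) ^ (θ.β / d)) := by
  classical
  obtain ⟨τ, hτ, hτα, hτβ, hp, hmax⟩ := exists_exponent hd θ hε
  obtain ⟨C, hC, h⟩ := exists_integral_klSummand hd θ hτ hτα hτβ
    (fun l => 2 / (d : ℝ) * l ≤ τ) (fun _ h => h) (fun _ h => (not_le.1 h).le)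
  refine ⟨C, fun n k hk hkn f hf => ?_⟩
  obtain ⟨κ, rfl⟩ : ∃ κ, k = κ + 1 := ⟨k - 1, by omega⟩
  obtain ⟨M, rfl⟩ : ∃ M, n = M + 2 := ⟨n - 2, by omega⟩
  obtain ⟨h1, h2⟩ := h M κ (by omega) (by omega) f hf
  obtain ⟨h3, h4⟩ := integral_klEstimator hf.1 h1
  refine ⟨h3, ?_⟩
  rw [filter_congr hp] at h2
  rw [h4]
  refine h2.trans (mul_le_mul_of_nonneg_left ?_ hC)
  have h5 := hmax (κ + 1) (M + 2) hk (by omega)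
  rw [Nat.cast_add, Nat.cast_add, Nat.cast_one, Nat.cast_two] at h5 ⊢
  exact h5

/-- The first coefficient of the expansion, weighted with the density. -/
theorem mul_expansionCoef_one (hd : 1 ≤ d) (hβ : 2 < θ.β) (hf : f ∈ densityClass d θ)
    {x : EuclideanSpace ℝ (Fin d)} (hx : 0 < f x) :
    f x * expansionCoef f 1 x =
      -(1 / (2 * ((d : ℝ) + 2) * unitBallVolume d ^ (2 / (d : ℝ)))) *
        (Laplacian.laplacian f x / f x ^ (2 / (d : ℝ))) := by
  have hV := unitBallVolume_pos d
  rw [expansionCoef_one hd hβ hf hx, Real.mul_rpow hV.le hx.le]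
  have h1 : unitBallVolume d ^ (2 / (d : ℝ)) ≠ 0 := (Real.rpow_pos_of_pos hV _).ne'
  have h2 : f x ^ (2 / (d : ℝ)) ≠ 0 := (Real.rpow_pos_of_pos hx _).ne'
  field_simp

/-- The integral of the first coefficient of the expansion. -/
theorem integral_expansionCoef_one (hd : 3 ≤ d) (hα : 2 * (d : ℝ) / (d - 2) < θ.α) (hβ : 2 < θ.β)
    (hf : f ∈ densityClass d θ) :
    2 * ((1 : ℕ) : ℝ) < d * θ.α / (θ.α + d) ∧
    IntegrableOn (fun x => Laplacian.laplacian f x / f x ^ (2 / (d : ℝ))) (posSet f) ∧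
    ∫ x, expansionCoef f 1 x ∂(densityLaw f) =
      -(1 / (2 * ((d : ℝ) + 2) * unitBallVolume d ^ (2 / (d : ℝ))) *
        ∫ x in posSet f, Laplacian.laplacian f x / f x ^ (2 / (d : ℝ))) := by
  have hα0 := θ.α_pos
  have hd1 : 1 ≤ d := by omega
  have hd3 : (3 : ℝ) ≤ d := by exact_mod_cast hd
  have hV := Real.rpow_pos_of_pos (unitBallVolume_pos d) (2 / (d : ℝ))
  rw [div_lt_iff₀ (by linarith)] at hα
  have hgood : 2 * ((1 : ℕ) : ℝ) < d * θ.α / (θ.α + d) := by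
    rw [lt_div_iff₀ (by positivity)]
    push_cast
    linarith
  have hgood' : 2 / (d : ℝ) * (1 : ℕ) < θ.α / (θ.α + d) := by
    rw [mul_div_assoc] at hgood
    rw [div_mul_eq_mul_div, div_lt_iff₀ (by linarith)]
    linarith
  have hmem : 1 ∈ Icc 1 (smoothnessOrder θ.β / 2) := by
    refine mem_Icc.2 ⟨le_rfl, ?_⟩
    have := (order_bounds θ).2.1
    have h1 : (0 : ℝ) < (smoothnessOrder θ.β / 2 : ℕ) := by linarith
    exact_mod_cast h1
  obtain ⟨_, hB⟩ := exists_integral_expansionCoef_le hd1 θ hmem hgood'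
  have hms := measurableSet_posSet hf.1
  have heq : Set.EqOn (fun x => f x * expansionCoef f 1 x)
      (fun x => -(1 / (2 * ((d : ℝ) + 2) * unitBallVolume d ^ (2 / (d : ℝ)))) *
        (Laplacian.laplacian f x / f x ^ (2 / (d : ℝ)))) (posSet f) :=
    fun x hx => mul_expansionCoef_one hd1 hβ hf hx
  refine ⟨hgood, ?_, ?_⟩
  · have h1 := (integrable_densityLaw_iff hf.1 _).1 (hB f hf).1
    rw [integrableOn_congr_fun heq hms, IntegrableOn, integrable_const_mul_iff] at h1
    · exact h1
    · exact (neg_ne_zero.2 (by positivity)).isUnit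
  · rw [integral_densityLaw hf.1, setIntegral_congr_fun hms heq, integral_const_mul, neg_mul]

end

end KLEntropy

theorem mainTheorem5 (d : ℕ) (hd : 1 ≤ d) :
    -- coefficients that depend on `d`, `f` and `l` only
    ∃ Lam : (EuclideanSpace ℝ (Fin d) → ℝ) → ℕ → ℝ,
    ∀ θ : KLEntropy.Theta,
    ∃ lam : (EuclideanSpace ℝ (Fin d) → ℝ) → ℕ → ℝ,
      -- `lam` is `Lam`, except that it vanishes when `2 l ≥ d α / (α + d)`
      (∀ f, ∀ l : ℕ, ((d : ℝ) * θ.α / (θ.α + d) ≤ 2 * (l : ℝ) → lam f l = 0) ∧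
        (2 * (l : ℝ) < (d : ℝ) * θ.α / (θ.α + d) → lam f l = Lam f l)) ∧
      -- uniform boundedness
      (∃ B : ℝ, ∀ f ∈ KLEntropy.densityClass d θ,
        ∀ l ∈ Finset.Icc 1 (⌈θ.β / 2⌉₊ - 1), |lam f l| ≤ B) ∧
      -- the entropy is well defined
      (∀ f ∈ KLEntropy.densityClass d θ,
        MeasureTheory.IntegrableOn (fun x => f x * Real.log (f x)) (KLEntropy.posSet f)) ∧
      -- the bias expansion
      (∀ kstar : ℕ → ℕ, (∀ n, 0 < kstar n) →
        (∃ ε₀ : ℝ, 0 < ε₀ ∧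
          Asymptotics.IsBigO Filter.atTop (fun n => (kstar n : ℝ))
            (fun n : ℕ => (n : ℝ) ^ (1 - ε₀))) →
        ∀ ε : ℝ, 0 < ε →
        ∃ C : ℝ, ∀ᶠ n : ℕ in Filter.atTop, ∀ k ∈ Finset.Icc 1 (kstar n),
          ∀ f ∈ KLEntropy.densityClass d θ,
            MeasureTheory.Integrable (KLEntropy.klEstimator n k) (KLEntropy.sampleLaw f n) ∧
            |(∫ X, KLEntropy.klEstimator n k X ∂(KLEntropy.sampleLaw f n))
                - KLEntropy.entropy f
                - ∑ l ∈ Finset.Icc 1 (⌈θ.β / 2⌉₊ - 1), KLEntropy.gammaFactor d n k l * lam f l|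
              ≤ C * max
                  ((k : ℝ) ^ (θ.α / (θ.α + d) - ε) / (n : ℝ) ^ (θ.α / (θ.α + d) - ε))
                  ((k : ℝ) ^ (θ.β / d) / (n : ℝ) ^ (θ.β / d))) ∧
      -- the first coefficient
      (3 ≤ d → 2 * (d : ℝ) / (d - 2) < θ.α → 2 < θ.β →
        ∀ f ∈ KLEntropy.densityClass d θ,
          MeasureTheory.IntegrableOn
            (fun x => Laplacian.laplacian f x / f x ^ (2 / (d : ℝ))) (KLEntropy.posSet f) ∧
          lam f 1 = -(1 / (2 * ((d : ℝ) + 2) * KLEntropy.unitBallVolume d ^ (2 / (d : ℝ))) *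
            ∫ x in KLEntropy.posSet f,
              Laplacian.laplacian f x / f x ^ (2 / (d : ℝ)))) := by
  classical
  refine ⟨fun f l => ∫ x, KLEntropy.expansionCoef f l x ∂(KLEntropy.densityLaw f), fun θ =>
    ⟨fun f l => if 2 * (l : ℝ) < (d : ℝ) * θ.α / (θ.α + d) then
      ∫ x, KLEntropy.expansionCoef f l x ∂(KLEntropy.densityLaw f) else 0,
      fun f l => ⟨fun h => if_neg (not_lt.2 h), fun h => if_pos h⟩, ?_, ?_, ?_, ?_⟩⟩
  · -- a finite maximum over `l` of the bounds
    have hd0 : (0 : ℝ) < d := by exact_mod_cast hd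
    have h : ∀ l ∈ Finset.Icc 1 (⌈θ.β / 2⌉₊ - 1), ∃ B : ℝ, ∀ f ∈ KLEntropy.densityClass d θ,
        |if 2 * (l : ℝ) < (d : ℝ) * θ.α / (θ.α + d) then
          ∫ x, KLEntropy.expansionCoef f l x ∂(KLEntropy.densityLaw f) else 0| ≤ B := by
      intro l hl
      rw [(KLEntropy.order_bounds θ).2.2] at hl
      by_cases hg : 2 * (l : ℝ) < (d : ℝ) * θ.α / (θ.α + d)
      · simp only [if_pos hg]
        rw [mul_div_assoc] at hg
        obtain ⟨B, hB⟩ := KLEntropy.exists_integral_expansionCoef_le hd θ hl (by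
          rw [div_mul_eq_mul_div, div_lt_iff₀ hd0]; linarith)
        exact ⟨B, fun f hf => (hB f hf).2⟩
      · exact ⟨0, fun f _ => by rw [if_neg hg, abs_zero]⟩
    choose! B hB using h
    refine ⟨∑ l ∈ Finset.Icc 1 (⌈θ.β / 2⌉₊ - 1), |B l|, fun f hf l hl => ?_⟩
    exact ((hB l hl f hf).trans (le_abs_self _)).trans
      (Finset.single_le_sum (f := fun l => |B l|) (fun _ _ => abs_nonneg _) hl)
  · intro f hf
    exact (KLEntropy.integrable_densityLaw_iff hf.1 _).1 (KLEntropy.integrable_log_density hf)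
  · rintro kstar - ⟨ε₀, hε₀, hk⟩ ε hε
    obtain ⟨C, hC⟩ := KLEntropy.exists_bias_bound hd θ hε
    refine ⟨C, ?_⟩
    filter_upwards [KLEntropy.eventually_two_mul_le hε₀ hk] with n hn k hkn f hf
    have hk' := Finset.mem_Icc.1 hkn
    have h := hC n k hk'.1 (by omega) f hf
    rw [Finset.sum_filter] at h
    simp only [mul_ite, mul_zero, (KLEntropy.order_bounds θ).2.2]
    exact h
  · intro hd3 hα hβ f hf
    obtain ⟨h1, h2, h3⟩ := KLEntropy.integral_expansionCoef_one hd3 hα hβ hf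
    exact ⟨h2, (if_pos h1).trans h3⟩
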